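/- Let $V_0$ be a finite-dimensional $\mathbb Z$-graded complex vector space, $V=\mathbb C^d\times V_0$ the trivial holomorphic bundle, and let $(V,(-,-)_V,Q^{hol})$ be a free holomorphically translation invariant BV theory on $\mathbb C^d$. That is: $(-,-)_V\colon V\otimes V\to K_{\mathbb C^d}[d-1]$ is a graded skew-symmetric bundle map, equivariant for the translations $\partial/\partial z_i,\partial/\partial\bar z_i$, whose integral $\int_{\mathbb C^d}(-,-)_V$ is a non-degenerate pairing on compactly supported forms $\Omega^{0,*}_c(\mathbb C^d)\otimes V_0$; and $Q^{hol}=\sum_\alpha(\partial/\partial z)^\alpha\mu_\alpha$ is a finite sum with linear maps $\mu_\alpha\colon V_0\to V_0$ of degree $+1$, such that $(\bar\partial+Q^{hol})^2=0$ on $\mathcal E_V=\Omega^{0,*}(\mathbb C^d)\otimes V_0$ and $Q^{hol}$ is graded skew self-adjoint for $\int(-,-)_V$. Let $\mathcal O_{loc}(\mathcal E_V)$ be the graded space of local functionals without constant term: in degree $k$ its elements are sequences $(I_n)_{n\ge1}$ of graded symmetric $n$-linear functionals of degree $k$ on the compactly supported fields, each of which is the integral over $\mathbb C^d$ of a Lagrangian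 density (a polydifferential operator in the $n$ fields with smooth coefficients, of locally finite order). Operators on fields act on functionals as graded derivations. Let $\bar\eta_i$ denote contraction with $\partial/\partial\bar z_i$, and let $\mathcal O_{loc}(\mathcal E_V)^{\mathbb C^{2d|d}}\subset\mathcal O_{loc}(\mathcal E_V)$ be the subspace of functionals annihilated by all $\partial/\partial z_i$, $\partial/\partial\bar z_i$ and $\bar\eta_i$, $1\le i\le d$. Let $\mathcal O^{hol,trans}_{loc}(\mathcal E_V)\subset\mathcal O_{loc}(\mathcal E_V)$ be the subspace of those $(I_n)$ for which each $I_n$ is a finite sum of functionals $$(\varphi_1,\dots,\varphi_n)\longmapsto\int_{\mathbb C^d}F(D_1\varphi_1,\dots,D_n\varphi_n)\,d^dz,\qquad D_j\in\mathbb C[\partial/\partial z_1,\dots,\partial/\partial z_d],$$ where $F=\wedge\otimes F_0$ is the wedge product of forms combined with a linear map $F_0\colon V_0^{\otimes n}\to\mathbb C$. Then $\bar\partial+Q^{hol}$ squares to zero on functionals and preserves both subspaces, $\mathcal O^{hol,trans}_{loc}(\mathcal E_V)\subset\mathcal O_{loc}(\mathcal E_V)^{\mathbb C^{2d|d}}$,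 and the inclusion of cochain complexes $$\bigl(\mathcal O^{hol,trans}_{loc}(\mathcal E_V),\ \bar\partial+Q^{hol}\bigr)\hookrightarrow\bigl(\mathcal O_{loc}(\mathcal E_V)^{\mathbb C^{2d|d}},\ \bar\partial+Q^{hol}\bigr)$$ is a quasi-isomorphism. -/

import Mathlib

open scoped ContDiff
open MeasureTheory CategoryTheory

noncomputable section

namespace HolTrans

universe u

/-! ### Smooth functions on `ℂ^d` and the constant coefficient vector fields -/

/-- Smooth (in the real sense) complex valued functions on `ℂ^d`. -/
def Smooth (d : ℕ) : Subalgebra ℂ ((Fin d → ℂ) → ℂ) where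
  carrier := {f | ContDiff ℝ ∞ f}
  mul_mem' {f g} hf hg := by
    have hf' : ContDiff ℝ ∞ f := hf
    have hg' : ContDiff ℝ ∞ g := hg
    exact hf'.mul hg'
  add_mem' {f g} hf hg := by
    have hf' : ContDiff ℝ ∞ f := hf
    have hg' : ContDiff ℝ ∞ g := hg
    exact hf'.add hg'
  algebraMap_mem' c := by
    have h : ContDiff ℝ ∞ (fun _ : Fin d → ℂ => c) := contDiff_const
    exact h

theorem contDiff_smooth {d : ℕ} (f : Smooth d) : ContDiff ℝ ∞ f.1 := f.2

theorem differentiableAt_smooth {d : ℕ} (f : Smooth d) (x : Fin d → ℂ) :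
    DifferentiableAt ℝ f.1 x :=
  (contDiff_smooth f).differentiable (by simp) x

/-- Directional derivative along the real tangent vector `v`. -/
def dirDeriv (d : ℕ) (v : Fin d → ℂ) : Module.End ℂ (Smooth d) where
  toFun f := ⟨fun x => fderiv ℝ f.1 x v, by
    have h : ContDiff ℝ ∞ (fun x => fderiv ℝ f.1 x v) :=
      ((contDiff_smooth f).fderiv_right (m := ∞) (by simp)).clm_apply contDiff_const
    exact h⟩
  map_add' f g := by
    apply Subtype.ext
    funext x
    change fderiv ℝ (f.1 + g.1) x v = fderiv ℝ f.1 x v + fderiv ℝ g.1 x v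
    rw [fderiv_add (differentiableAt_smooth f x) (differentiableAt_smooth g x)]
    rfl
  map_smul' c f := by
    apply Subtype.ext
    funext x
    change fderiv ℝ (c • f.1) x v = c • fderiv ℝ f.1 x v
    rw [fderiv_const_smul (differentiableAt_smooth f x) c]
    rfl

/-- `∂/∂z_i = (∂/∂x_i - √-1 ∂/∂y_i) / 2`. -/
def dz {d : ℕ} (i : Fin d) : Module.End ℂ (Smooth d) :=
  (1 / 2 : ℂ) • (dirDeriv d (Pi.single i 1) - Complex.I • dirDeriv d (Pi.single i Complex.I))

/-- `∂/∂z̄_i = (∂/∂x_i + √-1 ∂/∂y_i) / 2`. -/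
def dzbar {d : ℕ} (i : Fin d) : Module.End ℂ (Smooth d) :=
  (1 / 2 : ℂ) • (dirDeriv d (Pi.single i 1) + Complex.I • dirDeriv d (Pi.single i Complex.I))

/-- Compactly supported smooth functions on `ℂ^d`. -/
def Test (d : ℕ) : Submodule ℂ (Smooth d) where
  carrier := {f | HasCompactSupport f.1}
  add_mem' hf hg := HasCompactSupport.add hf hg
  zero_mem' := HasCompactSupport.zero
  smul_mem' c _ hf := HasCompactSupport.smul_left (f := fun _ => c) hf

instance (d : ℕ) : AddCommGroup (Test d) := Submodule.addCommGroup _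

instance (d : ℕ) : Module ℂ (Test d) := Submodule.module _

theorem dirDeriv_mem_test {d : ℕ} (v : Fin d → ℂ) :
    ∀ f ∈ Test d, dirDeriv d v f ∈ Test d := by
  intro f hf
  have h : HasCompactSupport (fun x => fderiv ℝ f.1 x v) :=
    HasCompactSupport.fderiv_apply (𝕜 := ℝ) hf v
  exact h

theorem dz_mem_test {d : ℕ} (i : Fin d) : ∀ f ∈ Test d, dz i f ∈ Test d := fun f hf =>
  (Test d).smul_mem _ ((Test d).sub_mem (dirDeriv_mem_test _ f hf)
    ((Test d).smul_mem _ (dirDeriv_mem_test _ f hf)))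

theorem dzbar_mem_test {d : ℕ} (i : Fin d) : ∀ f ∈ Test d, dzbar i f ∈ Test d := fun f hf =>
  (Test d).smul_mem _ ((Test d).add_mem (dirDeriv_mem_test _ f hf)
    ((Test d).smul_mem _ (dirDeriv_mem_test _ f hf)))

/-- `∂/∂z_i` on compactly supported functions. -/
def dzC {d : ℕ} (i : Fin d) : Module.End ℂ (Test d) := (dz i).restrict (dz_mem_test i)

/-- `∂/∂z̄_i` on compactly supported functions. -/
def dzbarC {d : ℕ} (i : Fin d) : Module.End ℂ (Test d) := (dzbar i).restrict (dzbar_mem_test i)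

/-- The monomial `D_1^{α_1} ⋯ D_d^{α_d}` in a family of operators. -/
def multi {d : ℕ} {M : Type*} [AddCommGroup M] [Module ℂ M] (D : Fin d → Module.End ℂ M)
    (α : Fin d → ℕ) : Module.End ℂ M :=
  (List.ofFn fun i => D i ^ α i).prod

/-! ### `(0,*)`-forms with values in `V₀`

`V₀ = ⨁_{a : ι} ℂ e_a` is a finite dimensional graded vector space with a homogeneous basis. With
coefficients in `M` (smooth functions, or compactly supported smooth functions), a form is
`φ = ∑_{S, a} φ (S, a) dz̄_S ⊗ e_a`, where `dz̄_S = dz̄_{s_1} ∧ ⋯ ∧ dz̄_{s_q}` for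
`S = {s_1 < ⋯ < s_q}`. -/

/-- `Ω^{0,*} ⊗ V₀` with coefficients in `M`. -/
abbrev Form (d : ℕ) (ι : Type u) (M : Type*) : Type _ := Finset (Fin d) × ι → M

/-- The smooth fields `Ω^{0,*}(ℂ^d, V)`. -/
abbrev SmoothField (d : ℕ) (ι : Type u) : Type u := Form d ι (Smooth d)

/-- The compactly supported fields `Ω^{0,*}_c(ℂ^d, V)`. -/
abbrev FieldC (d : ℕ) (ι : Type u) : Type u := Form d ι (Test d)

section Operators

variable {d : ℕ} {ι : Type u} {M : Type*} [AddCommGroup M] [Module ℂ M]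

/-- The sign `(-1)^{#{j ∈ S : j < i}}`. -/
def posSign (i : Fin d) (S : Finset (Fin d)) : ℂ := (-1) ^ (S.filter (· < i)).card

/-- The operator `D ⊗ id` acting on the coefficient functions. -/
def onCoeff (D : Module.End ℂ M) : Module.End ℂ (Form d ι M) where
  toFun φ s := D (φ s)
  map_add' φ ψ := by ext s; simp
  map_smul' c φ := by ext s; simp

/-- `φ ↦ dz̄_i ∧ φ`. -/
def wedge (i : Fin d) : Module.End ℂ (Form d ι M) where
  toFun φ s := if i ∈ s.1 then posSign i s.1 • φ (s.1.erase i, s.2) else 0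
  map_add' φ ψ := by ext s; dsimp only [Pi.add_apply]; split_ifs <;> simp
  map_smul' c φ := by
    ext s; dsimp only [Pi.smul_apply, RingHom.id_apply]; split_ifs <;> simp [smul_comm c]

/-- The operator `η̄_i`: contraction with the vector field `∂/∂z̄_i`. -/
def contract (i : Fin d) : Module.End ℂ (Form d ι M) where
  toFun φ s := if i ∈ s.1 then 0 else posSign i s.1 • φ (insert i s.1, s.2)
  map_add' φ ψ := by ext s; dsimp only [Pi.add_apply]; split_ifs <;> simp
  map_smul' c φ := by
    ext s; dsimp only [Pi.smul_apply, RingHom.id_apply]; split_ifs <;> simp [smul_comm c]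

/-- The parity operator: `(-1)^p` on the fields of total degree `p`. -/
def parity (deg : ι → ℤ) : Module.End ℂ (Form d ι M) where
  toFun φ s := ((-1 : ℂ) ^ ((s.1.card : ℤ) + deg s.2)) • φ s
  map_add' φ ψ := by ext s; simp
  map_smul' c φ := by ext s; simp [smul_comm c]

/-- The operator `id ⊗ A` for an odd linear map `A : V₀ → V₀`, with the Koszul sign
`(id ⊗ A) (α ⊗ v) = (-1)^{|α|} α ⊗ A v`. -/
def onFibre [Fintype ι] (A : Matrix ι ι ℂ) : Module.End ℂ (Form d ι M) where
  toFun φ s := ((-1 : ℂ) ^ s.1.card) • ∑ b, A s.2 b • φ (s.1, b)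
  map_add' φ ψ := by ext s; simp [Finset.sum_add_distrib]
  map_smul' c φ := by
    ext s
    simp only [Pi.smul_apply, RingHom.id_apply, Finset.smul_sum, smul_comm c]

/-- `∂̄ = ∑_i dz̄_i ∧ ∂/∂z̄_i`. -/
def delbar (Dbar : Fin d → Module.End ℂ M) : Module.End ℂ (Form d ι M) :=
  ∑ i, wedge i * onCoeff (Dbar i)

/-- The holomorphic differential operator `∑_α (∂/∂z)^α μ_α`. -/
def holOp [Fintype ι] (D : Fin d → Module.End ℂ M) (μ : (Fin d → ℕ) →₀ Matrix ι ι ℂ) :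
    Module.End ℂ (Form d ι M) :=
  μ.sum fun α A => onCoeff (multi D α) * onFibre A

/-- `φ` is homogeneous of total cohomological degree `p`. -/
def IsHomog (deg : ι → ℤ) (p : ℤ) (φ : Form d ι M) : Prop :=
  ∀ s : Finset (Fin d) × ι, (s.1.card : ℤ) + deg s.2 ≠ p → φ s = 0

end Operators

/-! ### Wedge product followed by a linear map on `V₀^{⊗ n}` -/

/-- The coefficient of `dz̄_1 ∧ ⋯ ∧ dz̄_d` in `(∧ ⊗ F₀) (w_1 ⊗ ⋯ ⊗ w_n)`, where
`w_j ∈ Λ^{0,*} ⊗ V₀` and `F₀ : V₀^{⊗ n} → ℂ` is given by its values `F₀ (e_{a_1} ⊗ ⋯ ⊗ e_{a_n})`.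
The map `g` says which factor contributes `dz̄_k`, that is, the form part of the `j`-th factor is
`dz̄_{S_j}` with `S_j = g⁻¹ {j}`. The first exponent is the sign that sorts
`dz̄_{S_1} ∧ ⋯ ∧ dz̄_{S_n}`; the second is the Koszul sign of moving the forms to the left of the
vectors. -/
def topWedge {d : ℕ} {ι : Type u} [Fintype ι] (deg : ι → ℤ) {n : ℕ} (F₀ : (Fin n → ι) → ℂ)
    (w : Fin n → Form d ι ℂ) : ℂ :=
  ∑ a : Fin n → ι, ∑ g : Fin d → Fin n,
    (-1 : ℂ) ^ (Finset.univ.filter fun p : Fin d × Fin d => p.1 < p.2 ∧ g p.2 < g p.1).card *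
    (-1 : ℂ) ^ (∑ i, ∑ j, if i < j then
      deg (a i) * ((Finset.univ.filter fun k => g k = j).card : ℤ) else 0) *
    F₀ a * ∏ j, w j (Finset.univ.filter fun k => g k = j, a j)

/-! ### Free holomorphically translation invariant theories -/

/-- The pairing `(v, v')_V` of two sections of `V`, as the coefficient of `d^d z`. -/
def sectionPairing {d : ℕ} {ι : Type u} [Fintype ι] (pairing : ι → ι → Smooth d)
    (v v' : ι → Smooth d) : Smooth d :=
  ∑ a, ∑ b, pairing a b * v a * v' b

/-- The pairing `∫ (φ, ψ)_V` of compactly supported fields. -/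
def fieldPairing {d : ℕ} {ι : Type u} [Fintype ι] (deg : ι → ℤ) (pairing : ι → ι → Smooth d)
    (φ ψ : FieldC d ι) : ℂ :=
  ∫ x : Fin d → ℂ, topWedge deg (n := 2) (fun a => (pairing (a 0) (a 1)).1 x)
    ![fun s => (φ s).1.1 x, fun s => (ψ s).1.1 x]

/-- A free holomorphically translation invariant BV theory on `ℂ^d`: the trivial bundle
`V = ℂ^d × V₀`, where `V₀` has the homogeneous basis `e_a` (`a : ι`) with `|e_a| = deg a`. -/
structure FreeTheory (d : ℕ) (ι : Type u) [Fintype ι] where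
  /-- The cohomological degrees of the basis vectors of `V₀`. -/
  deg : ι → ℤ
  /-- The bundle map `(-,-)_V : V ⊗ V → K[d-1]`, with `(e_a, e_b)_V = pairing a b • d^d z`. -/
  pairing : ι → ι → Smooth d
  /-- The coefficients of `Q^{hol} = ∑_α (∂/∂z)^α μ_α`. -/
  μ : (Fin d → ℕ) →₀ Matrix ι ι ℂ
  pairing_degree : ∀ a b, pairing a b ≠ 0 → deg a + deg b = 1 - d
  pairing_skew : ∀ a b, pairing b a = (-(-1 : ℂ) ^ (deg a * deg b)) • pairing a b
  pairing_dz : ∀ (i : Fin d) (v v' : ι → Smooth d),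
    sectionPairing pairing (fun a => dz i (v a)) v' +
      sectionPairing pairing v (fun a => dz i (v' a)) = dz i (sectionPairing pairing v v')
  pairing_dzbar : ∀ (i : Fin d) (v v' : ι → Smooth d),
    sectionPairing pairing (fun a => dzbar i (v a)) v' +
      sectionPairing pairing v (fun a => dzbar i (v' a)) = dzbar i (sectionPairing pairing v v')
  pairing_nondegenerate : ∀ φ : FieldC d ι,
    (∀ ψ, fieldPairing deg pairing φ ψ = 0) → φ = 0
  μ_degree : ∀ α a b, μ α a b ≠ 0 → deg a = deg b + 1
  sq_zero : ((delbar dzbar + holOp dz μ) * (delbar dzbar + holOp dz μ) :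
    Module.End ℂ (SmoothField d ι)) = 0
  /-- `∫ (Q^{hol} φ, ψ)_V = -(-1)^{|φ|} ∫ (φ, Q^{hol} ψ)_V`. -/
  skew_adjoint : ∀ φ ψ : FieldC d ι,
    fieldPairing deg pairing (holOp dzC μ φ) ψ =
      -fieldPairing deg pairing (parity deg φ) (holOp dzC μ ψ)

/-! ### Functionals on the fields -/

/-- Families `(I_n)_{n > 0}` of `n`-linear functionals on the compactly supported fields;
the entry `I n` takes `n + 1` arguments, so that constants are excluded. -/
abbrev Functional (d : ℕ) (ι : Type u) : Type u :=
  (n : ℕ) → MultilinearMap ℂ (fun _ : Fin (n + 1) => FieldC d ι) ℂ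

section Functionals

variable {d : ℕ} {ι : Type u}

/-- The action on functionals, as a derivation, of a linear operator `f` on fields:
`(f I) (φ_1, …, φ_n) = ∑_j I (s φ_1, …, s φ_{j-1}, f φ_j, φ_{j+1}, …, φ_n)`. Here `s = 1` if `f`
has even degree and `s = parity` if `f` has odd degree, which gives the Koszul signs. -/
def act (s f : Module.End ℂ (FieldC d ι)) : Module.End ℂ (Functional d ι) :=
  LinearMap.pi fun n => ∑ j : Fin (n + 1),
    (MultilinearMap.compLinearMapₗ fun i => if i < j then s else if i = j then f else 1) ∘ₗ
      LinearMap.proj n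

/-- Functionals of cohomological degree `k`. -/
def degreePart (deg : ι → ℤ) (k : ℤ) : Submodule ℂ (Functional d ι) where
  carrier := {I | ∀ (n : ℕ) (p : Fin (n + 1) → ℤ) (φ : Fin (n + 1) → FieldC d ι),
    (∀ j, IsHomog deg (p j) (φ j)) → k + ∑ j, p j ≠ 0 → I n φ = 0}
  add_mem' hI hJ n p φ hφ hp := by simp [hI n p φ hφ hp, hJ n p φ hφ hp]
  zero_mem' n p φ hφ hp := by simp
  smul_mem' c I hI n p φ hφ hp := by simp [hI n p φ hφ hp]

/-- Graded symmetric functionals. -/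
def symmetricPart (deg : ι → ℤ) : Submodule ℂ (Functional d ι) where
  carrier := {I | ∀ (n : ℕ) (p : Fin (n + 1) → ℤ) (φ : Fin (n + 1) → FieldC d ι),
    (∀ j, IsHomog deg (p j) (φ j)) → ∀ j : Fin n,
      I n (φ ∘ Equiv.swap j.castSucc j.succ) =
        (-1 : ℂ) ^ (p j.castSucc * p j.succ) * I n φ}
  add_mem' hI hJ n p φ hφ j := by
    simp [hI n p φ hφ j, hJ n p φ hφ j, mul_add]
  zero_mem' n p φ hφ j := by simp
  smul_mem' c I hI n p φ hφ j := by
    simp [hI n p φ hφ j, mul_left_comm]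

/-- Jet coordinates of a field: `(α, β, S, a)` stands for `(∂/∂z)^α (∂/∂z̄)^β φ_{S, a}`. -/
abbrev JetIndex (d : ℕ) (ι : Type u) : Type u :=
  (Fin d → ℕ) × (Fin d → ℕ) × Finset (Fin d) × ι

/-- A jet coordinate of a field, as a function on `ℂ^d`. -/
def jet (J : JetIndex d ι) (φ : FieldC d ι) (x : Fin d → ℂ) : ℂ :=
  (multi dzC J.1 (multi dzbarC J.2.1 (φ J.2.2))).1.1 x

/-- An `n`-linear functional is local if it is the integral of a Lagrangian density: a
polydifferential operator in the `n` fields, with smooth coefficients, of locally finite order. -/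
def IsLocal {n : ℕ} (I : MultilinearMap ℂ (fun _ : Fin n => FieldC d ι) ℂ) : Prop :=
  ∃ c : (Fin n → JetIndex d ι) → Smooth d,
    LocallyFinite (fun J => Function.support (c J).1) ∧
    ∀ φ : Fin n → FieldC d ι,
      I φ = ∫ x : Fin d → ℂ, ∑ᶠ J : Fin n → JetIndex d ι, (c J).1 x * ∏ j, jet (J j) (φ j) x

/-- The functionals `φ ↦ ∫ F (D_1 φ, …, D_n φ) d^d z`, where each `D_j` is a monomial in the
`∂/∂z_i` and `F = ∧ ⊗ F₀` for a linear map `F₀ : V₀^{⊗ n} → ℂ`. -/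
def IsHolMonomial [Fintype ι] (deg : ι → ℤ) {n : ℕ}
    (I : MultilinearMap ℂ (fun _ : Fin n => FieldC d ι) ℂ) : Prop :=
  ∃ (F₀ : (Fin n → ι) → ℂ) (α : Fin n → Fin d → ℕ), ∀ φ : Fin n → FieldC d ι,
    I φ = ∫ x : Fin d → ℂ, topWedge deg F₀ fun j s => (multi dzC (α j) (φ j s)).1.1 x

end Functionals

/-! ### The complexes of the theory -/

namespace FreeTheory

variable {d : ℕ} {ι : Type u} [Fintype ι] (T : FreeTheory d ι)

/-- The operator `∂̄ + Q^{hol}` on functionals: the derivation given by precomposition with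
`∂̄ + Q^{hol}` on fields. -/
def differential : Module.End ℂ (Functional d ι) :=
  act (parity T.deg) (delbar dzbarC + holOp dzC T.μ)

/-- The degree `k` part of the space `𝒪_loc(ℰ_V)` of local functionals. -/
def localFunctionals (k : ℤ) : Submodule ℂ (Functional d ι) :=
  degreePart T.deg k ⊓ symmetricPart T.deg ⊓
    Submodule.pi Set.univ fun _ => Submodule.span ℂ {I | IsLocal I}

/-- Holomorphically translation invariant local functionals of degree `k`: the local functionals
that are annihilated by all `∂/∂z_i`, `∂/∂z̄_i` and `η̄_i`. -/
def invariantLocal (k : ℤ) : Submodule ℂ (Functional d ι) :=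
  T.localFunctionals k ⊓ ⨅ i : Fin d,
    (LinearMap.ker (act 1 (onCoeff (dzC i))) ⊓ LinearMap.ker (act 1 (onCoeff (dzbarC i))) ⊓
      LinearMap.ker (act (parity T.deg) (contract i)))

/-- Local functionals of degree `k` that are sums of functionals built from holomorphic derivatives
`∂/∂z_i` only. -/
def holLocal (k : ℤ) : Submodule ℂ (Functional d ι) :=
  degreePart T.deg k ⊓ symmetricPart T.deg ⊓
    Submodule.pi Set.univ fun _ => Submodule.span ℂ {I | IsHolMonomial T.deg I}

end FreeTheory

/-! ### Subcomplexes cut out of a vector space with a square zero operator -/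

section Subcomplex

variable {A : Type u} [AddCommGroup A] [Module ℂ A] (Q : Module.End ℂ A) (hQ : Q * Q = 0)

/-- The cochain complex `⋯ → S k → S (k + 1) → ⋯` with differential `Q`. -/
def subcomplex (S : ℤ → Submodule ℂ A) (hS : ∀ k, ∀ x ∈ S k, Q x ∈ S (k + 1)) :
    CochainComplex (ModuleCat.{u} ℂ) ℤ :=
  CochainComplex.of (fun k => ModuleCat.of ℂ (S k)) (fun k => ModuleCat.ofHom (Q.restrict (hS k)))
    (by
      intro k
      ext x
      exact LinearMap.congr_fun hQ x.1)

theorem subcomplex_d (S : ℤ → Submodule ℂ A) (hS : ∀ k, ∀ x ∈ S k, Q x ∈ S (k + 1)) (k : ℤ) :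
    (subcomplex Q hQ S hS).d k (k + 1) = ModuleCat.ofHom (Q.restrict (hS k)) :=
  CochainComplex.of_d (fun k => ModuleCat.of ℂ (S k))
    (fun k => ModuleCat.ofHom (Q.restrict (hS k))) k

/-- The inclusion of one such complex into another. -/
def subcomplexInclusion (S S' : ℤ → Submodule ℂ A) (hS : ∀ k, ∀ x ∈ S k, Q x ∈ S (k + 1))
    (hS' : ∀ k, ∀ x ∈ S' k, Q x ∈ S' (k + 1)) (hle : ∀ k, S k ≤ S' k) :
    subcomplex Q hQ S hS ⟶ subcomplex Q hQ S' hS' :=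
  CochainComplex.ofHom (fun k => ModuleCat.ofHom (Submodule.inclusion (hle k))) fun k =>
    (congrArg (fun f => ModuleCat.ofHom (Submodule.inclusion (hle k)) ≫ f)
      (subcomplex_d Q hQ S' hS' k)).trans
    (congrArg (fun f => f ≫ ModuleCat.ofHom (Submodule.inclusion (hle (k + 1))))
      (subcomplex_d Q hQ S hS k)).symm

end Subcomplex

end HolTrans

end

noncomputable section

namespace HolTrans

universe u

/-! ### Calculus on smooth and test functions -/

section Calculus

variable {d : ℕ}

theorem dirDeriv_mul (v : Fin d → ℂ) (f g : Smooth d) :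
    dirDeriv d v (f * g) = dirDeriv d v f * g + f * dirDeriv d v g := by
  apply Subtype.ext
  funext x
  change fderiv ℝ (f.1 * g.1) x v = fderiv ℝ f.1 x v * g.1 x + f.1 x * fderiv ℝ g.1 x v
  rw [fderiv_mul (differentiableAt_smooth f x) (differentiableAt_smooth g x)]
  simp
  ring

theorem dirDeriv_comm (v w : Fin d → ℂ) : Commute (dirDeriv d v) (dirDeriv d w) := by
  apply LinearMap.ext
  intro f
  apply Subtype.ext
  funext x
  have h (v w : Fin d → ℂ) : fderiv ℝ (fun y => fderiv ℝ f.1 y w) x v =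
      fderiv ℝ (fderiv ℝ f.1) x v w := by
    have hd : DifferentiableAt ℝ (fderiv ℝ f.1) x :=
      ((contDiff_smooth f).fderiv_right (m := ∞) (by simp)).differentiable (by simp) x
    rw [fderiv_clm_apply hd (by fun_prop)]
    simp
  change fderiv ℝ (fun y => fderiv ℝ f.1 y w) x v = fderiv ℝ (fun y => fderiv ℝ f.1 y v) x w
  rw [h, h]
  exact ((contDiff_smooth f).contDiffAt.isSymmSndFDerivAt
    (by simpa using (WithTop.coe_le_coe.2 le_top : ((2 : ℕ∞) : ℕ∞ω) ≤ ∞))).eq v w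

/-- The constant coefficient vector fields: `∂/∂z_i` for `Sum.inl i`, `∂/∂z̄_i` for `Sum.inr i`. -/
def pd (k : Fin d ⊕ Fin d) : Module.End ℂ (Smooth d) := Sum.elim dz dzbar k

/-- The constant coefficient vector fields on compactly supported functions. -/
def pdC (k : Fin d ⊕ Fin d) : Module.End ℂ (Test d) := Sum.elim dzC dzbarC k

theorem coe_pdC (k : Fin d ⊕ Fin d) (f : Test d) : (pdC k f).1 = pd k f.1 := by
  cases k <;> rfl

/-- Every `pd k` is a combination of two directional derivatives. -/
theorem pd_eq (k : Fin d ⊕ Fin d) : ∃ (v w : Fin d → ℂ) (ε : ℂ),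
    pd k = (1 / 2 : ℂ) • (dirDeriv d v + ε • dirDeriv d w) := by
  rcases k with i | i
  · exact ⟨Pi.single i 1, Pi.single i Complex.I, -Complex.I, by
      change (1 / 2 : ℂ) • (dirDeriv d (Pi.single i 1) -
        Complex.I • dirDeriv d (Pi.single i Complex.I)) = _
      module⟩
  · exact ⟨_, _, _, rfl⟩

theorem pd_mul (k : Fin d ⊕ Fin d) (f g : Smooth d) :
    pd k (f * g) = pd k f * g + f * pd k g := by
  obtain ⟨v, w, ε, h⟩ := pd_eq k
  simp only [h, LinearMap.smul_apply, LinearMap.add_apply, dirDeriv_mul]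
  simp only [smul_add, add_mul, mul_add, smul_mul_assoc, mul_smul_comm]
  abel

theorem pd_comm (k l : Fin d ⊕ Fin d) : Commute (pd k) (pd l) := by
  obtain ⟨v, w, ε, h⟩ := pd_eq k
  obtain ⟨v', w', ε', h'⟩ := pd_eq l
  rw [h, h']
  refine Commute.smul_left (Commute.smul_right ?_ _) _
  exact .add_left
    (.add_right (dirDeriv_comm _ _) (.smul_right (dirDeriv_comm _ _) _))
    (.smul_left (.add_right (dirDeriv_comm _ _) (.smul_right (dirDeriv_comm _ _) _)) _)

theorem pd_one (k : Fin d ⊕ Fin d) : pd k 1 = 0 := by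
  have h := pd_mul k 1 1
  simpa using h

theorem pd_support (k : Fin d ⊕ Fin d) (f : Smooth d) :
    tsupport (pd k f).1 ⊆ tsupport f.1 := by
  obtain ⟨v, w, ε, h⟩ := pd_eq k
  refine closure_minimal (fun x hx => ?_) (isClosed_tsupport _)
  by_contra hn
  apply hx
  have h0 : fderiv ℝ f.1 x = 0 := by
    have := support_fderiv_subset ℝ (f := f.1)
    by_contra hc
    exact hn (this hc)
  rw [h]
  change (1 / 2 : ℂ) * (fderiv ℝ f.1 x v + ε * fderiv ℝ f.1 x w) = 0
  simp [h0]

/-- The coordinate functions `z_i` and `z̄_i`. -/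
def coordL (k : Fin d ⊕ Fin d) : (Fin d → ℂ) →L[ℝ] ℂ :=
  Sum.elim (fun i => ContinuousLinearMap.proj i)
    (fun i => (Complex.conjCLE : ℂ →L[ℝ] ℂ).comp (ContinuousLinearMap.proj i)) k

/-- The coordinate functions `z_i` and `z̄_i`, as smooth functions. -/
def coord (k : Fin d ⊕ Fin d) : Smooth d :=
  ⟨coordL k, show ContDiff ℝ ∞ (coordL k) from (coordL k).contDiff⟩

theorem pd_coord (k l : Fin d ⊕ Fin d) : pd k (coord l) = if k = l then 1 else 0 := by
  have h (v : Fin d → ℂ) (x) : fderiv ℝ (coord l).1 x v = coordL l v :=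
    congrArg (fun L => L v) (coordL l).fderiv
  have hs : (if k = l then (1 : Smooth d) else 0) =
      algebraMap ℂ (Smooth d) (if k = l then 1 else 0) := by split_ifs <;> simp
  rw [hs]
  apply Subtype.ext
  funext x
  change _ = (if k = l then 1 else 0 : ℂ)
  rcases k with i | i
  · change (1 / 2 : ℂ) * (fderiv ℝ (coord l).1 x (Pi.single i 1) -
      Complex.I * fderiv ℝ (coord l).1 x (Pi.single i Complex.I)) = _
    rw [h, h]
    rcases l with j | j <;> by_cases hij : j = i
    · subst hij; simp [coordL]; norm_num
    · simp [coordL, hij, Ne.symm hij]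
    · subst hij; simp [coordL]
    · simp [coordL, hij]
  · change (1 / 2 : ℂ) * (fderiv ℝ (coord l).1 x (Pi.single i 1) +
      Complex.I * fderiv ℝ (coord l).1 x (Pi.single i Complex.I)) = _
    rw [h, h]
    rcases l with j | j <;> by_cases hij : j = i
    · subst hij; simp [coordL]
    · simp [coordL, hij]
    · subst hij; simp [coordL]; norm_num
    · simp [coordL, hij, Ne.symm hij]

theorem mul_mem_test (c : Smooth d) : ∀ f ∈ Test d, LinearMap.mulLeft ℂ c f ∈ Test d := by
  intro f hf
  exact HasCompactSupport.mul_left (f := c.1) (f' := f.1) hf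

/-- Multiplication of test functions by a smooth function. -/
def mulC (c : Smooth d) : Module.End ℂ (Test d) :=
  (LinearMap.mulLeft ℂ c).restrict (mul_mem_test c)

theorem coe_mulC (c : Smooth d) (f : Test d) : (mulC c f).1 = c * f.1 := rfl

theorem mulC_mul (c c' : Smooth d) : mulC (c * c') = mulC c * mulC c' := by
  ext1 f
  exact Subtype.ext (mul_assoc c c' f.1)

theorem mulC_one : mulC (1 : Smooth d) = 1 := by
  ext1 f
  exact Subtype.ext (one_mul f.1)

theorem mulC_add (c c' : Smooth d) : mulC (c + c') = mulC c + mulC c' := by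
  ext1 f
  exact Subtype.ext (add_mul c c' f.1)

theorem mulC_smul (r : ℂ) (c : Smooth d) : mulC (r • c) = r • mulC c := by
  ext1 f
  exact Subtype.ext (smul_mul_assoc r c f.1)

theorem pdC_comm (k l : Fin d ⊕ Fin d) : Commute (pdC k) (pdC l) := by
  apply LinearMap.ext
  intro f
  apply Subtype.ext
  change (pdC k (pdC l f)).1 = (pdC l (pdC k f)).1
  simp only [coe_pdC]
  exact LinearMap.congr_fun (pd_comm k l) f.1

theorem pdC_mul_mulC (k : Fin d ⊕ Fin d) (c : Smooth d) :
    pdC k * mulC c = mulC c * pdC k + mulC (pd k c) := by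
  ext1 f
  apply Subtype.ext
  change (pdC k (mulC c f)).1 = c * (pdC k f).1 + pd k c * f.1
  rw [coe_pdC, coe_mulC, coe_pdC, pd_mul, add_comm]

theorem integrable_of_test {f : Smooth d} (hf : f ∈ Test d) : Integrable f.1 :=
  (contDiff_smooth f).continuous.integrable_of_hasCompactSupport hf

/-- The integral of a test function. -/
def integ : Test d →ₗ[ℂ] ℂ where
  toFun f := ∫ x, f.1.1 x
  map_add' f g := integral_add (integrable_of_test f.2) (integrable_of_test g.2)
  map_smul' c f := integral_const_mul c f.1.1

theorem integ_pdC (k : Fin d ⊕ Fin d) (f : Test d) : integ (pdC k f) = 0 := by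
  have h (v : Fin d → ℂ) : ∫ x, fderiv ℝ f.1.1 x v = 0 := by
    have := integral_mul_fderiv_eq_neg_fderiv_mul_of_integrable (μ := volume) (𝕜 := ℂ)
      (f := fun _ : Fin d → ℂ => (1 : ℂ)) (g := f.1.1) (v := v) (by simp)
      (by simp_rw [one_mul]; exact integrable_of_test (dirDeriv_mem_test v f.1 f.2))
      (by simpa using integrable_of_test f.2) (by simp)
      (fun x _ => differentiableAt_smooth f.1 x)
    simpa using this
  obtain ⟨v, w, ε, hk⟩ := pd_eq k
  have e : ∀ x, (pdC k f).1.1 x =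
      (1 / 2 : ℂ) * (fderiv ℝ f.1.1 x v + ε * fderiv ℝ f.1.1 x w) := by
    intro x
    rw [coe_pdC, hk]
    rfl
  change ∫ x, (pdC k f).1.1 x = 0
  simp_rw [e]
  have hv : Integrable fun x => fderiv ℝ f.1.1 x v :=
    integrable_of_test (dirDeriv_mem_test v f.1 f.2)
  have hw : Integrable fun x => fderiv ℝ f.1.1 x w :=
    integrable_of_test (dirDeriv_mem_test w f.1 f.2)
  rw [integral_const_mul, integral_add hv (hw.const_mul ε), integral_const_mul, h, h]
  simp

theorem eqOn_const_of_pd_eq_zero {f : Smooth d} {R : ℝ}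
    (hf : ∀ k, ∀ x ∈ Metric.ball (0 : Fin d → ℂ) R, (pd k f).1 x = 0) :
    ∀ x ∈ Metric.ball (0 : Fin d → ℂ) R, f.1 x = f.1 0 := by
  intro x hx
  have hR : 0 < R := (dist_nonneg).trans_lt (Metric.mem_ball.1 hx)
  refine Metric.isOpen_ball.is_const_of_fderiv_eq_zero (𝕜 := ℝ)
    (convex_ball _ _).isPreconnected
    (fun y _ => (differentiableAt_smooth f y).differentiableWithinAt) ?_ hx
    (Metric.mem_ball_self hR)
  intro y hy
  have h1 (i : Fin d) : fderiv ℝ f.1 y (Pi.single i 1) = 0 ∧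
      fderiv ℝ f.1 y (Pi.single i Complex.I) = 0 := by
    have a : (1 / 2 : ℂ) * (fderiv ℝ f.1 y (Pi.single i 1) -
      Complex.I * fderiv ℝ f.1 y (Pi.single i Complex.I)) = 0 := hf (Sum.inl i) y hy
    have b : (1 / 2 : ℂ) * (fderiv ℝ f.1 y (Pi.single i 1) +
      Complex.I * fderiv ℝ f.1 y (Pi.single i Complex.I)) = 0 := hf (Sum.inr i) y hy
    constructor
    · linear_combination a + b
    · linear_combination (-Complex.I) * (b - a) +
        (fderiv ℝ f.1 y (Pi.single i Complex.I)) * Complex.I_mul_I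
  ext v
  have hv : v = ∑ i, ((v i).re • (Pi.single i 1 : Fin d → ℂ) +
      (v i).im • (Pi.single i Complex.I : Fin d → ℂ)) := by
    ext j
    simp only [Finset.sum_apply, Pi.add_apply, Pi.smul_apply, Pi.single_apply]
    rw [Finset.sum_eq_single j] <;> simp +contextual [eq_comm]
  rw [hv, map_sum]
  simp [h1]

end Calculus

/-! ### Monomials in the derivatives -/

section Monomials

theorem List.prod_ofFn_update_mul {R : Type*} [Monoid R] {d : ℕ} (f : Fin d → R) (i : Fin d)
    (a : R) (h : ∀ j, Commute a (f j)) :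
    (List.ofFn (Function.update f i (a * f i))).prod = a * (List.ofFn f).prod := by
  induction d with
  | zero => exact i.elim0
  | succ d ih =>
    simp only [List.ofFn_succ, List.prod_cons]
    refine Fin.cases ?_ (fun i => ?_) i
    · simp [mul_assoc]
    · have e : (fun j : Fin d => Function.update f i.succ (a * f i.succ) j.succ) =
          Function.update (fun j => f j.succ) i (a * f i.succ) := by
        ext j
        by_cases hj : j = i
        · subst hj; simp
        · simp [hj]
      rw [e, ih (fun j => f j.succ) i fun j => h j.succ]
      rw [Function.update_of_ne (Fin.succ_ne_zero i).symm, ← mul_assoc, ← mul_assoc, (h 0).eq]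

variable {d : ℕ} {M : Type*} [AddCommGroup M] [Module ℂ M]

theorem multi_zero (D : Fin d → Module.End ℂ M) : multi D 0 = 1 := by
  simp [multi, List.ofFn_const]

theorem multi_add_single {D : Fin d → Module.End ℂ M} (hD : ∀ i j, Commute (D i) (D j))
    (α : Fin d → ℕ) (i : Fin d) : multi D (α + Pi.single i 1) = D i * multi D α := by
  unfold multi
  rw [← List.prod_ofFn_update_mul _ i (D i) fun j => (hD i j).pow_right _]
  congr 2
  ext1 j
  by_cases hj : j = i
  · subst hj; simp [pow_succ']
  · simp [hj]

theorem commute_multi {D : Fin d → Module.End ℂ M} {a : Module.End ℂ M}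
    (h : ∀ j, Commute a (D j)) (α : Fin d → ℕ) : Commute a (multi D α) := by
  apply Commute.list_prod_right
  intro x hx
  obtain ⟨i, rfl⟩ := (List.mem_ofFn' _ _).1 hx
  exact (h i).pow_right _

/-- Induction on multi-indices. -/
theorem multiIndex_induction {κ : Type*} [Finite κ] [DecidableEq κ] {P : (κ → ℕ) → Prop} (h0 : P 0)
    (h : ∀ γ k, P γ → P (γ + Pi.single k 1)) (γ : κ → ℕ) : P γ := by
  have := Fintype.ofFinite κ
  induction hn : ∑ k, γ k generalizing γ with
  | zero =>
    have : γ = 0 := by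
      ext k
      exact (Finset.sum_eq_zero_iff.1 hn) k (Finset.mem_univ k)
    rwa [this]
  | succ n ih =>
    obtain ⟨k, -, hk⟩ := Finset.exists_ne_zero_of_sum_ne_zero (s := Finset.univ) (f := γ)
      (by omega)
    have e : γ = (γ - Pi.single k 1) + Pi.single k 1 := by
      ext l
      by_cases hl : l = k
      · subst hl; simp; omega
      · simp [hl]
    rw [e]
    apply h
    apply ih
    have : ∑ l, γ l = ∑ l, (γ - Pi.single k 1 : κ → ℕ) l + 1 := by
      conv_lhs => rw [e]
      simp [Finset.sum_add_distrib]
    omega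

/-- The monomial of multi-index `γ` in all the `∂/∂z_i` and `∂/∂z̄_i`. -/
def Dop (γ : Fin d ⊕ Fin d → ℕ) : Module.End ℂ (Test d) :=
  multi dzC (fun i => γ (.inl i)) * multi dzbarC (fun i => γ (.inr i))

theorem Dop_zero : Dop (0 : Fin d ⊕ Fin d → ℕ) = 1 := by
  change multi dzC 0 * multi dzbarC 0 = 1
  simp [multi_zero]

theorem Dop_add_single (γ : Fin d ⊕ Fin d → ℕ) (k : Fin d ⊕ Fin d) :
    Dop (γ + Pi.single k 1) = pdC k * Dop γ := by
  have hz : ∀ i j : Fin d, Commute (dzC i) (dzC j) := fun i j => pdC_comm (.inl i) (.inl j)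
  have hb : ∀ i j : Fin d, Commute (dzbarC i) (dzbarC j) := fun i j => pdC_comm (.inr i) (.inr j)
  have hm : ∀ i j : Fin d, Commute (dzbarC i) (dzC j) := fun i j => pdC_comm (.inr i) (.inl j)
  rcases k with i | i
  · have h1 : (fun j => (γ + Pi.single (Sum.inl i) 1 : Fin d ⊕ Fin d → ℕ) (.inl j)) =
        (fun j => γ (.inl j)) + Pi.single i 1 := by
      ext j; simp [Pi.single_apply]
    have h2 : (fun j => (γ + Pi.single (Sum.inl i) 1 : Fin d ⊕ Fin d → ℕ) (.inr j)) =
        fun j => γ (.inr j) := by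
      ext j; simp
    rw [Dop, h1, h2, multi_add_single hz, mul_assoc]
    rfl
  · have h1 : (fun j => (γ + Pi.single (Sum.inr i) 1 : Fin d ⊕ Fin d → ℕ) (.inr j)) =
        (fun j => γ (.inr j)) + Pi.single i 1 := by
      ext j; simp [Pi.single_apply]
    have h2 : (fun j => (γ + Pi.single (Sum.inr i) 1 : Fin d ⊕ Fin d → ℕ) (.inl j)) =
        fun j => γ (.inl j) := by
      ext j; simp
    rw [Dop, h1, h2, multi_add_single hb, ← mul_assoc, ← (commute_multi (hm i) _).eq, mul_assoc]
    rfl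

theorem commute_pdC_Dop (k : Fin d ⊕ Fin d) (γ : Fin d ⊕ Fin d → ℕ) :
    Commute (pdC k) (Dop γ) :=
  .mul_right (commute_multi (fun i => pdC_comm k (.inl i)) _)
    (commute_multi (fun i => pdC_comm k (.inr i)) _)

theorem Dop_mul_multi (γ : Fin d ⊕ Fin d → ℕ) (α : Fin d → ℕ) :
    Dop γ * multi dzC α = Dop (γ + Sum.elim α 0) := by
  have hz : ∀ i j : Fin d, Commute (dzC i) (dzC j) := fun i j => pdC_comm (.inl i) (.inl j)
  induction α using multiIndex_induction with
  | h0 => simp [multi_zero]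
  | h α i ih =>
    have e : (Sum.elim (α + Pi.single i 1) 0 : Fin d ⊕ Fin d → ℕ) =
        Sum.elim α 0 + Pi.single (.inl i) 1 := by
      ext (j | j) <;> simp [Pi.single_apply]
    rw [multi_add_single hz, e, ← add_assoc, Dop_add_single, ← ih, ← mul_assoc, ← mul_assoc]
    congr 1
    exact (commute_pdC_Dop (.inl i) γ).eq.symm

theorem multi_eq_Dop (α : Fin d → ℕ) : multi dzC α = Dop (Sum.elim α 0) := by
  have := Dop_mul_multi 0 α
  rwa [Dop_zero, one_mul, zero_add] at this

theorem Dop_mul_mulC_coord (γ : Fin d ⊕ Fin d → ℕ) (k : Fin d ⊕ Fin d) :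
    Dop γ * mulC (coord k) =
      mulC (coord k) * Dop γ + (γ k : ℂ) • Dop (d := d) (γ - Pi.single k 1) := by
  induction γ using multiIndex_induction with
  | h0 => simp [Dop_zero]
  | h γ l ih =>
    rw [Dop_add_single, mul_assoc, ih, mul_add, ← mul_assoc, pdC_mul_mulC, pd_coord]
    by_cases hl : l = k
    · subst hl
      have e : (γ + Pi.single l 1 - Pi.single l 1 : Fin d ⊕ Fin d → ℕ) = γ := by simp
      rw [if_pos rfl, mulC_one, e, mul_smul_comm]
      by_cases h0 : γ l = 0
      · simp [h0, add_mul, mul_assoc]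
      · have e' : γ = (γ - Pi.single l 1) + Pi.single l 1 := by
          ext m
          by_cases hm : m = l
          · subst hm; simp; omega
          · simp [hm]
        rw [← Dop_add_single, ← e']
        simp [add_mul, mul_assoc, add_smul]
        abel
    · have e : (γ + Pi.single l 1 - Pi.single k 1 : Fin d ⊕ Fin d → ℕ) =
          (γ - Pi.single k 1) + Pi.single l 1 := by
        ext m
        by_cases hm : m = k
        · subst hm; simp [Ne.symm hl]
        · simp [hm]
      rw [if_neg hl, e, Dop_add_single]
      have : mulC (0 : Smooth d) = 0 := by
        ext1 f; exact Subtype.ext (zero_mul f.1)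
      simp [this, mul_assoc, Ne.symm hl]

theorem tsupport_Dop (γ : Fin d ⊕ Fin d → ℕ) (f : Test d) :
    tsupport (Dop γ f).1.1 ⊆ tsupport f.1.1 := by
  induction γ using multiIndex_induction with
  | h0 => simp [Dop_zero]
  | h γ k ih =>
    rw [Dop_add_single]
    change tsupport (pdC k (Dop γ f)).1.1 ⊆ _
    rw [coe_pdC]
    exact (pd_support k _).trans ih

end Monomials

/-! ### Derivations on multilinear functionals -/

section Derivations

variable {F : Type*} [AddCommGroup F] [Module ℂ F] {N : ℕ}

/-- The operators applied to the arguments in the `j`-th summand of a derivation. -/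
def slot (s f : Module.End ℂ F) (j : Fin N) (i : Fin N) : Module.End ℂ F :=
  if i < j then s else if i = j then f else 1

/-- The action of a field operator on `N`-linear functionals as a derivation. -/
def actN (s f : Module.End ℂ F) : Module.End ℂ (MultilinearMap ℂ (fun _ : Fin N => F) ℂ) :=
  ∑ j : Fin N, MultilinearMap.compLinearMapₗ (slot s f j)

theorem actN_apply (s f : Module.End ℂ F) (I : MultilinearMap ℂ (fun _ : Fin N => F) ℂ) :
    actN s f I = ∑ j : Fin N, I.compLinearMap (slot s f j) := by
  simp [actN]

theorem act_apply {d : ℕ} {ι : Type u} (s f : Module.End ℂ (FieldC d ι)) (I : Functional d ι)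
    (n : ℕ) : act s f I n = actN s f (I n) := by
  simp [act, actN]
  rfl

theorem slot_of_lt (s f : Module.End ℂ F) {i j : Fin N} (h : i < j) : slot s f j i = s :=
  if_pos h

theorem slot_self (s f : Module.End ℂ F) (j : Fin N) : slot s f j j = f := by simp [slot]

theorem slot_of_gt (s f : Module.End ℂ F) {i j : Fin N} (h : j < i) : slot s f j i = 1 := by
  rw [slot, if_neg h.not_gt, if_neg h.ne']

theorem compLinearMap_congr_smul (I : MultilinearMap ℂ (fun _ : Fin N => F) ℂ)
    {G G' : Fin N → Module.End ℂ F} (l : Fin N) (c : ℂ) (h : ∀ i, i ≠ l → G i = G' i)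
    (hl : G l = c • G' l) : I.compLinearMap G = c • I.compLinearMap G' := by
  ext φ
  have e : (fun i => G i (φ i)) =
      Function.update (fun i => G' i (φ i)) l (c • G' l (φ l)) := by
    ext1 i
    by_cases hi : i = l
    · subst hi; simp [hl]
    · simp [hi, h i hi]
  simp only [MultilinearMap.compLinearMap_apply, smul_apply]
  rw [e, MultilinearMap.map_update_smul, Function.update_eq_self]

/-- The commutator of two derivations is the derivation given by the commutator, with the sign `c`
prescribed by the parities. -/
theorem actN_commutator {s t f g : Module.End ℂ F} {c : ℂ} (hc : c * c = 1)
    (hst : s * t = t * s) (hsg : s * g = c • (g * s)) (htf : t * f = c • (f * t))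
    (I : MultilinearMap ℂ (fun _ : Fin N => F) ℂ) :
    actN s f (actN t g I) - c • actN t g (actN s f I) =
      actN (s * t) (g * f - c • (f * g)) I := by
  set a : Fin N → Fin N → MultilinearMap ℂ (fun _ : Fin N => F) ℂ := fun j l =>
    I.compLinearMap (fun i => slot t g l i * slot s f j i) with ha
  set b : Fin N → Fin N → MultilinearMap ℂ (fun _ : Fin N => F) ℂ := fun j l =>
    I.compLinearMap (fun i => slot s f j i * slot t g l i) with hb
  have h1 : actN s f (actN t g I) = ∑ j, ∑ l, a j l := by
    simp only [actN_apply, ha]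
    refine Finset.sum_congr rfl fun j _ => ?_
    ext φ
    simp [MultilinearMap.compLinearMap_apply]
  have h2 : actN t g (actN s f I) = ∑ j, ∑ l, b j l := by
    rw [Finset.sum_comm]
    simp only [actN_apply, hb]
    refine Finset.sum_congr rfl fun j _ => ?_
    ext φ
    simp [MultilinearMap.compLinearMap_apply]
  have off : ∀ j l, j ≠ l → a j l - c • b j l = 0 := by
    intro j l hjl
    rw [sub_eq_zero]
    rcases lt_or_gt_of_ne hjl with h | h
    · refine compLinearMap_congr_smul I j c (fun i hi => ?_) ?_
      · rcases lt_trichotomy i j with h' | h' | h'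
        · rw [slot_of_lt _ _ h', slot_of_lt _ _ (h'.trans h), hst]
        · exact absurd h' hi
        · rw [slot_of_gt _ _ h', mul_one, one_mul]
      · rw [slot_self, slot_of_lt _ _ h, htf]
    · have : b j l = c • a j l := by
        refine compLinearMap_congr_smul I l c (fun i hi => ?_) ?_
        · rcases lt_trichotomy i l with h' | h' | h'
          · rw [slot_of_lt _ _ h', slot_of_lt _ _ (h'.trans h), hst]
          · exact absurd h' hi
          · rw [slot_of_gt _ _ h', mul_one, one_mul]
        · rw [slot_self, slot_of_lt _ _ h, hsg]
      rw [this, smul_smul, hc, one_smul]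
  have diag : ∀ j, a j j - c • b j j =
      I.compLinearMap (slot (s * t) (g * f - c • (f * g)) j) := by
    intro j
    ext φ
    have key : ∀ (G : Module.End ℂ F) (X : Fin N → Module.End ℂ F),
        (∀ i, i ≠ j → X i = slot (s * t) G j i) → X j = G →
        I (fun i => X i (φ i)) =
          I (Function.update (fun i => slot (s * t) (0 : Module.End ℂ F) j i (φ i)) j (G (φ j))) := by
      intro G X h hj
      congr 1
      ext1 i
      by_cases hi : i = j
      · subst hi; simp [hj]
      · simp [hi, h i hi, slot]
    simp only [sub_apply, smul_apply, ha, hb,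
      MultilinearMap.compLinearMap_apply]
    rw [key (g * f - c • (f * g)) _ (fun _ _ => rfl) (slot_self _ _ _)]
    rw [key (g * f) (fun i => slot t g j i * slot s f j i), key (f * g)
      (fun i => slot s f j i * slot t g j i)]
    · rw [LinearMap.sub_apply, MultilinearMap.map_update_sub, LinearMap.smul_apply,
        MultilinearMap.map_update_smul]
    · intro i hi
      rcases lt_or_gt_of_ne hi with h | h
      · simp [slot_of_lt _ _ h]
      · simp [slot_of_gt _ _ h]
    · simp [slot_self]
    · intro i hi
      rcases lt_or_gt_of_ne hi with h | h
      · simp [slot_of_lt _ _ h, hst]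
      · simp [slot_of_gt _ _ h]
    · simp [slot_self]
  rw [h1, h2, Finset.smul_sum, ← Finset.sum_sub_distrib, actN_apply]
  refine Finset.sum_congr rfl fun j _ => ?_
  rw [Finset.smul_sum, ← Finset.sum_sub_distrib, Finset.sum_eq_single j, diag]
  · intro l _ hl
    exact off j l hl.symm
  · simp

theorem actN_smul (s f : Module.End ℂ F) (c : ℂ) (I : MultilinearMap ℂ (fun _ : Fin N => F) ℂ) :
    actN s (c • f) I = c • actN s f I := by
  simp only [actN_apply, Finset.smul_sum]
  refine Finset.sum_congr rfl fun j _ => ?_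
  refine compLinearMap_congr_smul I j c (fun i hi => ?_) (by simp [slot_self])
  simp [slot, hi]

theorem actN_zero (s : Module.End ℂ F) (I : MultilinearMap ℂ (fun _ : Fin N => F) ℂ) :
    actN s 0 I = 0 := by
  simpa using actN_smul s 0 0 I

end Derivations

/-! ### Degree and symmetry -/

section Degree

variable {d : ℕ} {ι : Type u}

/-- `N`-linear functionals of degree `k`. -/
def degN (deg : ι → ℤ) (N : ℕ) (k : ℤ) :
    Submodule ℂ (MultilinearMap ℂ (fun _ : Fin N => FieldC d ι) ℂ) where
  carrier := {I | ∀ (p : Fin N → ℤ) (φ : Fin N → FieldC d ι),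
    (∀ j, IsHomog deg (p j) (φ j)) → k + ∑ j, p j ≠ 0 → I φ = 0}
  add_mem' hI hJ p φ hφ hp := by simp [hI p φ hφ hp, hJ p φ hφ hp]
  zero_mem' p φ hφ hp := by simp
  smul_mem' c I hI p φ hφ hp := by simp [hI p φ hφ hp]

/-- Graded symmetric `n + 1`-linear functionals. -/
def symN (deg : ι → ℤ) (n : ℕ) :
    Submodule ℂ (MultilinearMap ℂ (fun _ : Fin (n + 1) => FieldC d ι) ℂ) where
  carrier := {I | ∀ (p : Fin (n + 1) → ℤ) (φ : Fin (n + 1) → FieldC d ι),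
    (∀ j, IsHomog deg (p j) (φ j)) → ∀ j : Fin n,
      I (φ ∘ Equiv.swap j.castSucc j.succ) = (-1 : ℂ) ^ (p j.castSucc * p j.succ) * I φ}
  add_mem' hI hJ p φ hφ j := by simp [hI p φ hφ j, hJ p φ hφ j, mul_add]
  zero_mem' p φ hφ j := by simp
  smul_mem' c I hI p φ hφ j := by simp [hI p φ hφ j, mul_left_comm]

/-- The operator `f` raises the degree by `e`. -/
def HasDegree (deg : ι → ℤ) (e : ℤ) (f : Module.End ℂ (FieldC d ι)) : Prop :=
  ∀ p φ, IsHomog deg p φ → IsHomog deg (p + e) (f φ)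

/-- The operator `s` multiplies fields of degree `p` by `(-1)^{e p}`. -/
def IsKoszulSign (deg : ι → ℤ) (e : ℤ) (s : Module.End ℂ (FieldC d ι)) : Prop :=
  ∀ p φ, IsHomog deg p φ → s φ = ((-1 : ℂ) ^ (e * p)) • φ

theorem isKoszulSign_parity (deg : ι → ℤ) {e : ℤ} (he : Odd e) :
    IsKoszulSign (d := d) deg e (parity deg) := by
  intro p φ hφ
  ext1 s
  change ((-1 : ℂ) ^ ((s.1.card : ℤ) + deg s.2)) • φ s = ((-1 : ℂ) ^ (e * p)) • φ s
  by_cases h : (s.1.card : ℤ) + deg s.2 = p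
  · rw [h, zpow_mul, he.neg_one_zpow]
  · rw [hφ s h, smul_zero, smul_zero]

theorem slot_isHomog {deg : ι → ℤ} {e : ℤ} {s f : Module.End ℂ (FieldC d ι)}
    (hs : IsKoszulSign deg e s) (hf : HasDegree deg e f) {N : ℕ} {p : Fin N → ℤ}
    {φ : Fin N → FieldC d ι} (hφ : ∀ j, IsHomog deg (p j) (φ j)) (l i : Fin N) :
    IsHomog deg (p i + if i = l then e else 0) (slot s f l i (φ i)) := by
  unfold slot
  by_cases h : i < l
  · rw [if_pos h, if_neg h.ne, add_zero, hs _ _ (hφ i)]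
    intro t ht
    simp [hφ i t ht]
  · by_cases h' : i = l
    · simpa [h, h'] using hf _ _ (hφ l)
    · simpa [h, h'] using hφ i

theorem actN_mem_degN {deg : ι → ℤ} {e : ℤ} {s f : Module.End ℂ (FieldC d ι)}
    (hs : IsKoszulSign deg e s) (hf : HasDegree deg e f) {N : ℕ} {k : ℤ}
    {I : MultilinearMap ℂ (fun _ : Fin N => FieldC d ι) ℂ} (hI : I ∈ degN deg N k) :
    actN s f I ∈ degN deg N (k + e) := by
  intro p φ hφ hp
  rw [actN_apply, sum_apply]
  refine Finset.sum_eq_zero fun l _ => ?_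
  refine hI _ _ (slot_isHomog hs hf hφ l) ?_
  rw [Finset.sum_add_distrib]
  simpa [add_comm, add_left_comm, add_assoc] using hp

theorem neg_one_zpow_mul_self (a : ℤ) : (-1 : ℂ) ^ a * (-1) ^ a = 1 := by
  rw [← mul_zpow]; simp

theorem apply_slot {deg : ι → ℤ} {e : ℤ} {s f : Module.End ℂ (FieldC d ι)}
    (hs : IsKoszulSign deg e s) {N : ℕ} {p : Fin N → ℤ}
    (I : MultilinearMap ℂ (fun _ : Fin N => FieldC d ι) ℂ)
    {φ : Fin N → FieldC d ι} (hφ : ∀ j, IsHomog deg (p j) (φ j)) (l : Fin N) :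
    I (fun i => slot s f l i (φ i)) = (∏ i, if i < l then (-1 : ℂ) ^ (e * p i) else 1) *
      I (Function.update φ l (f (φ l))) := by
  rw [← smul_eq_mul, ← MultilinearMap.map_smul_univ]
  congr 1
  ext1 i
  by_cases h : i < l
  · rw [slot_of_lt _ _ h, if_pos h, hs _ _ (hφ i), Function.update_of_ne h.ne]
  · rw [if_neg h, one_smul]
    by_cases h' : i = l
    · subst h'; rw [slot_self, Function.update_self]
    · rw [Function.update_of_ne h', slot, if_neg h, if_neg h']; rfl

theorem swap_castSucc_succ_lt_iff {n : ℕ} (j : Fin n) {l : Fin (n + 1)} (h1 : l ≠ j.castSucc)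
    (h2 : l ≠ j.succ) (i : Fin (n + 1)) :
    Equiv.swap j.castSucc j.succ i < l ↔ i < l := by
  have h1' : (l : ℕ) ≠ j := fun h => h1 (Fin.ext h)
  have h2' : (l : ℕ) ≠ j + 1 := fun h => h2 (Fin.ext h)
  by_cases e1 : i = j.castSucc
  · subst e1
    rw [Equiv.swap_apply_left, Fin.lt_def, Fin.lt_def]
    simp only [Fin.val_succ, Fin.val_castSucc]
    omega
  · by_cases e2 : i = j.succ
    · subst e2
      rw [Equiv.swap_apply_right, Fin.lt_def, Fin.lt_def]
      simp only [Fin.val_succ, Fin.val_castSucc]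
      omega
    · rw [Equiv.swap_apply_of_ne_of_ne e1 e2]

theorem prod_lt_succ {n : ℕ} (u : Fin (n + 1) → ℂ) (j : Fin n) :
    (∏ i, if i < j.succ then u i else 1) =
      (∏ i, if i < j.castSucc then u i else 1) * u j.castSucc := by
  have : u j.castSucc = ∏ i, if i = j.castSucc then u i else 1 := by simp
  rw [this, ← Finset.prod_mul_distrib]
  refine Finset.prod_congr rfl fun i _ => ?_
  rcases lt_trichotomy i j.castSucc with h | h | h
  · rw [if_pos h, if_neg h.ne, if_pos (h.trans (Fin.castSucc_lt_succ)), mul_one]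
  · subst h
    rw [if_neg (lt_irrefl _), if_pos rfl, if_pos (Fin.castSucc_lt_succ), one_mul]
  · have : ¬ i < j.succ := by
      rw [Fin.lt_def] at h ⊢
      simp only [Fin.val_succ, Fin.val_castSucc] at h ⊢
      omega
    rw [if_neg h.not_gt, if_neg h.ne', if_neg this, mul_one]

theorem actN_mem_symN {deg : ι → ℤ} {e : ℤ} {s f : Module.End ℂ (FieldC d ι)}
    (hs : IsKoszulSign deg e s) (hf : HasDegree deg e f) {n : ℕ}
    {I : MultilinearMap ℂ (fun _ : Fin (n + 1) => FieldC d ι) ℂ} (hI : I ∈ symN deg n) :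
    actN s f I ∈ symN deg n := by
  intro p φ hφ j
  set σ := Equiv.swap j.castSucc j.succ with hσ
  have hσσ : ∀ i, σ (σ i) = i := fun i => Equiv.swap_apply_self _ _ i
  simp only [actN_apply, sum_apply, MultilinearMap.compLinearMap_apply]
  rw [← Equiv.sum_comp σ, Finset.mul_sum]
  refine Finset.sum_congr rfl fun l _ => ?_
  rw [apply_slot hs I hφ l]
  have hφσ : ∀ i, IsHomog deg ((p ∘ σ) i) ((φ ∘ σ) i) := fun i => hφ (σ i)
  rw [apply_slot hs I hφσ (σ l)]
  have e1 : Function.update (φ ∘ σ) (σ l) (f ((φ ∘ σ) (σ l))) =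
      (Function.update φ l (f (φ l))) ∘ σ := by
    ext1 i
    by_cases hi : i = σ l
    · subst hi; simp [hσσ]
    · have : σ i ≠ l := fun h => hi (by rw [← h, hσσ])
      simp [hi, this]
  have hup : ∀ i, IsHomog deg (p i + if i = l then e else 0) (Function.update φ l (f (φ l)) i) := by
    intro i
    by_cases hi : i = l
    · subst hi; simpa using hf _ _ (hφ i)
    · simpa [hi] using hφ i
  rw [e1, hI _ _ hup j, ← mul_assoc, ← mul_assoc]
  congr 1
  have hne : j.castSucc ≠ j.succ := (Fin.castSucc_lt_succ (i := j)).ne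
  have h0 : (-1 : ℂ) ≠ 0 := by norm_num
  have below : (∏ i, if i < j.castSucc then (-1 : ℂ) ^ (e * (p ∘ σ) i) else 1) =
      ∏ i, if i < j.castSucc then (-1 : ℂ) ^ (e * p i) else 1 := by
    refine Finset.prod_congr rfl fun i _ => ?_
    split_ifs with h
    · rw [Function.comp_apply, hσ, Equiv.swap_apply_of_ne_of_ne h.ne
        (h.trans Fin.castSucc_lt_succ).ne]
    · rfl
  by_cases hl1 : l = j.castSucc
  · subst hl1
    rw [hσ, Equiv.swap_apply_left, prod_lt_succ (fun i => (-1 : ℂ) ^ (e * (p ∘ _) i)), ← hσ, below]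
    simp only [Function.comp_apply, hσ, Equiv.swap_apply_left, if_true, if_neg hne.symm, add_zero]
    rw [add_mul, zpow_add₀ h0]
    linear_combination (∏ i, if i < j.castSucc then (-1 : ℂ) ^ (e * p i) else 1) *
      (-1) ^ (p j.castSucc * p j.succ) * neg_one_zpow_mul_self (e * p j.succ)
  · by_cases hl2 : l = j.succ
    · subst hl2
      rw [hσ, Equiv.swap_apply_right, ← hσ, below, prod_lt_succ]
      simp only [if_true, if_neg hne, add_zero]
      rw [mul_add, zpow_add₀ h0, mul_comm (p j.castSucc) e]
      ring
    · rw [if_neg (Ne.symm hl1), if_neg (Ne.symm hl2), add_zero, add_zero, mul_comm]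
      congr 1
      have e2 : σ l = l := Equiv.swap_apply_of_ne_of_ne hl1 hl2
      rw [e2, ← Equiv.prod_comp σ]
      refine Finset.prod_congr rfl fun i _ => ?_
      simp only [Function.comp_apply, Equiv.swap_apply_self, hσ, swap_castSucc_succ_lt_iff j hl1 hl2]

end Degree

/-! ### Relations between the operators on fields -/

section Relations

variable {d : ℕ} {ι : Type u} {M : Type*} [AddCommGroup M] [Module ℂ M]

theorem posSign_mul_self (i : Fin d) (S : Finset (Fin d)) : posSign i S * posSign i S = 1 := by
  rw [posSign, ← mul_pow]; simp

theorem posSign_insert {i k : Fin d} {S : Finset (Fin d)} (h : k ∉ S) :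
    posSign i (insert k S) = (if k < i then -1 else 1) * posSign i S := by
  unfold posSign
  rw [Finset.filter_insert]
  split_ifs with h'
  · rw [Finset.card_insert_of_notMem (by simp [h]), pow_succ']
  · rw [one_mul]

theorem posSign_erase {i k : Fin d} {S : Finset (Fin d)} (h : k ∈ S) :
    posSign i (S.erase k) = (if k < i then -1 else 1) * posSign i S := by
  conv_rhs => rw [← Finset.insert_erase h, posSign_insert (Finset.notMem_erase k S)]
  split_ifs <;> simp

theorem contract_apply (i : Fin d) (φ : Form d ι M) (s : Finset (Fin d) × ι) :
    contract i φ s = if i ∈ s.1 then 0 else posSign i s.1 • φ (insert i s.1, s.2) := rfl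

theorem wedge_apply (i : Fin d) (φ : Form d ι M) (s : Finset (Fin d) × ι) :
    wedge i φ s = if i ∈ s.1 then posSign i s.1 • φ (s.1.erase i, s.2) else 0 := rfl

theorem onCoeff_apply (D : Module.End ℂ M) (φ : Form d ι M) (s : Finset (Fin d) × ι) :
    onCoeff D φ s = D (φ s) := rfl

theorem onFibre_apply [Fintype ι] (A : Matrix ι ι ℂ) (φ : Form d ι M) (s : Finset (Fin d) × ι) :
    onFibre A φ s = ((-1 : ℂ) ^ s.1.card) • ∑ b, A s.2 b • φ (s.1, b) := rfl

theorem parity_apply (deg : ι → ℤ) (φ : Form d ι M) (s : Finset (Fin d) × ι) :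
    parity deg φ s = ((-1 : ℂ) ^ ((s.1.card : ℤ) + deg s.2)) • φ s := rfl

theorem wedge_mul_contract_apply (i : Fin d) (φ : Form d ι M) (s : Finset (Fin d) × ι) :
    (wedge i * contract i : Module.End ℂ (Form d ι M)) φ s = if i ∈ s.1 then φ s else 0 := by
  change wedge i (contract i φ) s = _
  rw [wedge_apply]
  split_ifs with h
  · rw [contract_apply, if_neg (by simp), posSign_erase h, smul_smul]
    simp [Finset.insert_erase h, posSign_mul_self]
  · rfl

theorem contract_mul_wedge_add (i k : Fin d) :
    (contract k * wedge i + wedge i * contract k : Module.End ℂ (Form d ι M)) =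
      if i = k then 1 else 0 := by
  ext φ s
  split_ifs with hik
  · subst hik
    change contract i (wedge i φ) s + (wedge i * contract i : Module.End ℂ (Form d ι M)) φ s = φ s
    rw [wedge_mul_contract_apply, contract_apply]
    by_cases h : i ∈ s.1
    · simp [h]
    · simp [h, wedge_apply, posSign_insert h, smul_smul, posSign_mul_self]
  · change contract k (wedge i φ) s + wedge i (contract k φ) s = 0
    rw [wedge_apply, contract_apply]
    by_cases hk : k ∈ s.1
    · simp [hk, contract_apply, Ne.symm hik]
    · by_cases hi : i ∈ s.1
      · have e : (insert k s.1).erase i = insert k (s.1.erase i) :=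
          Finset.erase_insert_of_ne (Ne.symm hik)
        simp only [hk, hi, if_true, if_false, wedge_apply, contract_apply, Finset.mem_insert,
          or_true, Finset.mem_erase, and_false, e, posSign_insert hk, posSign_erase hi, smul_smul]
        rw [← add_smul]
        rcases lt_or_gt_of_ne hik with h | h
        · simp [h, h.not_gt, mul_comm]
        · simp [h, h.not_gt, mul_comm]
      · simp [hk, hi, wedge_apply, hik]

theorem contract_mul_contract_add (i k : Fin d) :
    (contract i * contract k + contract k * contract i : Module.End ℂ (Form d ι M)) = 0 := by
  ext φ s
  change contract i (contract k φ) s + contract k (contract i φ) s = 0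
  simp only [contract_apply]
  by_cases hi : i ∈ s.1
  · simp [hi]
  · by_cases hk : k ∈ s.1
    · simp [hk]
    · by_cases hik : i = k
      · subst hik; simp
      · simp only [hi, hk, if_false, Finset.mem_insert, hik, Ne.symm hik, or_self,
          posSign_insert hi, posSign_insert hk, smul_smul, Finset.insert_comm k i]
        rw [← add_smul]
        rcases lt_or_gt_of_ne hik with h | h
        · simp [h, h.not_gt, mul_comm]
        · simp [h, h.not_gt, mul_comm]

theorem onCoeff_mul (D D' : Module.End ℂ M) :
    (onCoeff (D * D') : Module.End ℂ (Form d ι M)) = onCoeff D * onCoeff D' := rfl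

theorem onCoeff_add (D D' : Module.End ℂ M) :
    (onCoeff (D + D') : Module.End ℂ (Form d ι M)) = onCoeff D + onCoeff D' := rfl

theorem onCoeff_one : (onCoeff 1 : Module.End ℂ (Form d ι M)) = 1 := rfl

theorem onCoeff_zero : (onCoeff 0 : Module.End ℂ (Form d ι M)) = 0 := rfl

theorem onCoeff_contract (D : Module.End ℂ M) (i : Fin d) :
    Commute (onCoeff D : Module.End ℂ (Form d ι M)) (contract i) := by
  ext φ s
  change D (contract i φ s) = contract i (onCoeff D φ) s
  simp only [contract_apply, onCoeff_apply]
  split_ifs <;> simp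

theorem onCoeff_wedge (D : Module.End ℂ M) (i : Fin d) :
    Commute (onCoeff D : Module.End ℂ (Form d ι M)) (wedge i) := by
  ext φ s
  change D (wedge i φ s) = wedge i (onCoeff D φ) s
  simp only [wedge_apply, onCoeff_apply]
  split_ifs <;> simp

theorem onCoeff_onFibre [Fintype ι] (D : Module.End ℂ M) (A : Matrix ι ι ℂ) :
    Commute (onCoeff D : Module.End ℂ (Form d ι M)) (onFibre A) := by
  ext φ s
  change D (onFibre A φ s) = onFibre A (onCoeff D φ) s
  simp [onFibre_apply, onCoeff_apply]

theorem contract_mul_onFibre_add [Fintype ι] (i : Fin d) (A : Matrix ι ι ℂ) :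
    (contract i * onFibre A + onFibre A * contract i : Module.End ℂ (Form d ι M)) = 0 := by
  ext φ s
  change contract i (onFibre A φ) s + onFibre A (contract i φ) s = 0
  simp only [contract_apply, onFibre_apply]
  by_cases h : i ∈ s.1
  · simp [h]
  · simp only [h, if_false, Finset.card_insert_of_notMem h, pow_succ, Finset.smul_sum, smul_smul,
      ← Finset.sum_add_distrib, ← add_smul]
    refine Finset.sum_eq_zero fun b _ => ?_
    convert! zero_smul ℂ _ using 2
    ring

theorem parity_mul_self (deg : ι → ℤ) :
    (parity deg * parity deg : Module.End ℂ (Form d ι M)) = 1 := by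
  ext φ s
  change parity deg (parity deg φ) s = φ s
  rw [parity_apply, parity_apply, smul_smul, neg_one_zpow_mul_self, one_smul]

/-- Multiplication by `z̄_i`, on test functions. -/
def zbarC (i : Fin d) : Module.End ℂ (Test d) := mulC (coord (.inr i))

theorem pdC_mul_zbarC (k : Fin d ⊕ Fin d) (i : Fin d) :
    pdC k * zbarC i = zbarC i * pdC k + if k = .inr i then 1 else 0 := by
  rw [zbarC, pdC_mul_mulC, pd_coord]
  split_ifs
  · rw [mulC_one]
  · congr 1
    ext1 f; exact Subtype.ext (zero_mul f.1)

/-- Contraction with the Euler vector field `∑ z̄_i ∂/∂z̄_i`. -/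
def eulerContract (d : ℕ) (ι : Type u) : Module.End ℂ (FieldC d ι) :=
  ∑ i, onCoeff (zbarC i) * contract i

/-- The Lie derivative along the Euler vector field `∑ z̄_i ∂/∂z̄_i`. -/
def eulerLie (d : ℕ) (ι : Type u) : Module.End ℂ (FieldC d ι) :=
  ∑ i, (onCoeff (zbarC i * dzbarC i) + wedge i * contract i)

theorem contract_mul_delbar_add (k : Fin d) (D : Fin d → Module.End ℂ M) :
    contract k * delbar D + delbar D * contract k =
      (onCoeff (D k) : Module.End ℂ (Form d ι M)) := by
  rw [delbar, Finset.mul_sum, Finset.sum_mul, ← Finset.sum_add_distrib]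
  have : ∀ i, contract k * (wedge i * onCoeff (D i)) + wedge i * onCoeff (D i) * contract k =
      ((if i = k then 1 else 0) * onCoeff (D i) : Module.End ℂ (Form d ι M)) := by
    intro i
    rw [mul_assoc (wedge i), (onCoeff_contract (D i) k).eq, ← mul_assoc, ← mul_assoc, ← add_mul,
      contract_mul_wedge_add]
  simp [this]

theorem contract_mul_holOp_add [Fintype ι] (k : Fin d) (D : Fin d → Module.End ℂ M)
    (μ : (Fin d → ℕ) →₀ Matrix ι ι ℂ) :
    (contract k * holOp D μ + holOp D μ * contract k : Module.End ℂ (Form d ι M)) = 0 := by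
  rw [holOp, Finsupp.sum, Finset.mul_sum, Finset.sum_mul, ← Finset.sum_add_distrib]
  refine Finset.sum_eq_zero fun α _ => ?_
  rw [← mul_assoc, ← (onCoeff_contract _ k).eq, mul_assoc, mul_assoc, ← mul_add,
    contract_mul_onFibre_add, mul_zero]

theorem commute_onCoeff_delbar (D : Fin d → Module.End ℂ M) {a : Module.End ℂ M}
    (h : ∀ i, Commute a (D i)) : Commute (onCoeff a : Module.End ℂ (Form d ι M)) (delbar D) := by
  refine Commute.sum_right _ _ _ fun i _ => ?_
  refine Commute.mul_right (onCoeff_wedge a i) ?_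
  rw [Commute, SemiconjBy, ← onCoeff_mul, ← onCoeff_mul, (h i).eq]

theorem commute_onCoeff_holOp [Fintype ι] (D : Fin d → Module.End ℂ M) {a : Module.End ℂ M}
    (h : ∀ i, Commute a (D i)) (μ : (Fin d → ℕ) →₀ Matrix ι ι ℂ) :
    Commute (onCoeff a : Module.End ℂ (Form d ι M)) (holOp D μ) := by
  refine Commute.sum_right _ _ _ fun α _ => ?_
  refine Commute.mul_right ?_ (onCoeff_onFibre a _)
  rw [Commute, SemiconjBy, ← onCoeff_mul, ← onCoeff_mul, (commute_multi h α).eq]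

theorem commute_zbarC_dzC (i k : Fin d) : Commute (zbarC i) (dzC k) := by
  have := pdC_mul_zbarC (.inl k) i
  simp only [reduceCtorEq, if_false, add_zero] at this
  exact this.symm

theorem delbar_mul_onCoeff {D : Fin d → Module.End ℂ M} {Z : Module.End ℂ M} {k : Fin d}
    (h : ∀ i, D i * Z = Z * D i + if i = k then 1 else 0) :
    (delbar D * onCoeff Z : Module.End ℂ (Form d ι M)) = onCoeff Z * delbar D + wedge k := by
  have : ∀ i, (wedge i * onCoeff (D i) * onCoeff Z : Module.End ℂ (Form d ι M)) =
      onCoeff Z * (wedge i * onCoeff (D i)) + if i = k then wedge i else 0 := by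
    intro i
    rw [mul_assoc, ← onCoeff_mul, h, onCoeff_add, mul_add, onCoeff_mul, ← mul_assoc,
      ← (onCoeff_wedge _ i).eq, mul_assoc]
    split_ifs
    · rw [onCoeff_one, mul_one]
    · rw [onCoeff_zero, mul_zero]
  simp only [delbar, Finset.sum_mul, Finset.mul_sum, this, Finset.sum_add_distrib]
  simp

theorem delbar_mul_sum_contract_add {D Z : Fin d → Module.End ℂ M}
    (h : ∀ i k, D i * Z k = Z k * D i + if i = k then 1 else 0) :
    (delbar D * (∑ i, onCoeff (Z i) * contract i) + (∑ i, onCoeff (Z i) * contract i) * delbar D :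
      Module.End ℂ (Form d ι M)) = ∑ i, (onCoeff (Z i * D i) + wedge i * contract i) := by
  simp only [Finset.mul_sum, Finset.sum_mul, ← Finset.sum_add_distrib]
  refine Finset.sum_congr rfl fun k _ => ?_
  have h2 := contract_mul_delbar_add (ι := ι) k D
  rw [onCoeff_mul, ← h2, ← mul_assoc, delbar_mul_onCoeff fun i => h i k]
  noncomm_ring

theorem delbar_mul_eulerContract_add :
    delbar dzbarC * eulerContract d ι + eulerContract d ι * delbar dzbarC = eulerLie d ι := by
  refine delbar_mul_sum_contract_add fun i k => ?_
  have h := pdC_mul_zbarC (.inr i) k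
  simp only [Sum.inr.injEq] at h
  exact h

theorem holOp_mul_eulerContract_add [Fintype ι] (μ : (Fin d → ℕ) →₀ Matrix ι ι ℂ) :
    holOp dzC μ * eulerContract d ι + eulerContract d ι * holOp dzC μ = 0 := by
  simp only [eulerContract, Finset.mul_sum, Finset.sum_mul, ← Finset.sum_add_distrib]
  refine Finset.sum_eq_zero fun k _ => ?_
  rw [← mul_assoc, ← (commute_onCoeff_holOp dzC (commute_zbarC_dzC k) μ).eq, mul_assoc, mul_assoc,
    ← mul_add, add_comm, contract_mul_holOp_add, mul_zero]

theorem onCoeff_pdC_mul_eulerContract (k : Fin d ⊕ Fin d) :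
    onCoeff (pdC k) * eulerContract d ι - eulerContract d ι * onCoeff (pdC k) =
      Sum.elim (fun _ => 0) contract k := by
  have h : ∀ i, onCoeff (pdC k) * (onCoeff (zbarC i) * contract i) -
      onCoeff (zbarC i) * contract i * onCoeff (pdC k) =
      ((if k = .inr i then contract i else 0) : Module.End ℂ (FieldC d ι)) := by
    intro i
    rw [← mul_assoc, ← onCoeff_mul, pdC_mul_zbarC, mul_assoc (onCoeff _), ← (onCoeff_contract _ i).eq,
      ← mul_assoc, ← onCoeff_mul, onCoeff_add, add_mul, add_sub_cancel_left]
    split_ifs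
    · rw [onCoeff_one, one_mul]
    · rw [onCoeff_zero, zero_mul]
  simp only [eulerContract, Finset.mul_sum, Finset.sum_mul, ← Finset.sum_sub_distrib, h]
  rcases k with k | k <;> simp

theorem contract_mul_eulerContract_add (k : Fin d) :
    contract k * eulerContract d ι + eulerContract d ι * contract k = 0 := by
  simp only [eulerContract, Finset.mul_sum, Finset.sum_mul, ← Finset.sum_add_distrib]
  refine Finset.sum_eq_zero fun i _ => ?_
  rw [← mul_assoc, ← (onCoeff_contract _ k).eq, mul_assoc, mul_assoc, ← mul_add,
    contract_mul_contract_add, mul_zero]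

/-! #### Degrees -/

variable {deg : ι → ℤ}

theorem HasDegree.add {e : ℤ} {f g : Module.End ℂ (FieldC d ι)} (hf : HasDegree deg e f)
    (hg : HasDegree deg e g) : HasDegree deg e (f + g) := by
  intro p φ hφ s hs
  change f φ s + g φ s = 0
  rw [hf p φ hφ s hs, hg p φ hφ s hs, add_zero]

theorem HasDegree.sum {κ : Type*} {e : ℤ} {t : Finset κ} {f : κ → Module.End ℂ (FieldC d ι)}
    (hf : ∀ k ∈ t, HasDegree deg e (f k)) : HasDegree deg e (∑ k ∈ t, f k) := by
  intro p φ hφ s hs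
  rw [LinearMap.sum_apply, Finset.sum_apply]
  exact Finset.sum_eq_zero fun k hk => hf k hk p φ hφ s hs

theorem HasDegree.mul {e e' : ℤ} {f g : Module.End ℂ (FieldC d ι)} (hf : HasDegree deg e f)
    (hg : HasDegree deg e' g) : HasDegree deg (e' + e) (f * g) := by
  intro p φ hφ
  rw [← add_assoc]
  exact hf _ _ (hg _ _ hφ)

theorem hasDegree_onCoeff (D : Module.End ℂ (Test d)) : HasDegree deg 0 (onCoeff D) := by
  intro p φ hφ s hs
  rw [onCoeff_apply, hφ s (by simpa using hs), map_zero]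

theorem hasDegree_contract (i : Fin d) : HasDegree deg (-1) (contract i) := by
  intro p φ hφ s hs
  rw [contract_apply]
  split_ifs with h
  · rfl
  · rw [hφ, smul_zero]
    rw [Finset.card_insert_of_notMem h]
    push_cast
    intro h'
    exact hs (by simp only [← h']; ring)

theorem hasDegree_wedge (i : Fin d) : HasDegree deg 1 (wedge i) := by
  intro p φ hφ s hs
  rw [wedge_apply]
  split_ifs with h
  · rw [hφ, smul_zero]
    have := Finset.card_erase_add_one h
    intro h'
    apply hs
    rw [← h', ← this]
    push_cast
    ring
  · rfl

theorem hasDegree_onFibre [Fintype ι] {A : Matrix ι ι ℂ}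
    (hA : ∀ a b, A a b ≠ 0 → deg a = deg b + 1) : HasDegree (d := d) deg 1 (onFibre A) := by
  intro p φ hφ s hs
  rw [onFibre_apply, Finset.sum_eq_zero, smul_zero]
  intro b _
  by_cases h : A s.2 b = 0
  · rw [h, zero_smul]
  · rw [hφ, smul_zero]
    intro h'
    apply hs
    rw [hA _ _ h, ← h']
    ring

theorem hasDegree_delbar (D : Fin d → Module.End ℂ (Test d)) : HasDegree deg 1 (delbar D) :=
  HasDegree.sum fun i _ => (hasDegree_wedge i).mul (hasDegree_onCoeff (D i))

theorem hasDegree_holOp [Fintype ι] (D : Fin d → Module.End ℂ (Test d))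
    {μ : (Fin d → ℕ) →₀ Matrix ι ι ℂ} (hμ : ∀ α a b, μ α a b ≠ 0 → deg a = deg b + 1) :
    HasDegree deg 1 (holOp D μ) :=
  HasDegree.sum fun α _ => (hasDegree_onCoeff _).mul (hasDegree_onFibre (hμ α))

theorem hasDegree_eulerContract : HasDegree deg (-1) (eulerContract d ι) :=
  HasDegree.sum fun i _ => (hasDegree_onCoeff _).mul (hasDegree_contract i)

theorem hasDegree_eulerLie : HasDegree deg 0 (eulerLie d ι) :=
  HasDegree.sum fun i _ => (hasDegree_onCoeff _).add
    ((hasDegree_wedge i).mul (hasDegree_contract i))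

theorem parity_anticommute [Fintype ι] {e : ℤ} (he : Odd e) {f : Module.End ℂ (FieldC d ι)}
    (hf : HasDegree deg e f) : parity deg * f = (-1 : ℂ) • (f * parity deg) := by
  classical
  refine LinearMap.pi_ext fun s x => ?_
  have hx : IsHomog deg ((s.1.card : ℤ) + deg s.2) (Pi.single s x : FieldC d ι) := by
    intro t ht
    rw [Pi.single_apply, if_neg]
    rintro rfl
    exact ht rfl
  change parity deg (f (Pi.single s x)) = (-1 : ℂ) • f (parity deg (Pi.single s x))
  have h1 : Odd (1 : ℤ) := odd_one
  rw [isKoszulSign_parity deg h1 _ _ hx, isKoszulSign_parity deg h1 _ _ (hf _ _ hx), map_smul,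
    smul_smul]
  congr 1
  rw [one_mul, one_mul, zpow_add₀ (by norm_num), he.neg_one_zpow]
  ring

/-! #### Compactly supported fields as smooth fields -/

/-- The inclusion of compactly supported fields into smooth fields. -/
def toSmooth : FieldC d ι →ₗ[ℂ] SmoothField d ι where
  toFun φ s := (φ s).1
  map_add' _ _ := rfl
  map_smul' _ _ := rfl

theorem toSmooth_injective : Function.Injective (toSmooth (d := d) (ι := ι)) := by
  intro φ ψ h
  ext1 s
  exact Subtype.ext (congrFun h s)

theorem toSmooth_onCoeff {D : Module.End ℂ (Test d)} {D' : Module.End ℂ (Smooth d)}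
    (h : ∀ f, (D f).1 = D' f.1) (φ : FieldC d ι) :
    toSmooth (onCoeff D φ) = onCoeff D' (toSmooth φ) := by
  ext1 s
  exact h (φ s)

theorem toSmooth_wedge (i : Fin d) (φ : FieldC d ι) :
    toSmooth (wedge i φ) = wedge i (toSmooth φ) := by
  ext1 s
  change (wedge i φ s).1 = _
  rw [wedge_apply, wedge_apply]
  split_ifs <;> rfl

theorem toSmooth_onFibre [Fintype ι] (A : Matrix ι ι ℂ) (φ : FieldC d ι) :
    toSmooth (onFibre A φ) = onFibre A (toSmooth φ) := by
  ext1 s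
  change (onFibre A φ s).1 = _
  rw [onFibre_apply, onFibre_apply]
  simp [toSmooth]

theorem coe_multi_dzC (α : Fin d → ℕ) (f : Test d) : (multi dzC α f).1 = multi dz α f.1 := by
  have hc : ∀ i j : Fin d, Commute (dzC i) (dzC j) := fun i j => pdC_comm (.inl i) (.inl j)
  have hs : ∀ i j : Fin d, Commute (dz i) (dz j) := fun i j => pd_comm (.inl i) (.inl j)
  induction α using multiIndex_induction with
  | h0 => simp [multi_zero]
  | h α i ih =>
    rw [multi_add_single hc, multi_add_single hs]
    change dz i (multi dzC α f).1 = dz i (multi dz α f.1)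
    rw [ih]

theorem toSmooth_holOp [Fintype ι] (μ : (Fin d → ℕ) →₀ Matrix ι ι ℂ) (φ : FieldC d ι) :
    toSmooth (holOp dzC μ φ) = holOp dz μ (toSmooth φ) := by
  rw [holOp, holOp, Finsupp.sum, Finsupp.sum, LinearMap.sum_apply, map_sum, LinearMap.sum_apply]
  refine Finset.sum_congr rfl fun α _ => ?_
  change toSmooth (onCoeff _ (onFibre _ φ)) = onCoeff _ (onFibre _ (toSmooth φ))
  rw [toSmooth_onCoeff (coe_multi_dzC α), toSmooth_onFibre]

theorem toSmooth_delbar (φ : FieldC d ι) :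
    toSmooth (delbar dzbarC φ) = delbar dzbar (toSmooth φ) := by
  rw [delbar, delbar, LinearMap.sum_apply, map_sum, LinearMap.sum_apply]
  refine Finset.sum_congr rfl fun i _ => ?_
  change toSmooth (wedge i (onCoeff _ φ)) = wedge i (onCoeff _ (toSmooth φ))
  rw [toSmooth_wedge, toSmooth_onCoeff (D := dzbarC i) (D' := dzbar i) fun f => coe_pdC (.inr i) f]

namespace FreeTheory

variable [Fintype ι] (T : FreeTheory d ι)

/-- The operator `∂̄ + Q^{hol}` on compactly supported fields. -/
def fieldDiff : Module.End ℂ (FieldC d ι) := delbar dzbarC + holOp dzC T.μ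

theorem fieldDiff_mul_self : T.fieldDiff * T.fieldDiff = 0 := by
  have h : ∀ φ, toSmooth (T.fieldDiff φ) =
      (delbar dzbar + holOp dz T.μ : Module.End ℂ (SmoothField d ι)) (toSmooth φ) := by
    intro φ
    rw [fieldDiff, LinearMap.add_apply, LinearMap.add_apply, map_add, toSmooth_delbar,
      toSmooth_holOp]
  ext1 φ
  apply toSmooth_injective
  change toSmooth (T.fieldDiff (T.fieldDiff φ)) = toSmooth 0
  rw [h, h, map_zero]
  exact LinearMap.congr_fun T.sq_zero (toSmooth φ)

theorem hasDegree_fieldDiff : HasDegree T.deg 1 T.fieldDiff :=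
  (hasDegree_delbar _).add (hasDegree_holOp _ T.μ_degree)

theorem fieldDiff_mul_eulerContract_add :
    T.fieldDiff * eulerContract d ι + eulerContract d ι * T.fieldDiff = eulerLie d ι := by
  rw [fieldDiff, add_mul, mul_add, add_add_add_comm, delbar_mul_eulerContract_add,
    holOp_mul_eulerContract_add, add_zero]

theorem commute_eulerLie_fieldDiff : Commute (eulerLie d ι) T.fieldDiff := by
  rw [Commute, SemiconjBy, ← T.fieldDiff_mul_eulerContract_add, add_mul, mul_add, mul_assoc,
    mul_assoc, T.fieldDiff_mul_self, mul_zero, add_zero, ← mul_assoc T.fieldDiff T.fieldDiff,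
    T.fieldDiff_mul_self, zero_mul, zero_add]

theorem contract_mul_fieldDiff_add (i : Fin d) :
    contract i * T.fieldDiff + T.fieldDiff * contract i = onCoeff (pdC (.inr i)) := by
  have h1 := contract_mul_delbar_add (ι := ι) i dzbarC
  have h2 := contract_mul_holOp_add i dzC T.μ
  rw [fieldDiff, mul_add, add_mul]
  calc _ = (contract i * delbar dzbarC + delbar dzbarC * contract i) +
      (contract i * holOp dzC T.μ + holOp dzC T.μ * contract i) := by abel
    _ = _ := by rw [h1, h2, add_zero]; rfl

theorem commute_onCoeff_pdC_fieldDiff (k : Fin d ⊕ Fin d) :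
    Commute (onCoeff (pdC k)) T.fieldDiff :=
  .add_right (commute_onCoeff_delbar _ fun i => pdC_comm k (.inr i))
    (commute_onCoeff_holOp _ (fun i => pdC_comm k (.inl i)) _)

end FreeTheory

end Relations

/-! ### Integrals of polydifferential expressions -/

section Local

variable {d : ℕ} {ι : Type u} {n : ℕ}

/-- The product of `n + 1` test functions. -/
def prodT (d n : ℕ) : MultilinearMap ℂ (fun _ : Fin (n + 1) => Test d) (Test d) :=
  ((MultilinearMap.mkPiAlgebra ℂ (Fin (n + 1)) (Smooth d)).compLinearMap
    fun _ => (Test d).subtype).codRestrict (Test d) fun f => by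
      simp only [MultilinearMap.compLinearMap_apply, MultilinearMap.mkPiAlgebra_apply,
        Fin.prod_univ_succ, mul_comm _ (∏ i : Fin n, _)]
      exact mul_mem_test _ _ (f 0).2

theorem coe_prodT (f : Fin (n + 1) → Test d) : (prodT d n f).1 = ∏ j, (f j).1 := rfl

theorem coe_finset_prod {κ : Type*} (t : Finset κ) (f : κ → Smooth d) (x : Fin d → ℂ) :
    (∏ j ∈ t, f j).1 x = ∏ j ∈ t, (f j).1 x := by
  classical
  induction t using Finset.induction_on with
  | empty => simp
  | insert a t ha ih => rw [Finset.prod_insert ha, Finset.prod_insert ha, ← ih]; rfl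

theorem coe_finset_sum {κ : Type*} (t : Finset κ) (f : κ → Smooth d) (x : Fin d → ℂ) :
    (∑ j ∈ t, f j).1 x = ∑ j ∈ t, (f j).1 x := by
  classical
  induction t using Finset.induction_on with
  | empty => simp
  | insert a t ha ih => rw [Finset.sum_insert ha, Finset.sum_insert ha, ← ih]; rfl

theorem pd_prod {κ : Type*} [DecidableEq κ] (k : Fin d ⊕ Fin d) (t : Finset κ) (f : κ → Smooth d) :
    pd k (∏ j ∈ t, f j) = ∑ j ∈ t, pd k (f j) * ∏ i ∈ t.erase j, f i := by
  induction t using Finset.induction_on with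
  | empty => simp [pd_one]
  | insert a t ha ih =>
    rw [Finset.prod_insert ha, pd_mul, ih, Finset.sum_insert ha, Finset.erase_insert ha,
      Finset.mul_sum]
    congr 1
    refine Finset.sum_congr rfl fun j hj => ?_
    have : j ≠ a := fun h => ha (h ▸ hj)
    rw [Finset.erase_insert_of_ne this.symm, Finset.prod_insert (by simp [ha])]
    ring

theorem pdC_prodT (k : Fin d ⊕ Fin d) (f : Fin (n + 1) → Test d) :
    pdC k (prodT d n f) = ∑ j, prodT d n (Function.update f j (pdC k (f j))) := by
  apply Subtype.ext
  rw [coe_pdC, coe_prodT, pd_prod, AddSubmonoidClass.coe_finsetSum]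
  refine Finset.sum_congr rfl fun j _ => ?_
  rw [coe_prodT]
  have : (fun i => (Function.update f j (pdC k (f j)) i).1) =
      Function.update (fun i => (f i).1) j (pd k (f j).1) := by
    ext1 i
    by_cases hi : i = j
    · subst hi; simp [coe_pdC]
    · simp [hi]
  simp only [this, Finset.prod_update_of_mem (Finset.mem_univ j), Finset.sdiff_singleton_eq_erase]

/-- The functional `φ ↦ ∫ c · X_0 φ_0 ⋯ X_n φ_n`, depending multilinearly on the `X_j`. -/
def density (c : Smooth d) : MultilinearMap ℂ (fun _ : Fin (n + 1) => FieldC d ι →ₗ[ℂ] Test d)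
    (MultilinearMap ℂ (fun _ : Fin (n + 1) => FieldC d ι) ℂ) :=
  MultilinearMap.piLinearMap ((integ ∘ₗ mulC c).compMultilinearMap (prodT d n))

theorem density_apply (c : Smooth d) (X : Fin (n + 1) → FieldC d ι →ₗ[ℂ] Test d)
    (φ : Fin (n + 1) → FieldC d ι) :
    density c X φ = integ (mulC c (prodT d n fun j => X j (φ j))) := rfl

theorem density_apply_eq_integral (c : Smooth d) (X : Fin (n + 1) → FieldC d ι →ₗ[ℂ] Test d)
    (φ : Fin (n + 1) → FieldC d ι) :
    density c X φ = ∫ x : Fin d → ℂ, c.1 x * ∏ j, (X j (φ j)).1.1 x := by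
  rw [density_apply]
  change ∫ x, c.1 x * (prodT d n fun j => X j (φ j)).1.1 x = _
  simp_rw [coe_prodT, coe_finset_prod]

theorem density_comp (c : Smooth d) (X : Fin (n + 1) → FieldC d ι →ₗ[ℂ] Test d)
    (G : Fin (n + 1) → Module.End ℂ (FieldC d ι)) :
    (density c X).compLinearMap G = density c fun j => X j ∘ₗ G j := rfl

theorem density_add (c c' : Smooth d) (X : Fin (n + 1) → FieldC d ι →ₗ[ℂ] Test d) :
    density (c + c') X = density c X + density c' X := by
  ext φ
  simp [density_apply, mulC_add]

theorem density_smul (r : ℂ) (c : Smooth d) (X : Fin (n + 1) → FieldC d ι →ₗ[ℂ] Test d) :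
    density (r • c) X = r • density c X := by
  ext φ
  simp [density_apply, mulC_smul]

theorem density_update_mulC (c c' : Smooth d) (X : Fin (n + 1) → FieldC d ι →ₗ[ℂ] Test d)
    (j : Fin (n + 1)) (Y : FieldC d ι →ₗ[ℂ] Test d) :
    density c (Function.update X j (mulC c' ∘ₗ Y)) = density (c * c') (Function.update X j Y) := by
  ext φ
  rw [density_apply, density_apply]
  congr 1
  apply Subtype.ext
  rw [coe_mulC, coe_mulC, mul_assoc]
  congr 1
  rw [coe_prodT, coe_prodT]
  have h : ∀ Z : FieldC d ι →ₗ[ℂ] Test d, (fun i => (Function.update X j Z i (φ i)).1) =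
      Function.update (fun i => (X i (φ i)).1) j (Z (φ j)).1 := by
    intro Z
    ext1 i
    by_cases hi : i = j
    · subst hi; simp
    · simp [hi]
  rw [h, h, Finset.prod_update_of_mem (Finset.mem_univ j),
    Finset.prod_update_of_mem (Finset.mem_univ j), ← mul_assoc]
  rfl

/-- Integration by parts. -/
theorem sum_density_pdC (c : Smooth d) (X : Fin (n + 1) → FieldC d ι →ₗ[ℂ] Test d)
    (k : Fin d ⊕ Fin d) :
    ∑ j, density c (Function.update X j (pdC k ∘ₗ X j)) = -density (pd k c) X := by
  ext φ
  have h0 := integ_pdC k (mulC c (prodT d n fun j => X j (φ j)))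
  have h1 : pdC k (mulC c (prodT d n fun j => X j (φ j))) =
      mulC c (pdC k (prodT d n fun j => X j (φ j))) +
        mulC (pd k c) (prodT d n fun j => X j (φ j)) :=
    LinearMap.congr_fun (pdC_mul_mulC k c) _
  rw [h1, pdC_prodT, map_sum, map_add, map_sum] at h0
  rw [sum_apply, neg_apply, ← sub_eq_zero, sub_neg_eq_add, ← h0]
  congr 1
  refine Finset.sum_congr rfl fun j _ => ?_
  rw [density_apply]
  congr 3
  ext1 i
  by_cases hi : i = j
  · subst hi; simp
  · simp [hi]

theorem actN_one_density (c : Smooth d) (X : Fin (n + 1) → FieldC d ι →ₗ[ℂ] Test d)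
    (G : Module.End ℂ (FieldC d ι)) :
    actN 1 G (density c X) = ∑ j, density c (Function.update X j (X j ∘ₗ G)) := by
  rw [actN_apply]
  refine Finset.sum_congr rfl fun j _ => ?_
  rw [density_comp]
  congr 1
  ext1 i
  by_cases hi : i = j
  · subst hi; simp [slot_self]
  · simp only [slot, hi, if_false, ite_self, Function.update_of_ne, ne_eq, not_false_eq_true]
    rfl

/-- Jet coordinates: a multi-index in the `z_i` and `z̄_i`, and a component of the field. -/
abbrev Jet (d : ℕ) (ι : Type u) : Type u := (Fin d ⊕ Fin d → ℕ) × Finset (Fin d) × ι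

/-- A jet coordinate of fields. -/
def jetL (J : Jet d ι) : FieldC d ι →ₗ[ℂ] Test d := Dop J.1 ∘ₗ LinearMap.proj J.2

theorem jetL_apply (J : Jet d ι) (φ : FieldC d ι) : jetL J φ = Dop J.1 (φ J.2) := rfl

/-- Differential operators from fields to functions. -/
def diffOps (d : ℕ) (ι : Type u) : Submodule ℂ (FieldC d ι →ₗ[ℂ] Test d) :=
  Submodule.span ℂ {L | ∃ c J, L = mulC c ∘ₗ jetL J}

theorem jetL_mem_diffOps (J : Jet d ι) : jetL J ∈ diffOps d ι :=
  Submodule.subset_span ⟨1, J, by rw [mulC_one]; rfl⟩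

theorem mulC_comp_mem_diffOps (c : Smooth d) {L : FieldC d ι →ₗ[ℂ] Test d}
    (hL : L ∈ diffOps d ι) : mulC c ∘ₗ L ∈ diffOps d ι := by
  induction hL using Submodule.span_induction with
  | mem L h =>
    obtain ⟨c', J, rfl⟩ := h
    refine Submodule.subset_span ⟨c * c', J, ?_⟩
    rw [mulC_mul]
    rfl
  | zero => rw [LinearMap.comp_zero]; exact zero_mem _
  | add L L' _ _ h h' => rw [LinearMap.comp_add]; exact add_mem h h'
  | smul r L _ h => rw [LinearMap.comp_smul]; exact Submodule.smul_mem _ r h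

/-- Differential operators on fields. -/
def IsDiffOp (G : Module.End ℂ (FieldC d ι)) : Prop :=
  ∀ L ∈ diffOps d ι, L ∘ₗ G ∈ diffOps d ι

theorem IsDiffOp.of_jetL {G : Module.End ℂ (FieldC d ι)} (h : ∀ J, jetL J ∘ₗ G ∈ diffOps d ι) :
    IsDiffOp G := by
  intro L hL
  induction hL using Submodule.span_induction with
  | mem L hL =>
    obtain ⟨c, J, rfl⟩ := hL
    rw [LinearMap.comp_assoc]
    exact mulC_comp_mem_diffOps c (h J)
  | zero => rw [LinearMap.zero_comp]; exact zero_mem _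
  | add L L' _ _ h h' => rw [LinearMap.add_comp]; exact add_mem h h'
  | smul r L _ h => rw [LinearMap.smul_comp]; exact Submodule.smul_mem _ r h

theorem isDiffOp_one : IsDiffOp (1 : Module.End ℂ (FieldC d ι)) := fun _ h => h

theorem IsDiffOp.mul {G G' : Module.End ℂ (FieldC d ι)} (h : IsDiffOp G) (h' : IsDiffOp G') :
    IsDiffOp (G * G') := fun L hL => h' _ (h L hL)

theorem IsDiffOp.add {G G' : Module.End ℂ (FieldC d ι)} (h : IsDiffOp G) (h' : IsDiffOp G') :
    IsDiffOp (G + G') := fun L hL => by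
  rw [LinearMap.comp_add]
  exact add_mem (h L hL) (h' L hL)

theorem IsDiffOp.sum {κ : Type*} {t : Finset κ} {G : κ → Module.End ℂ (FieldC d ι)}
    (h : ∀ k ∈ t, IsDiffOp (G k)) : IsDiffOp (∑ k ∈ t, G k) := by
  classical
  induction t using Finset.induction_on with
  | empty => intro L _; rw [Finset.sum_empty, LinearMap.comp_zero]; exact zero_mem _
  | insert a t ha ih =>
    rw [Finset.sum_insert ha]
    exact (h a (Finset.mem_insert_self a t)).add
      (ih fun k hk => h k (Finset.mem_insert_of_mem hk))

theorem jetL_comp_onCoeff (J : Jet d ι) (D : Module.End ℂ (Test d)) :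
    jetL J ∘ₗ onCoeff D = (Dop J.1 * D) ∘ₗ LinearMap.proj J.2 := rfl

theorem jetL_comp_onCoeff_pdC (J : Jet d ι) (k : Fin d ⊕ Fin d) :
    jetL J ∘ₗ onCoeff (pdC k) = pdC k ∘ₗ jetL J := by
  rw [jetL_comp_onCoeff, ← (commute_pdC_Dop k J.1).eq]
  rfl

theorem isDiffOp_onCoeff_multi (α : Fin d → ℕ) :
    IsDiffOp (onCoeff (multi dzC α) : Module.End ℂ (FieldC d ι)) := by
  refine .of_jetL fun J => ?_
  rw [jetL_comp_onCoeff, Dop_mul_multi]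
  exact jetL_mem_diffOps (_, J.2)

theorem pdC_comp_jetL (k : Fin d ⊕ Fin d) (J : Jet d ι) :
    pdC k ∘ₗ jetL J = jetL (J.1 + Pi.single k 1, J.2) := by
  simp only [jetL, Dop_add_single]
  rfl

theorem isDiffOp_onCoeff_pdC (k : Fin d ⊕ Fin d) :
    IsDiffOp (onCoeff (pdC k) : Module.End ℂ (FieldC d ι)) := by
  refine .of_jetL fun J => ?_
  rw [jetL_comp_onCoeff_pdC, pdC_comp_jetL]
  exact jetL_mem_diffOps _

theorem jetL_comp_onCoeff_zbarC (J : Jet d ι) (i : Fin d) :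
    jetL J ∘ₗ onCoeff (zbarC i) = zbarC i ∘ₗ jetL J +
      (J.1 (.inr i) : ℂ) • jetL (J.1 - Pi.single (.inr i) 1, J.2) := by
  rw [jetL_comp_onCoeff, zbarC, Dop_mul_mulC_coord]
  rfl

theorem isDiffOp_onCoeff_zbarC (i : Fin d) :
    IsDiffOp (onCoeff (zbarC i) : Module.End ℂ (FieldC d ι)) := by
  refine .of_jetL fun J => ?_
  rw [jetL_comp_onCoeff_zbarC]
  exact add_mem (mulC_comp_mem_diffOps _ (jetL_mem_diffOps _))
    (Submodule.smul_mem _ _ (jetL_mem_diffOps _))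

theorem jetL_comp_contract (J : Jet d ι) (i : Fin d) :
    jetL J ∘ₗ contract i = if i ∈ J.2.1 then 0 else
      posSign i J.2.1 • jetL (J.1, insert i J.2.1, J.2.2) := by
  ext1 φ
  change Dop J.1 (contract i φ J.2) = _
  rw [contract_apply]
  split_ifs
  · simp
  · rw [map_smul]; rfl

theorem isDiffOp_contract (i : Fin d) : IsDiffOp (contract i : Module.End ℂ (FieldC d ι)) := by
  refine .of_jetL fun J => ?_
  rw [jetL_comp_contract]
  split_ifs
  · exact zero_mem _
  · exact Submodule.smul_mem _ _ (jetL_mem_diffOps _)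

theorem isDiffOp_wedge (i : Fin d) : IsDiffOp (wedge i : Module.End ℂ (FieldC d ι)) := by
  refine .of_jetL fun J => ?_
  have : jetL J ∘ₗ wedge i = if i ∈ J.2.1 then
      posSign i J.2.1 • jetL (J.1, J.2.1.erase i, J.2.2) else 0 := by
    ext1 φ
    change Dop J.1 (wedge i φ J.2) = _
    rw [wedge_apply]
    split_ifs
    · rw [map_smul]; rfl
    · simp
  rw [this]
  split_ifs
  · exact Submodule.smul_mem _ _ (jetL_mem_diffOps _)
  · exact zero_mem _

theorem isDiffOp_onFibre [Fintype ι] (A : Matrix ι ι ℂ) :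
    IsDiffOp (onFibre A : Module.End ℂ (FieldC d ι)) := by
  refine .of_jetL fun J => ?_
  have : jetL J ∘ₗ onFibre A = ((-1 : ℂ) ^ J.2.1.card) •
      ∑ b, A J.2.2 b • jetL (J.1, J.2.1, b) := by
    ext1 φ
    change Dop J.1 (onFibre A φ J.2) = _
    rw [onFibre_apply, map_smul, map_sum, LinearMap.smul_apply, LinearMap.sum_apply]
    simp only [map_smul]
    rfl
  rw [this]
  exact Submodule.smul_mem _ _ (Submodule.sum_mem _ fun b _ =>
    Submodule.smul_mem _ _ (jetL_mem_diffOps _))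

theorem jetL_comp_parity (deg : ι → ℤ) (J : Jet d ι) :
    jetL J ∘ₗ parity deg = ((-1 : ℂ) ^ ((J.2.1.card : ℤ) + deg J.2.2)) • jetL J := by
  ext1 φ
  change Dop J.1 (parity deg φ J.2) = _
  rw [parity_apply, map_smul]
  rfl

theorem isDiffOp_parity (deg : ι → ℤ) : IsDiffOp (parity deg : Module.End ℂ (FieldC d ι)) := by
  refine .of_jetL fun J => ?_
  rw [jetL_comp_parity]
  exact Submodule.smul_mem _ _ (jetL_mem_diffOps _)

theorem isDiffOp_eulerContract : IsDiffOp (eulerContract d ι) :=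
  .sum fun i _ => (isDiffOp_onCoeff_zbarC i).mul (isDiffOp_contract i)

theorem FreeTheory.isDiffOp_fieldDiff [Fintype ι] (T : FreeTheory d ι) : IsDiffOp T.fieldDiff :=
  .add (.sum fun i _ => (isDiffOp_wedge i).mul (isDiffOp_onCoeff_pdC (.inr i)))
    (.sum fun α _ => (isDiffOp_onCoeff_multi α).mul (isDiffOp_onFibre _))

/-- Functionals given by Lagrangian densities of finite order. -/
def lagrangian (d : ℕ) (ι : Type u) (n : ℕ) :
    Submodule ℂ (MultilinearMap ℂ (fun _ : Fin (n + 1) => FieldC d ι) ℂ) :=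
  Submodule.span ℂ {I | ∃ c X, (∀ j, X j ∈ diffOps d ι) ∧ I = density c X}

theorem density_mem_lagrangian (c : Smooth d) {X : Fin (n + 1) → FieldC d ι →ₗ[ℂ] Test d}
    (hX : ∀ j, X j ∈ diffOps d ι) : density c X ∈ lagrangian d ι n :=
  Submodule.subset_span ⟨c, X, hX, rfl⟩

theorem compLinearMap_mem_lagrangian {I : MultilinearMap ℂ (fun _ : Fin (n + 1) => FieldC d ι) ℂ}
    (hI : I ∈ lagrangian d ι n) {G : Fin (n + 1) → Module.End ℂ (FieldC d ι)}
    (hG : ∀ j, IsDiffOp (G j)) : I.compLinearMap G ∈ lagrangian d ι n := by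
  have : lagrangian d ι n ≤ (lagrangian d ι n).comap (MultilinearMap.compLinearMapₗ G) := by
    refine Submodule.span_le.2 ?_
    rintro _ ⟨c, X, hX, rfl⟩
    rw [SetLike.mem_coe, Submodule.mem_comap, MultilinearMap.compLinearMapₗ_apply, density_comp]
    exact density_mem_lagrangian c (X := fun j => X j ∘ₗ G j) fun j => hG j _ (hX j)
  exact this hI

theorem actN_mem_lagrangian {s f : Module.End ℂ (FieldC d ι)} (hs : IsDiffOp s) (hf : IsDiffOp f)
    {I : MultilinearMap ℂ (fun _ : Fin (n + 1) => FieldC d ι) ℂ} (hI : I ∈ lagrangian d ι n) :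
    actN s f I ∈ lagrangian d ι n := by
  rw [actN_apply]
  refine Submodule.sum_mem _ fun j _ => compLinearMap_mem_lagrangian hI fun i => ?_
  unfold slot
  split_ifs
  · exact hs
  · exact hf
  · exact isDiffOp_one

theorem map_mem_of_forall_mem_span {R κ E F : Type*} [CommSemiring R] [Finite κ]
    [AddCommMonoid E] [Module R E] [AddCommMonoid F] [Module R F]
    (f : MultilinearMap R (fun _ : κ => E) F) {G : Set E} {S : Submodule R F}
    (h : ∀ X : κ → E, (∀ j, X j ∈ G) → f X ∈ S) (X : κ → E)
    (hX : ∀ j, X j ∈ Submodule.span R G) : f X ∈ S := by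
  classical
  have := Fintype.ofFinite κ
  have key : ∀ (t : Finset κ) (X : κ → E), (∀ j ∈ t, X j ∈ Submodule.span R G) →
      (∀ j ∉ t, X j ∈ G) → f X ∈ S := by
    intro t
    induction t using Finset.induction_on with
    | empty => exact fun X _ h2 => h X fun j => h2 j (by simp)
    | insert a t ha ih =>
      intro X h1 h2
      have hspan : ∀ y ∈ Submodule.span R G, f (Function.update X a y) ∈ S := by
        intro y hy
        induction hy using Submodule.span_induction with
        | mem y hy =>
          refine ih _ (fun j hj => ?_) (fun j hj => ?_)
          · have : j ≠ a := fun e => ha (e ▸ hj)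
            rw [Function.update_of_ne this]
            exact h1 j (Finset.mem_insert_of_mem hj)
          · by_cases e : j = a
            · subst e; simpa using hy
            · rw [Function.update_of_ne e]
              exact h2 j (by simp [e, hj])
        | zero => rw [MultilinearMap.map_update_zero]; exact zero_mem _
        | add y y' _ _ h h' => rw [MultilinearMap.map_update_add]; exact add_mem h h'
        | smul r y _ h => rw [MultilinearMap.map_update_smul]; exact Submodule.smul_mem _ r h
      have := hspan (X a) (h1 a (Finset.mem_insert_self a t))
      rwa [Function.update_eq_self] at this
  exact key Finset.univ X (fun j _ => hX j) (fun j hj => absurd (Finset.mem_univ j) hj)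

/-- Pulling the coefficients out of a density. -/
theorem density_mulC_comp (c : Fin (n + 1) → Smooth d)
    (X : Fin (n + 1) → FieldC d ι →ₗ[ℂ] Test d) :
    density 1 (fun j => mulC (c j) ∘ₗ X j) = density (∏ j, c j) X := by
  ext φ
  rw [density_apply, density_apply]
  congr 1
  apply Subtype.ext
  rw [coe_mulC, coe_mulC, coe_prodT, coe_prodT, one_mul, ← Finset.prod_mul_distrib]
  rfl

theorem density_eq_density_one (c : Smooth d) (X : Fin (n + 1) → FieldC d ι →ₗ[ℂ] Test d) :
    density c X = density 1 (Function.update X 0 (mulC c ∘ₗ X 0)) := by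
  rw [density_update_mulC, one_mul, Function.update_eq_self]

theorem lagrangian_le {S : Submodule ℂ (MultilinearMap ℂ (fun _ : Fin (n + 1) => FieldC d ι) ℂ)}
    (h : ∀ c (J : Fin (n + 1) → Jet d ι), density c (fun j => jetL (J j)) ∈ S) :
    lagrangian d ι n ≤ S := by
  refine Submodule.span_le.2 ?_
  rintro _ ⟨c, X, hX, rfl⟩
  rw [density_eq_density_one]
  refine map_mem_of_forall_mem_span (density 1)
    (G := {L | ∃ c J, L = mulC c ∘ₗ jetL J}) (fun X hX => ?_) _ fun j => ?_
  · choose c J hJ using hX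
    have : X = fun j => mulC (c j) ∘ₗ jetL (J j) := funext hJ
    rw [this, density_mulC_comp]
    exact h _ _
  · by_cases hj : j = 0
    · subst hj
      rw [Function.update_self]
      exact mulC_comp_mem_diffOps c (hX 0)
    · rw [Function.update_of_ne hj]
      exact hX j

/-- The two forms of the jet coordinates. -/
def jetEquiv (d : ℕ) (ι : Type u) : JetIndex d ι ≃ Jet d ι where
  toFun J := (Sum.elim J.1 J.2.1, J.2.2)
  invFun J := (fun i => J.1 (.inl i), fun i => J.1 (.inr i), J.2)
  left_inv _ := rfl
  right_inv J := by
    refine Prod.ext (funext fun i => ?_) rfl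
    cases i <;> rfl

theorem jet_eq (J : JetIndex d ι) (φ : FieldC d ι) (x : Fin d → ℂ) :
    jet J φ x = (jetL (jetEquiv d ι J) φ).1.1 x := rfl

theorem lagrangian_le_local :
    lagrangian d ι n ≤ Submodule.span ℂ {I | IsLocal I} := by
  classical
  refine lagrangian_le fun c J => Submodule.subset_span ?_
  set J' : Fin (n + 1) → JetIndex d ι := fun j => (jetEquiv d ι).symm (J j) with hJ'
  refine ⟨Pi.single J' c, ?_, fun φ => ?_⟩
  · intro x
    refine ⟨Set.univ, Filter.univ_mem, (Set.finite_singleton J').subset ?_⟩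
    rintro K ⟨y, hy, -⟩
    by_contra hK
    rw [Set.mem_singleton_iff] at hK
    apply hy
    simp [hK]
  · rw [density_apply_eq_integral]
    refine integral_congr_ae (Filter.Eventually.of_forall fun x => ?_)
    dsimp only
    rw [finsum_eq_single _ J']
    · simp [jet_eq, hJ']
    · intro K hK
      simp [hK]

/-- A local functional agrees with a functional of finite order as long as one argument is
supported in a fixed ball. -/
theorem exists_lagrangian_of_local {I : MultilinearMap ℂ (fun _ : Fin (n + 1) => FieldC d ι) ℂ}
    (hI : I ∈ Submodule.span ℂ {I | IsLocal I}) (R : ℝ) :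
    ∃ L ∈ lagrangian d ι n, ∀ φ : Fin (n + 1) → FieldC d ι,
      (∀ s, tsupport (φ 0 s).1.1 ⊆ Metric.ball 0 R) → I φ = L φ := by
  induction hI using Submodule.span_induction with
  | mem I h =>
    obtain ⟨c, hc, hI⟩ := h
    have hfin := hc.finite_nonempty_inter_compact (isCompact_closedBall (0 : Fin d → ℂ) R)
    refine ⟨∑ J ∈ hfin.toFinset, density (c J) fun j => jetL (jetEquiv d ι (J j)),
      Submodule.sum_mem _ fun J _ => density_mem_lagrangian _ fun j => jetL_mem_diffOps _,
      fun φ hφ => ?_⟩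
    rw [hI, sum_apply]
    simp only [density_apply]
    rw [← map_sum]
    change _ = ∫ x, _
    refine integral_congr_ae (Filter.Eventually.of_forall fun x => ?_)
    dsimp only
    rw [AddSubmonoidClass.coe_finsetSum, coe_finset_sum]
    have e : ∀ J : Fin (n + 1) → JetIndex d ι,
        (mulC (c J) (prodT d n fun j => jetL (jetEquiv d ι (J j)) (φ j))).1.1 x =
          (c J).1 x * ∏ j, jet (J j) (φ j) x := by
      intro J
      change (c J).1 x * (prodT d n _).1.1 x = _
      rw [coe_prodT, coe_finset_prod]
      rfl
    simp only [e]
    by_cases hx : x ∈ Metric.closedBall (0 : Fin d → ℂ) R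
    · refine finsum_eq_sum_of_support_subset _ fun J hJ => ?_
      rw [Finset.mem_coe, Set.Finite.mem_toFinset]
      exact ⟨x, left_ne_zero_of_mul hJ, hx⟩
    · have h0 : ∀ J : Fin (n + 1) → JetIndex d ι,
          (c J).1 x * ∏ j, jet (J j) (φ j) x = 0 := by
        intro J
        rw [Finset.prod_eq_zero (Finset.mem_univ 0), mul_zero]
        rw [jet_eq, jetL_apply]
        apply image_eq_zero_of_notMem_tsupport
        intro h
        exact hx (Metric.ball_subset_closedBall (hφ _ (tsupport_Dop _ _ h)))
      simp [h0]
  | zero => exact ⟨0, zero_mem _, fun _ _ => rfl⟩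
  | add I I' _ _ h h' =>
    obtain ⟨L, hL, h⟩ := h
    obtain ⟨L', hL', h'⟩ := h'
    exact ⟨L + L', add_mem hL hL', fun φ hφ => by rw [add_apply, add_apply, h φ hφ, h' φ hφ]⟩
  | smul r I _ h =>
    obtain ⟨L, hL, h⟩ := h
    exact ⟨r • L, Submodule.smul_mem _ r hL, fun φ hφ => by rw [smul_apply, smul_apply, h φ hφ]⟩

/-! ### Normal form -/

/-- The functional with given coefficients with respect to the jet monomials. -/
def realize (d : ℕ) (ι : Type u) (n : ℕ) : ((Fin (n + 1) → Jet d ι) →₀ Smooth d) →ₗ[ℂ]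
    MultilinearMap ℂ (fun _ : Fin (n + 1) => FieldC d ι) ℂ :=
  Finsupp.lsum ℂ fun J =>
    { toFun := fun c => density c fun j => jetL (J j)
      map_add' := fun _ _ => density_add _ _ _
      map_smul' := fun _ _ => density_smul _ _ _ }

theorem realize_single (J : Fin (n + 1) → Jet d ι) (c : Smooth d) :
    realize d ι n (Finsupp.single J c) = density c fun j => jetL (J j) := by
  rw [realize, Finsupp.lsum_single]
  rfl

theorem realize_apply (C : (Fin (n + 1) → Jet d ι) →₀ Smooth d) :
    realize d ι n C = C.sum fun J c => density c fun j => jetL (J j) := rfl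

/-- Jet monomials without derivatives of the first field. -/
def normalJets (d : ℕ) (ι : Type u) (n : ℕ) : Set (Fin (n + 1) → Jet d ι) := {J | (J 0).1 = 0}

theorem lagrangian_le_normal :
    lagrangian d ι n ≤
      (Finsupp.supported (Smooth d) ℂ (normalJets d ι n)).map (realize d ι n) := by
  refine lagrangian_le fun c J => ?_
  obtain ⟨s, hs⟩ : ∃ s, (J 0).2 = s := ⟨_, rfl⟩
  have key : ∀ γ : Fin d ⊕ Fin d → ℕ, ∀ (c : Smooth d) (J : Fin (n + 1) → Jet d ι),
      J 0 = (γ, s) → density c (fun j => jetL (J j)) ∈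
        (Finsupp.supported (Smooth d) ℂ (normalJets d ι n)).map (realize d ι n) := by
    intro γ
    induction γ using multiIndex_induction with
    | h0 =>
      intro c J hJ
      refine ⟨Finsupp.single J c, Finsupp.single_mem_supported ℂ c ?_, realize_single J c⟩
      simp [normalJets, hJ]
    | h γ k ih =>
      intro c J hJ
      set J₀ : Fin (n + 1) → Jet d ι := Function.update J 0 (γ, s) with hJ₀
      have h := sum_density_pdC c (fun j => jetL (J₀ j)) k
      have h0 : Function.update (fun j => jetL (J₀ j)) 0 (pdC k ∘ₗ jetL (J₀ 0)) =
          fun j => jetL (J j) := by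
        ext1 j
        by_cases hj : j = 0
        · subst hj; rw [Function.update_self, pdC_comp_jetL, hJ, hJ₀, Function.update_self]
        · simp [hj, hJ₀]
      rw [Fin.sum_univ_succ, h0] at h
      rw [eq_sub_of_add_eq h]
      refine sub_mem (neg_mem (ih _ _ (by simp [hJ₀]))) (Submodule.sum_mem _ fun j _ => ?_)
      have h1 : Function.update (fun j => jetL (J₀ j)) j.succ (pdC k ∘ₗ jetL (J₀ j.succ)) =
          fun i => jetL (Function.update J₀ j.succ
            ((J₀ j.succ).1 + Pi.single k 1, (J₀ j.succ).2) i) := by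
        ext1 i
        by_cases hi : i = j.succ
        · subst hi; rw [Function.update_self, pdC_comp_jetL, Function.update_self]
        · simp [hi]
      rw [h1]
      refine ih _ _ ?_
      rw [Function.update_of_ne (Fin.succ_ne_zero j).symm, hJ₀, Function.update_self]
  exact key (J 0).1 c J (Prod.ext rfl hs)

end Local

/-! ### Uniqueness of coefficients -/

section Uniqueness

variable {d : ℕ} {ι : Type u} {n : ℕ}

theorem pd_eventuallyEq_zero {f : Smooth d} {x : Fin d → ℂ} {c : ℂ}
    (h : f.1 =ᶠ[nhds x] fun _ => c) (k : Fin d ⊕ Fin d) :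
    (pd k f).1 =ᶠ[nhds x] fun _ => 0 := by
  obtain ⟨v, w, ε, hk⟩ := pd_eq k
  filter_upwards [h.fderiv (𝕜 := ℝ)] with y hy
  rw [hk]
  change (1 / 2 : ℂ) * (fderiv ℝ f.1 y v + ε * fderiv ℝ f.1 y w) = 0
  simp [hy]

theorem exists_bump (x : Fin d → ℂ) :
    ∃ f : Test d, ∀ γ, (Dop γ f).1.1 =ᶠ[nhds x] fun _ => if γ = 0 then 1 else 0 := by
  let b : ContDiffBump x := ⟨1, 2, by norm_num, by norm_num⟩
  have hb : ContDiff ℝ ∞ fun y => ((b y : ℝ) : ℂ) := Complex.ofRealCLM.contDiff.comp b.contDiff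
  let f : Test d := ⟨⟨fun y => ((b y : ℝ) : ℂ), hb⟩,
    HasCompactSupport.comp_left (g := ((↑) : ℝ → ℂ)) b.hasCompactSupport Complex.ofReal_zero⟩
  refine ⟨f, fun γ => ?_⟩
  induction γ using multiIndex_induction with
  | h0 =>
    rw [Dop_zero]
    filter_upwards [b.eventuallyEq_one] with y hy
    change ((b y : ℝ) : ℂ) = _
    simp [hy]
  | h γ k ih =>
    rw [Dop_add_single]
    change (pdC k (Dop γ f)).1.1 =ᶠ[nhds x] _
    rw [coe_pdC]
    have h0 : γ + Pi.single k 1 ≠ 0 := fun h => by simpa using congrFun h k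
    simp only [h0, if_false]
    exact pd_eventuallyEq_zero ih k

/-- Test functions with prescribed jet at a point. -/
theorem exists_jet (x : Fin d → ℂ) (γ : Fin d ⊕ Fin d → ℕ) :
    ∃ f : Test d, ∀ γ', (Dop γ' f).1.1 x = if γ' = γ then 1 else 0 := by
  induction γ using multiIndex_induction with
  | h0 =>
    obtain ⟨f, hf⟩ := exists_bump x
    exact ⟨f, fun γ' => (hf γ').self_of_nhds⟩
  | h γ k ih =>
    obtain ⟨f, hf⟩ := ih
    refine ⟨((γ k + 1 : ℂ)⁻¹) • (mulC (coord k) f - coordL k x • f), fun γ' => ?_⟩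
    have h1 : Dop γ' (mulC (coord k) f) =
        mulC (coord k) (Dop γ' f) + (γ' k : ℂ) • Dop (γ' - Pi.single k 1) f :=
      LinearMap.congr_fun (Dop_mul_mulC_coord γ' k) f
    rw [map_smul, map_sub, map_smul, h1]
    change (γ k + 1 : ℂ)⁻¹ * (coordL k x * (Dop γ' f).1.1 x +
      (γ' k : ℂ) * (Dop (γ' - Pi.single k 1) f).1.1 x - coordL k x * (Dop γ' f).1.1 x) = _
    rw [add_sub_cancel_left, hf]
    by_cases h : γ' = γ + Pi.single k 1
    · subst h
      have : (γ k + 1 : ℂ) ≠ 0 := Nat.cast_add_one_ne_zero _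
      simp [this]
    · rw [if_neg h]
      by_cases h0 : γ' k = 0
      · simp [h0]
      · rw [if_neg, mul_zero, mul_zero]
        intro h'
        apply h
        rw [← h']
        ext l
        by_cases hl : l = k
        · subst hl; simp; omega
        · simp [hl]

theorem eq_zero_of_integ_mulC {G : Smooth d} {U : Set (Fin d → ℂ)} (hU : IsOpen U)
    (h : ∀ ψ : Test d, tsupport ψ.1.1 ⊆ U → integ (mulC G ψ) = 0) :
    ∀ x ∈ U, G.1 x = 0 := by
  have hc : Continuous G.1 := (contDiff_smooth G).continuous
  have hae : ∀ᵐ x ∂(volume : Measure (Fin d → ℂ)), x ∈ U → G.1 x = 0 := by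
    refine hU.ae_eq_zero_of_integral_contDiff_smul_eq_zero
      (hc.locallyIntegrable.locallyIntegrableOn U) fun g hg hgc hgU => ?_
    have hg' : ContDiff ℝ ∞ fun y => ((g y : ℝ) : ℂ) := Complex.ofRealCLM.contDiff.comp hg
    let ψ : Test d := ⟨⟨fun y => ((g y : ℝ) : ℂ), hg'⟩,
      HasCompactSupport.comp_left (g := ((↑) : ℝ → ℂ)) hgc Complex.ofReal_zero⟩
    have hψ : tsupport ψ.1.1 ⊆ U :=
      (tsupport_comp_subset Complex.ofReal_zero g).trans hgU
    rw [← h ψ hψ]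
    change _ = ∫ x, G.1 x * ((g x : ℝ) : ℂ)
    refine integral_congr_ae (Filter.Eventually.of_forall fun x => ?_)
    simp [mul_comm]
  have hae' : G.1 =ᵐ[volume.restrict U] fun _ => 0 :=
    (ae_restrict_iff' hU.measurableSet).2 hae
  exact Measure.eqOn_open_of_ae_eq hae' hU hc.continuousOn continuousOn_const

theorem coeff_eq_zero_of_realize {C : (Fin (n + 1) → Jet d ι) →₀ Smooth d}
    (hC : C ∈ Finsupp.supported (Smooth d) ℂ (normalJets d ι n)) {U : Set (Fin d → ℂ)}
    (hU : IsOpen U)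
    (h : ∀ φ : Fin (n + 1) → FieldC d ι, (∀ s, tsupport (φ 0 s).1.1 ⊆ U) →
      realize d ι n C φ = 0) (J : Fin (n + 1) → Jet d ι) :
    ∀ x ∈ U, (C J).1 x = 0 := by
  classical
  intro x hx
  by_cases hJ : J ∈ C.support
  swap
  · rw [Finsupp.notMem_support_iff.1 hJ]; rfl
  have hnorm : ∀ K ∈ C.support, (K 0).1 = 0 := fun K hK => hC hK
  choose f hf using fun j : Fin n => exists_jet x (J j.succ).1
  let Φ : Fin n → FieldC d ι := fun j => Pi.single (J j.succ).2 (f j)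
  let G : Smooth d := ∑ K ∈ C.support, (if (K 0).2 = (J 0).2 then C K else 0) *
    ∏ j : Fin n, (jetL (K j.succ) (Φ j)).1
  have hG : G.1 x = 0 := by
    refine eq_zero_of_integ_mulC hU (fun ψ hψ => ?_) x hx
    rw [← h (Fin.cons (Pi.single (J 0).2 ψ) Φ), realize_apply, Finsupp.sum, sum_apply]
    · simp only [density_apply]
      rw [← map_sum]
      congr 1
      apply Subtype.ext
      rw [coe_mulC, AddSubmonoidClass.coe_finsetSum, Finset.sum_mul]
      refine Finset.sum_congr rfl fun K hK => ?_
      rw [coe_mulC, coe_prodT, Fin.prod_univ_succ]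
      simp only [Fin.cons_zero, Fin.cons_succ]
      rw [jetL_apply (K 0), hnorm K hK, Dop_zero]
      by_cases hs : (K 0).2 = (J 0).2
      · simp only [hs, if_true, Pi.single_eq_same, Module.End.one_apply]
        ring
      · simp [hs]
    · intro s
      rw [Fin.cons_zero]
      by_cases hs : s = (J 0).2
      · subst hs; simpa using hψ
      · rw [Pi.single_eq_of_ne hs]
        change tsupport (0 : (Fin d → ℂ) → ℂ) ⊆ U
        rw [tsupport_eq_empty_iff.2 rfl]
        exact Set.empty_subset _
  rw [coe_finset_sum, Finset.sum_eq_single J] at hG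
  · rw [if_pos rfl] at hG
    change (C J).1 x * (∏ j : Fin n, (jetL (J j.succ) (Φ j)).1).1 x = 0 at hG
    rw [coe_finset_prod, Finset.prod_eq_one, mul_one] at hG
    · exact hG
    · intro j _
      rw [jetL_apply]
      simp only [Φ, Pi.single_eq_same, hf, if_true]
  · intro K hK hKJ
    change (if (K 0).2 = (J 0).2 then C K else 0).1 x *
      (∏ j : Fin n, (jetL (K j.succ) (Φ j)).1).1 x = 0
    by_cases hs : (K 0).2 = (J 0).2
    · rw [coe_finset_prod]
      have h0 : K 0 = J 0 := Prod.ext (by rw [hnorm K hK, hnorm J hJ]) hs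
      obtain ⟨j, hj⟩ : ∃ j : Fin n, K j.succ ≠ J j.succ := by
        by_contra! hcon
        apply hKJ
        ext1 j
        exact Fin.cases h0 hcon j
      rw [Finset.prod_eq_zero (Finset.mem_univ j), mul_zero]
      rw [jetL_apply]
      by_cases hs' : (K j.succ).2 = (J j.succ).2
      · simp only [Φ, hs', Pi.single_eq_same, hf]
        rw [if_neg]
        intro h1
        exact hj (Prod.ext h1 hs')
      · simp only [Φ, Pi.single_eq_of_ne hs', map_zero]
        rfl
    · rw [if_neg hs]
      exact zero_mul _
  · intro h'
    exact absurd hJ h'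

/-! ### Translation invariant functionals -/

theorem mapRange_mem_supported {κ A B : Type*} [AddCommMonoid A] [Module ℂ A] [AddCommMonoid B]
    [Module ℂ B] {s : Set κ} (f : A →ₗ[ℂ] B) {C : κ →₀ A} (hC : C ∈ Finsupp.supported A ℂ s) :
    Finsupp.mapRange.linearMap f C ∈ Finsupp.supported B ℂ s :=
  fun _ hK => hC (Finsupp.support_mapRange (hf := map_zero f) hK)

/-- The functional given by a jet monomial with coefficient one. -/
def mono (J : Fin (n + 1) → Jet d ι) : MultilinearMap ℂ (fun _ : Fin (n + 1) => FieldC d ι) ℂ :=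
  density 1 fun j => jetL (J j)

/-- The functional with given constant coefficients. -/
def realizeConst (d : ℕ) (ι : Type u) (n : ℕ) : ((Fin (n + 1) → Jet d ι) →₀ ℂ) →ₗ[ℂ]
    MultilinearMap ℂ (fun _ : Fin (n + 1) => FieldC d ι) ℂ :=
  Finsupp.linearCombination ℂ mono

theorem realizeConst_single (J : Fin (n + 1) → Jet d ι) (r : ℂ) :
    realizeConst d ι n (Finsupp.single J r) = r • mono J :=
  Finsupp.linearCombination_single ℂ r J

theorem realizeConst_eq (C : (Fin (n + 1) → Jet d ι) →₀ ℂ) :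
    realizeConst d ι n C =
      realize d ι n (Finsupp.mapRange.linearMap (Algebra.linearMap ℂ (Smooth d)) C) := by
  induction C using Finsupp.induction_linear with
  | zero => simp
  | add C C' h h' => rw [map_add, map_add, map_add, h, h']
  | single J r =>
    rw [realizeConst_single, Finsupp.mapRange.linearMap_apply, Finsupp.mapRange_single,
      realize_single, Algebra.linearMap_apply, Algebra.algebraMap_eq_smul_one, density_smul]
    rfl

theorem mono_mem_lagrangian (J : Fin (n + 1) → Jet d ι) : mono J ∈ lagrangian d ι n :=
  density_mem_lagrangian 1 fun j => jetL_mem_diffOps (J j)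

theorem realizeConst_mem_lagrangian (C : (Fin (n + 1) → Jet d ι) →₀ ℂ) :
    realizeConst d ι n C ∈ lagrangian d ι n :=
  Submodule.sum_mem _ fun J _ => Submodule.smul_mem _ _ (mono_mem_lagrangian J)

theorem realizeConst_injective {C : (Fin (n + 1) → Jet d ι) →₀ ℂ}
    (hC : C ∈ Finsupp.supported ℂ ℂ (normalJets d ι n)) (h : realizeConst d ι n C = 0) :
    C = 0 := by
  ext J
  have hC' : Finsupp.mapRange.linearMap (Algebra.linearMap ℂ (Smooth d)) C ∈
      Finsupp.supported (Smooth d) ℂ (normalJets d ι n) :=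
    mapRange_mem_supported _ hC
  have := coeff_eq_zero_of_realize hC' isOpen_univ
    (fun φ _ => by rw [← realizeConst_eq, h]; rfl) J 0 (Set.mem_univ _)
  exact this

theorem actN_onCoeff_pdC_density (k : Fin d ⊕ Fin d) (c : Smooth d) (J : Fin (n + 1) → Jet d ι) :
    actN 1 (onCoeff (pdC k)) (density c fun j => jetL (J j)) =
      -density (pd k c) fun j => jetL (J j) := by
  rw [actN_one_density, ← sum_density_pdC]
  simp only [jetL_comp_onCoeff_pdC]

theorem actN_onCoeff_pdC_mono (k : Fin d ⊕ Fin d) (J : Fin (n + 1) → Jet d ι) :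
    actN 1 (onCoeff (pdC k)) (mono J) = 0 := by
  rw [mono, actN_onCoeff_pdC_density, pd_one, ← zero_smul ℂ (1 : Smooth d), density_smul, zero_smul,
    neg_zero]

theorem actN_onCoeff_pdC_realize (k : Fin d ⊕ Fin d) (C : (Fin (n + 1) → Jet d ι) →₀ Smooth d) :
    actN 1 (onCoeff (pdC k)) (realize d ι n C) =
      -realize d ι n (Finsupp.mapRange.linearMap (pd k) C) := by
  induction C using Finsupp.induction_linear with
  | zero => simp
  | add C C' h h' => simp only [map_add, h, h']; abel
  | single J c =>
    rw [realize_single, actN_onCoeff_pdC_density, Finsupp.mapRange.linearMap_apply,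
      Finsupp.mapRange_single, realize_single]

theorem density_congr_on {c c' : Smooth d} {U : Set (Fin d → ℂ)} (hc : ∀ x ∈ U, c.1 x = c'.1 x)
    (J : Fin (n + 1) → Jet d ι) {φ : Fin (n + 1) → FieldC d ι}
    (hφ : ∀ s, tsupport (φ 0 s).1.1 ⊆ U) :
    density c (fun j => jetL (J j)) φ = density c' (fun j => jetL (J j)) φ := by
  rw [density_apply_eq_integral, density_apply_eq_integral]
  refine integral_congr_ae (Filter.Eventually.of_forall fun x => ?_)
  dsimp only
  by_cases hx : x ∈ U
  · rw [hc x hx]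
  · rw [Finset.prod_eq_zero (Finset.mem_univ 0), mul_zero, mul_zero]
    apply image_eq_zero_of_notMem_tsupport
    intro h
    exact hx (hφ _ (tsupport_Dop _ _ h))

theorem exists_const_of_invariant {I : MultilinearMap ℂ (fun _ : Fin (n + 1) => FieldC d ι) ℂ}
    (hI : I ∈ Submodule.span ℂ {I | IsLocal I})
    (hinv : ∀ k, actN 1 (onCoeff (pdC k)) I = 0) (R : ℝ) :
    ∃ C ∈ Finsupp.supported ℂ ℂ (normalJets d ι n), ∀ φ : Fin (n + 1) → FieldC d ι,
      (∀ s, tsupport (φ 0 s).1.1 ⊆ Metric.ball 0 R) → I φ = realizeConst d ι n C φ := by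
  obtain ⟨L, hL, hIL⟩ := exists_lagrangian_of_local hI R
  obtain ⟨C, hC, rfl⟩ := lagrangian_le_normal hL
  have hpd : ∀ J k, ∀ x ∈ Metric.ball (0 : Fin d → ℂ) R, (pd k (C J)).1 x = 0 := by
    intro J k
    have hC' : Finsupp.mapRange.linearMap (pd k) C ∈
        Finsupp.supported (Smooth d) ℂ (normalJets d ι n) :=
      mapRange_mem_supported _ hC
    refine coeff_eq_zero_of_realize hC' Metric.isOpen_ball (fun φ hφ => ?_) J
    rw [← neg_eq_zero, ← neg_apply, ← actN_onCoeff_pdC_realize]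
    have h0 : actN 1 (onCoeff (pdC k)) I φ = 0 := by rw [hinv]; rfl
    rw [← h0, actN_apply, actN_apply, sum_apply, sum_apply]
    refine Finset.sum_congr rfl fun j _ => ?_
    simp only [MultilinearMap.compLinearMap_apply]
    refine (hIL _ fun s => ?_).symm
    unfold slot
    split_ifs
    · exact hφ s
    · rw [onCoeff_apply, coe_pdC]
      exact (pd_support k _).trans (hφ s)
    · exact hφ s
  let ev : Smooth d →ₗ[ℂ] ℂ :=
    { toFun := fun f => f.1 0, map_add' := fun _ _ => rfl, map_smul' := fun _ _ => rfl }
  refine ⟨Finsupp.mapRange.linearMap ev C, mapRange_mem_supported _ hC,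
    fun φ hφ => ?_⟩
  rw [hIL φ hφ]
  have key : ∀ (C : (Fin (n + 1) → Jet d ι) →₀ Smooth d), realize d ι n C φ =
      ∑ K ∈ C.support, density (C K) (fun j => jetL (K j)) φ := by
    intro C
    rw [realize_apply, Finsupp.sum, sum_apply]
  rw [key, realizeConst, Finsupp.linearCombination_apply, Finsupp.mapRange.linearMap_apply,
    Finsupp.sum_mapRange_index (h := fun K r => r • mono K) fun _ => zero_smul _ _,
    Finsupp.sum, sum_apply]
  refine Finset.sum_congr rfl fun K _ => ?_
  rw [mono, ← density_smul]
  refine density_congr_on (fun x hx => ?_) K hφ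
  rw [eqOn_const_of_pd_eq_zero (hpd K) x hx]
  exact (mul_one _).symm

/-- A translation invariant local functional has constant coefficients. -/
theorem exists_realizeConst_eq [Finite ι]
    {I : MultilinearMap ℂ (fun _ : Fin (n + 1) => FieldC d ι) ℂ}
    (hI : I ∈ Submodule.span ℂ {I | IsLocal I})
    (hinv : ∀ k, actN 1 (onCoeff (pdC k)) I = 0) :
    ∃ C ∈ Finsupp.supported ℂ ℂ (normalJets d ι n), realizeConst d ι n C = I := by
  choose C hC hIC using fun R => exists_const_of_invariant hI hinv R
  have heq : ∀ R, 1 ≤ R → C R = C 1 := by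
    intro R hR
    ext J
    have hs : Finsupp.mapRange.linearMap (Algebra.linearMap ℂ (Smooth d)) (C R - C 1) ∈
        Finsupp.supported (Smooth d) ℂ (normalJets d ι n) :=
      mapRange_mem_supported _ (sub_mem (hC R) (hC 1))
    have := coeff_eq_zero_of_realize hs (Metric.isOpen_ball (x := 0) (ε := 1)) (fun φ hφ => by
      rw [← realizeConst_eq, map_sub, sub_apply, ← hIC 1 φ hφ, ← hIC R φ fun s =>
        (hφ s).trans (Metric.ball_subset_ball hR), sub_self]) J 0 (Metric.mem_ball_self one_pos)
    change C R J - C 1 J = 0 at this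
    exact sub_eq_zero.1 this
  refine ⟨C 1, hC 1, ?_⟩
  ext φ
  have := Fintype.ofFinite ι
  have hcpt : IsCompact (⋃ s, tsupport (φ 0 s).1.1) := isCompact_iUnion fun s => (φ 0 s).2
  obtain ⟨r, hr⟩ := hcpt.isBounded.subset_ball 0
  rw [hIC (max r 1) φ fun s => (Set.subset_iUnion (fun s => tsupport (φ 0 s).1.1) s).trans
    (hr.trans (Metric.ball_subset_ball (le_max_left _ _))), heq _ (le_max_right _ _)]

/-! ### Weights -/

/-- The weight of a jet monomial under the Euler vector field `∑ z̄_i ∂/∂z̄_i`. -/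
def weight (J : Fin (n + 1) → Jet d ι) : ℤ :=
  ∑ j, ((∑ i, ((J j).1 (.inr i) : ℤ)) + (J j).2.1.card) - d

theorem jetL_comp_eulerLie (J : Jet d ι) :
    jetL J ∘ₗ eulerLie d ι = ∑ i, zbarC i ∘ₗ pdC (.inr i) ∘ₗ jetL J +
      ((((∑ i, (J.1 (.inr i) : ℤ)) + J.2.1.card : ℤ)) : ℂ) • jetL J := by
  have h1 : ∀ i, jetL J ∘ₗ onCoeff (zbarC i * dzbarC i) =
      zbarC i ∘ₗ pdC (.inr i) ∘ₗ jetL J + (J.1 (.inr i) : ℂ) • jetL J := by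
    intro i
    change (jetL J ∘ₗ onCoeff (zbarC i)) ∘ₗ onCoeff (pdC (.inr i)) = _
    rw [jetL_comp_onCoeff_zbarC, LinearMap.add_comp, LinearMap.smul_comp, LinearMap.comp_assoc,
      jetL_comp_onCoeff_pdC, jetL_comp_onCoeff_pdC]
    by_cases h0 : J.1 (.inr i) = 0
    · simp [h0]
    · have : pdC (.inr i) ∘ₗ jetL (J.1 - Pi.single (.inr i) 1, J.2) = jetL J := by
        rw [pdC_comp_jetL]
        congr 1
        refine Prod.ext (funext fun l => ?_) rfl
        by_cases hl : l = .inr i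
        · subst hl; simp; omega
        · simp [hl]
      rw [this]
  have h2 : ∀ i, jetL J ∘ₗ (wedge i * contract i) =
      (if i ∈ J.2.1 then (1 : ℂ) else 0) • jetL J := by
    intro i
    ext1 φ
    change Dop J.1 ((wedge i * contract i : Module.End ℂ (FieldC d ι)) φ J.2) = _
    rw [wedge_mul_contract_apply]
    split_ifs
    · rw [one_smul]; rfl
    · simp
  have h3 : jetL J ∘ₗ eulerLie d ι = ∑ i, (zbarC i ∘ₗ pdC (.inr i) ∘ₗ jetL J +
      ((J.1 (.inr i) : ℂ) + if i ∈ J.2.1 then (1 : ℂ) else 0) • jetL J) := by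
    ext1 φ
    change jetL J (eulerLie d ι φ) = _
    rw [eulerLie, LinearMap.sum_apply, map_sum, LinearMap.sum_apply]
    refine Finset.sum_congr rfl fun i _ => ?_
    rw [add_smul, ← add_assoc, ← h1, ← h2, ← LinearMap.comp_add]
    rfl
  rw [h3, Finset.sum_add_distrib, ← Finset.sum_smul, Finset.sum_add_distrib]
  congr 2
  push_cast
  simp

theorem actN_eulerLie_mono (J : Fin (n + 1) → Jet d ι) :
    actN 1 (eulerLie d ι) (mono J) = (weight J : ℂ) • mono J := by
  rw [mono, actN_one_density]
  simp only [jetL_comp_eulerLie, MultilinearMap.map_update_add, MultilinearMap.map_update_sum,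
    MultilinearMap.map_update_smul, zbarC, density_update_mulC, one_mul, Finset.sum_add_distrib,
    Function.update_eq_self]
  rw [Finset.sum_comm]
  simp only [sum_density_pdC, pd_coord, if_true]
  rw [← Finset.sum_smul]
  simp only [weight, Finset.sum_const, Finset.card_univ, Fintype.card_fin]
  push_cast
  module

end Uniqueness

/-! ### Functionals built from holomorphic derivatives -/

section Holomorphic

variable {d : ℕ} {ι : Type u} {n : ℕ}

/-- The components of the fields that enter a summand of a holomorphic functional. -/
def holJet (α : Fin (n + 1) → Fin d → ℕ) (a : Fin (n + 1) → ι) (g : Fin d → Fin (n + 1)) :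
    Fin (n + 1) → Jet d ι :=
  fun j => (Sum.elim (α j) 0, Finset.univ.filter fun k => g k = j, a j)

/-- The sign in the definition of `topWedge`. -/
def wedgeSign (deg : ι → ℤ) {N : ℕ} (a : Fin N → ι) (g : Fin d → Fin N) : ℂ :=
  (-1 : ℂ) ^ (Finset.univ.filter fun p : Fin d × Fin d => p.1 < p.2 ∧ g p.2 < g p.1).card *
    (-1 : ℂ) ^ (∑ i, ∑ j, if i < j then
      deg (a i) * ((Finset.univ.filter fun k => g k = j).card : ℤ) else 0)

/-- The functional `φ ↦ ∫ F (D_1 φ, …, D_n φ) d^d z`, as a combination of jet monomials. -/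
def holMono [Fintype ι] (deg : ι → ℤ) (F₀ : (Fin (n + 1) → ι) → ℂ)
    (α : Fin (n + 1) → Fin d → ℕ) : MultilinearMap ℂ (fun _ : Fin (n + 1) => FieldC d ι) ℂ :=
  ∑ a, ∑ g, (wedgeSign deg a g * F₀ a) • mono (holJet α a g)

theorem holMono_apply [Fintype ι] (deg : ι → ℤ) (F₀ : (Fin (n + 1) → ι) → ℂ)
    (α : Fin (n + 1) → Fin d → ℕ) (φ : Fin (n + 1) → FieldC d ι) :
    holMono deg F₀ α φ =
      ∫ x : Fin d → ℂ, topWedge deg F₀ fun j s => (multi dzC (α j) (φ j s)).1.1 x := by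
  simp only [holMono, sum_apply, smul_apply, mono, density_apply, smul_eq_mul]
  simp only [← smul_eq_mul, ← map_smul, ← map_sum, mulC_one, Module.End.one_apply]
  change ∫ x, _ = _
  refine integral_congr_ae (Filter.Eventually.of_forall fun x => ?_)
  dsimp only
  rw [AddSubmonoidClass.coe_finsetSum, coe_finset_sum, topWedge]
  refine Finset.sum_congr rfl fun a _ => ?_
  rw [AddSubmonoidClass.coe_finsetSum, coe_finset_sum]
  refine Finset.sum_congr rfl fun g _ => ?_
  change (wedgeSign deg a g * F₀ a) * (prodT d n _).1.1 x = _
  rw [coe_prodT, coe_finset_prod]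
  simp only [jetL_apply, holJet, ← multi_eq_Dop]
  rfl

theorem isHolMonomial_iff [Fintype ι] (deg : ι → ℤ)
    (I : MultilinearMap ℂ (fun _ : Fin (n + 1) => FieldC d ι) ℂ) :
    IsHolMonomial deg I ↔ ∃ F₀ α, I = holMono deg F₀ α := by
  refine exists_congr fun F₀ => exists_congr fun α => ?_
  simp only [← holMono_apply]
  exact ⟨fun h => MultilinearMap.ext h, fun h φ => by rw [h]⟩

theorem holMono_induction [Fintype ι] {deg : ι → ℤ}
    {S : Submodule ℂ (MultilinearMap ℂ (fun _ : Fin (n + 1) => FieldC d ι) ℂ)}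
    (h : ∀ F₀ α, holMono deg F₀ α ∈ S) :
    Submodule.span ℂ {I | IsHolMonomial deg I} ≤ S := by
  refine Submodule.span_le.2 fun I hI => ?_
  obtain ⟨F₀, α, rfl⟩ := (isHolMonomial_iff deg I).1 hI
  exact h F₀ α

theorem holMono_mem_lagrangian [Fintype ι] (deg : ι → ℤ) (F₀ : (Fin (n + 1) → ι) → ℂ)
    (α : Fin (n + 1) → Fin d → ℕ) : holMono deg F₀ α ∈ lagrangian d ι n :=
  Submodule.sum_mem _ fun _ _ => Submodule.sum_mem _ fun _ _ =>
    Submodule.smul_mem _ _ (mono_mem_lagrangian _)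

theorem actN_onCoeff_pdC_holMono [Fintype ι] (deg : ι → ℤ) (F₀ : (Fin (n + 1) → ι) → ℂ)
    (α : Fin (n + 1) → Fin d → ℕ) (k : Fin d ⊕ Fin d) :
    actN 1 (onCoeff (pdC k)) (holMono deg F₀ α) = 0 := by
  simp [holMono, actN_onCoeff_pdC_mono]

theorem weight_holJet (α : Fin (n + 1) → Fin d → ℕ) (a : Fin (n + 1) → ι)
    (g : Fin d → Fin (n + 1)) : weight (holJet α a g) = 0 := by
  have : ∑ j, (Finset.univ.filter fun k => g k = j).card = d := by
    rw [← Finset.card_eq_sum_card_fiberwise (fun _ _ => Finset.mem_univ _), Finset.card_univ,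
      Fintype.card_fin]
  simp only [weight, holJet, Sum.elim_inr, Pi.zero_apply, Nat.cast_zero, Finset.sum_const_zero,
    zero_add]
  rw [← Nat.cast_sum, this, sub_self]

theorem actN_eulerLie_holMono [Fintype ι] (deg : ι → ℤ) (F₀ : (Fin (n + 1) → ι) → ℂ)
    (α : Fin (n + 1) → Fin d → ℕ) : actN 1 (eulerLie d ι) (holMono deg F₀ α) = 0 := by
  simp [holMono, actN_eulerLie_mono, weight_holJet]

/-! #### Contractions -/

/-- Inserting `dz̄_i` in the `j`-th component. -/
def insertForm (J : Fin (n + 1) → Jet d ι) (j : Fin (n + 1)) (i : Fin d) :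
    Fin (n + 1) → Jet d ι :=
  Function.update J j ((J j).1, insert i (J j).2.1, (J j).2.2)

/-- The sign of a contraction of the `j`-th argument. -/
def contractSign (deg : ι → ℤ) (J : Fin (n + 1) → Jet d ι) (j : Fin (n + 1)) (i : Fin d) : ℂ :=
  (∏ l, if l < j then (-1 : ℂ) ^ (((J l).2.1.card : ℤ) + deg (J l).2.2) else 1) *
    posSign i (J j).2.1

theorem contractSign_ne_zero (deg : ι → ℤ) (J : Fin (n + 1) → Jet d ι) (j : Fin (n + 1))
    (i : Fin d) : contractSign deg J j i ≠ 0 := by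
  refine mul_ne_zero (Finset.prod_ne_zero_iff.2 fun l _ => ?_) ?_
  · split_ifs
    · exact zpow_ne_zero _ (by norm_num)
    · exact one_ne_zero
  · exact pow_ne_zero _ (by norm_num)

theorem actN_contract_mono (deg : ι → ℤ) (i : Fin d) (J : Fin (n + 1) → Jet d ι) :
    actN (parity deg) (contract i) (mono J) = ∑ j, if i ∈ (J j).2.1 then 0 else
      contractSign deg J j i • mono (insertForm J j i) := by
  rw [actN_apply]
  refine Finset.sum_congr rfl fun j _ => ?_
  rw [mono, density_comp]
  split_ifs with h
  · refine MultilinearMap.map_coord_zero _ j ?_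
    rw [slot_self, jetL_comp_contract, if_pos h]
  · have e : (fun l => jetL (J l) ∘ₗ slot (parity deg) (contract i) j l) = fun l =>
        ((if l < j then (-1 : ℂ) ^ (((J l).2.1.card : ℤ) + deg (J l).2.2) else 1) *
          if l = j then posSign i (J j).2.1 else 1) • jetL (insertForm J j i l) := by
      ext1 l
      rcases lt_trichotomy l j with h' | h' | h'
      · rw [slot_of_lt _ _ h', jetL_comp_parity, if_pos h', if_neg h'.ne, mul_one, insertForm,
          Function.update_of_ne h'.ne]
      · subst h'
        rw [slot_self, jetL_comp_contract, if_neg h, if_neg (lt_irrefl _), if_pos rfl, one_mul,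
          insertForm, Function.update_self]
      · rw [slot_of_gt _ _ h', if_neg h'.not_gt, if_neg h'.ne', one_mul, one_smul, insertForm,
          Function.update_of_ne h'.ne']
        rfl
    rw [e, MultilinearMap.map_smul_univ, Finset.prod_mul_distrib,
      Finset.prod_ite_eq' Finset.univ j, if_pos (Finset.mem_univ j)]
    rfl

/-- The sign `-1` if `p` holds. -/
def signOf (p : Prop) [Decidable p] : ℂ := if p then -1 else 1

theorem neg_one_pow_card_filter {κ : Type*} (t : Finset κ) (p : κ → Prop)
    [DecidablePred p] : (-1 : ℂ) ^ (t.filter p).card = ∏ x ∈ t, signOf (p x) := by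
  simp [signOf, Finset.prod_ite]

theorem neg_one_zpow_sum {κ : Type*} (t : Finset κ) (f : κ → ℤ) :
    (-1 : ℂ) ^ (∑ x ∈ t, f x) = ∏ x ∈ t, (-1 : ℂ) ^ f x := by
  classical
  induction t using Finset.induction_on with
  | empty => simp
  | insert a t ha ih =>
    rw [Finset.sum_insert ha, Finset.prod_insert ha, zpow_add₀ (by norm_num), ih]

/-- The Koszul sign of moving a one-form past the first `m` vectors. -/
def vectorSign (deg : ι → ℤ) {N : ℕ} (a : Fin N → ι) (m : Fin N) : ℂ :=
  ∏ l, if l < m then (-1 : ℂ) ^ deg (a l) else 1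

theorem wedgeSign_eq (deg : ι → ℤ) {N : ℕ} (a : Fin N → ι) (g : Fin d → Fin N) :
    wedgeSign deg a g = (∏ p, ∏ q, signOf (p < q ∧ g q < g p)) *
      ∏ k, vectorSign deg a (g k) := by
  rw [wedgeSign, neg_one_pow_card_filter, Fintype.prod_prod_type]
  congr 1
  have h : (∑ l, ∑ m, if l < m then
      deg (a l) * ((Finset.univ.filter fun k => g k = m).card : ℤ) else 0) =
      ∑ k, ∑ l, if l < g k then deg (a l) else 0 := by
    rw [Finset.sum_comm (s := (Finset.univ : Finset (Fin d)))]
    refine Finset.sum_congr rfl fun l _ => ?_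
    have : ∀ m, ((Finset.univ.filter fun k => g k = m).card : ℤ) =
        ∑ k, if g k = m then 1 else 0 := fun m => by simp
    simp only [this]
    have h2 : ∀ m, (if l < m then deg (a l) * ∑ k, (if g k = m then (1 : ℤ) else 0) else 0) =
        ∑ k, if g k = m then (if l < m then deg (a l) else 0) else 0 := by
      intro m
      split_ifs
      · simp only [Finset.mul_sum, mul_ite, mul_one, mul_zero]
      · simp
    rw [Finset.sum_congr rfl fun m _ => h2 m, Finset.sum_comm]
    simp
  rw [h, neg_one_zpow_sum]
  refine Finset.prod_congr rfl fun k _ => ?_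
  rw [neg_one_zpow_sum]
  refine Finset.prod_congr rfl fun l _ => ?_
  split_ifs <;> simp

theorem contractSign_holJet_eq (deg : ι → ℤ) (α : Fin (n + 1) → Fin d → ℕ)
    (a : Fin (n + 1) → ι) (g : Fin d → Fin (n + 1)) (j : Fin (n + 1)) (i : Fin d) :
    contractSign deg (holJet α a g) j i =
      vectorSign deg a j * ∏ k, (signOf (g k < j) * signOf (k < i ∧ g k = j)) := by
  have h1 : (∏ l, if l < j then (-1 : ℂ) ^ (((Finset.univ.filter fun k => g k = l).card : ℤ) +
      deg (a l)) else 1) = vectorSign deg a j * ∏ k, signOf (g k < j) := by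
    have : ∀ l, (if l < j then (-1 : ℂ) ^ (((Finset.univ.filter fun k => g k = l).card : ℤ) +
        deg (a l)) else 1) = (if l < j then (-1 : ℂ) ^ deg (a l) else 1) *
          ∏ k, if g k = l then signOf (l < j) else 1 := by
      intro l
      rw [Finset.prod_ite, Finset.prod_const_one, mul_one, Finset.prod_const]
      split_ifs with h
      · rw [zpow_add₀ (by norm_num), zpow_natCast, mul_comm]
        simp [signOf, h]
      · simp [signOf, h]
    rw [Finset.prod_congr rfl fun l _ => this l, Finset.prod_mul_distrib, Finset.prod_comm]
    congr 1
    refine Finset.prod_congr rfl fun k _ => ?_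
    rw [Finset.prod_ite_eq Finset.univ (g k) fun l => signOf (l < j), if_pos (Finset.mem_univ _)]
  have h2 : posSign i (Finset.univ.filter fun k => g k = j) = ∏ k, signOf (k < i ∧ g k = j) := by
    rw [posSign, Finset.filter_filter, neg_one_pow_card_filter]
    refine Finset.prod_congr rfl fun k _ => ?_
    simp only [and_comm]
  rw [Finset.prod_mul_distrib, ← mul_assoc, ← h1, ← h2]
  rfl

/-- The factors of the total sign that involve `dz̄_k` for `k ≠ i`. -/
def crossSign (i k : Fin d) {N : ℕ} (m j g : Fin N) : ℂ :=
  signOf (k < i ∧ m < g) * signOf (i < k ∧ g < m) * (signOf (g < j) * signOf (k < i ∧ g = j))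

theorem crossSign_comm {i k : Fin d} (hk : k ≠ i) {N : ℕ} (m j g : Fin N) :
    crossSign i k m j g = crossSign i k j m g := by
  have h0 : ∀ j, signOf (g < j) * signOf (g = j) = -signOf (j < g) := by
    intro j
    unfold signOf
    rcases lt_trichotomy g j with h | h | h
    · simp [h, h.not_gt, h.ne]
    · simp [h]
    · simp [h, h.not_gt, h.ne']
  rcases lt_or_gt_of_ne hk with h | h
  · simp only [crossSign, h, true_and, h0]
    simp only [h.not_gt, false_and]
    ring
  · simp only [crossSign, h, true_and, h.not_gt, false_and]
    ring

theorem wedgeSign_mul_contractSign (deg : ι → ℤ) (α : Fin (n + 1) → Fin d → ℕ)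
    (a : Fin (n + 1) → ι) (g : Fin d → Fin (n + 1)) (j : Fin (n + 1)) (i : Fin d) :
    wedgeSign deg a g * contractSign deg (holJet α a g) j i =
      ((∏ p ∈ Finset.univ.erase i, ∏ q ∈ Finset.univ.erase i, signOf (p < q ∧ g q < g p)) *
        ∏ k ∈ Finset.univ.erase i, vectorSign deg a (g k)) *
      (vectorSign deg a (g i) * vectorSign deg a j) * signOf (g i < j) *
      ∏ k ∈ Finset.univ.erase i, crossSign i k (g i) j (g k) := by
  have split : ∀ f : Fin d → ℂ, ∏ k, f k = f i * ∏ k ∈ Finset.univ.erase i, f k := fun f =>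
    (Finset.mul_prod_erase _ _ (Finset.mem_univ i)).symm
  rw [wedgeSign_eq, contractSign_holJet_eq]
  simp only [crossSign, Finset.prod_mul_distrib]
  rw [split fun p => ∏ q, signOf (p < q ∧ g q < g p), split fun q => signOf (i < q ∧ g q < g i),
    Finset.prod_congr rfl fun p _ => split fun q => signOf (p < q ∧ g q < g p),
    Finset.prod_mul_distrib, split fun k => vectorSign deg a (g k), split fun k => signOf (g k < j),
    split fun k => signOf (k < i ∧ g k = j)]
  have e1 : signOf (i < i ∧ g i < g i) = 1 := by simp [signOf]
  have e2 : signOf (i < i ∧ g i = j) = 1 := by simp [signOf]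
  rw [e1, e2]
  ring

theorem insertForm_holJet_update (α : Fin (n + 1) → Fin d → ℕ) (a : Fin (n + 1) → ι)
    (g : Fin d → Fin (n + 1)) {j : Fin (n + 1)} {i : Fin d} (h : g i ≠ j) :
    insertForm (holJet α a (Function.update g i j)) (g i) i = insertForm (holJet α a g) j i := by
  ext1 l
  have key : ∀ (g' : Fin d → Fin (n + 1)) (m : Fin (n + 1)),
      insertForm (holJet α a g') m i l = (Sum.elim (α l) 0,
        Finset.univ.filter (fun k => g' k = l ∨ (k = i ∧ l = m)), a l) := by
    intro g' m
    by_cases hl : l = m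
    · subst hl
      rw [insertForm, Function.update_self]
      refine Prod.ext rfl (Prod.ext ?_ rfl)
      ext k
      simp [holJet, or_comm]
    · rw [insertForm, Function.update_of_ne hl]
      simp [holJet, hl]
  rw [key, key]
  refine Prod.ext rfl (Prod.ext ?_ rfl)
  ext k
  by_cases hk : k = i
  · subst hk
    simp only [Finset.mem_filter, Finset.mem_univ, true_and, Function.update_self]
    constructor
    · rintro (h | h)
      · exact Or.inr h.symm
      · exact Or.inl h.symm
    · rintro (h | h)
      · exact Or.inr h.symm
      · exact Or.inl h.symm
  · simp [hk]

theorem actN_contract_holMono [Fintype ι] (deg : ι → ℤ) (F₀ : (Fin (n + 1) → ι) → ℂ)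
    (α : Fin (n + 1) → Fin d → ℕ) (i : Fin d) :
    actN (parity deg) (contract i) (holMono deg F₀ α) = 0 := by
  simp only [holMono, map_sum, map_smul, actN_contract_mono]
  refine Finset.sum_eq_zero fun a _ => ?_
  simp only [Finset.smul_sum, smul_ite, smul_zero, smul_smul]
  rw [← Fintype.sum_prod_type']
  refine Finset.sum_involution (fun x _ => (Function.update x.1 i x.2, x.1 i)) ?_ ?_ ?_ ?_
  · rintro ⟨g, j⟩ -
    dsimp only
    by_cases h : g i = j
    · simp [holJet, h]
    · have h1 : i ∉ (holJet α a g j).2.1 := by simpa [holJet] using h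
      have h2 : i ∉ (holJet α a (Function.update g i j) (g i)).2.1 := by
        simpa [holJet] using Ne.symm h
      rw [if_neg h1, if_neg h2, insertForm_holJet_update α a g h, ← add_smul]
      convert! zero_smul ℂ _
      rw [mul_right_comm, mul_right_comm _ (F₀ a), ← add_mul, wedgeSign_mul_contractSign,
        wedgeSign_mul_contractSign]
      convert! zero_mul _
      have hne : ∀ k ∈ Finset.univ.erase i, Function.update g i j k = g k := fun k hk =>
        Function.update_of_ne (Finset.ne_of_mem_erase hk) _ _
      have c1 : (∏ p ∈ Finset.univ.erase i, ∏ q ∈ Finset.univ.erase i,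
          signOf (p < q ∧ Function.update g i j q < Function.update g i j p)) =
          ∏ p ∈ Finset.univ.erase i, ∏ q ∈ Finset.univ.erase i, signOf (p < q ∧ g q < g p) :=
        Finset.prod_congr rfl fun p hp => Finset.prod_congr rfl fun q hq => by
          rw [hne p hp, hne q hq]
      have c2 : (∏ k ∈ Finset.univ.erase i, vectorSign deg a (Function.update g i j k)) =
          ∏ k ∈ Finset.univ.erase i, vectorSign deg a (g k) :=
        Finset.prod_congr rfl fun k hk => by rw [hne k hk]
      have c3 : (∏ k ∈ Finset.univ.erase i, crossSign i k j (g i) (Function.update g i j k)) =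
          ∏ k ∈ Finset.univ.erase i, crossSign i k (g i) j (g k) :=
        Finset.prod_congr rfl fun k hk => by
          rw [hne k hk, crossSign_comm (Finset.ne_of_mem_erase hk)]
      have c4 : signOf (j < g i) = -signOf (g i < j) := by
        rcases lt_or_gt_of_ne h with h' | h' <;> simp [signOf, h', h'.not_gt]
      rw [c1, c2, Function.update_self, c3, c4]
      ring
  · rintro ⟨g, j⟩ - hx heq
    apply hx
    have : g i = j := congrArg Prod.snd heq
    simp [holJet, this]
  · rintro ⟨g, j⟩ _
    exact Finset.mem_univ _
  · rintro ⟨g, j⟩ _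
    simp

end Holomorphic

/-! ### Functionals of weight zero -/

section WeightZero

variable {d : ℕ} {ι : Type u} {n : ℕ}

/-- Removing `dz̄_i` from the `j`-th component. -/
def removeForm (J : Fin (n + 1) → Jet d ι) (j : Fin (n + 1)) (i : Fin d) :
    Fin (n + 1) → Jet d ι :=
  Function.update J j ((J j).1, (J j).2.1.erase i, (J j).2.2)

theorem removeForm_insertForm {J : Fin (n + 1) → Jet d ι} {j : Fin (n + 1)} {i : Fin d}
    (h : i ∉ (J j).2.1) : removeForm (insertForm J j i) j i = J := by
  simp [removeForm, insertForm, h]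

theorem insertForm_removeForm {J : Fin (n + 1) → Jet d ι} {j : Fin (n + 1)} {i : Fin d}
    (h : i ∈ (J j).2.1) : insertForm (removeForm J j i) j i = J := by
  simp [removeForm, insertForm, h]

/-- The action of a contraction on coefficients. -/
def contractCoeff (deg : ι → ℤ) (n : ℕ) (i : Fin d) :
    ((Fin (n + 1) → Jet d ι) →₀ ℂ) →ₗ[ℂ] ((Fin (n + 1) → Jet d ι) →₀ ℂ) :=
  Finsupp.linearCombination ℂ fun J => ∑ j, if i ∈ (J j).2.1 then 0 else
    Finsupp.single (insertForm J j i) (contractSign deg J j i)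

theorem realizeConst_contractCoeff (deg : ι → ℤ) (i : Fin d)
    (C : (Fin (n + 1) → Jet d ι) →₀ ℂ) :
    realizeConst d ι n (contractCoeff deg n i C) =
      actN (parity deg) (contract i) (realizeConst d ι n C) := by
  induction C using Finsupp.induction_linear with
  | zero => simp
  | add C C' h h' => rw [map_add, map_add, map_add, map_add, h, h']
  | single J r =>
    rw [contractCoeff, Finsupp.linearCombination_single, map_smul, map_sum, realizeConst_single,
      map_smul, actN_contract_mono]
    congr 1
    refine Finset.sum_congr rfl fun j _ => ?_
    split_ifs
    · exact map_zero _
    · exact realizeConst_single _ _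

theorem contractCoeff_mem_supported {deg : ι → ℤ} {i : Fin d}
    {C : (Fin (n + 1) → Jet d ι) →₀ ℂ} (hC : C ∈ Finsupp.supported ℂ ℂ (normalJets d ι n)) :
    contractCoeff deg n i C ∈ Finsupp.supported ℂ ℂ (normalJets d ι n) := by
  rw [contractCoeff, Finsupp.linearCombination_apply]
  refine Submodule.sum_mem _ fun J hJ => Submodule.smul_mem _ _ (Submodule.sum_mem _ fun j _ => ?_)
  split_ifs
  · exact zero_mem _
  · refine Finsupp.single_mem_supported ℂ _ ?_
    have hJ' : (J 0).1 = 0 := hC hJ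
    change (insertForm J j i 0).1 = 0
    by_cases h : 0 = j
    · subst h; simpa [insertForm] using hJ'
    · simpa [insertForm, h] using hJ'

theorem contractCoeff_apply (deg : ι → ℤ) (i : Fin d) (C : (Fin (n + 1) → Jet d ι) →₀ ℂ)
    (K : Fin (n + 1) → Jet d ι) :
    contractCoeff deg n i C K = ∑ j, if i ∈ (K j).2.1 then
      contractSign deg (removeForm K j i) j i * C (removeForm K j i) else 0 := by
  classical
  induction C using Finsupp.induction_linear with
  | zero => simp
  | add C C' h h' =>
    rw [map_add, Finsupp.add_apply, h, h', ← Finset.sum_add_distrib]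
    refine Finset.sum_congr rfl fun j _ => ?_
    split_ifs
    · rw [Finsupp.add_apply]; ring
    · rw [add_zero]
  | single J r =>
    rw [contractCoeff, Finsupp.linearCombination_single, Finsupp.smul_apply, Finsupp.finsetSum_apply,
      Finset.smul_sum]
    refine Finset.sum_congr rfl fun j _ => ?_
    by_cases hJ : i ∈ (J j).2.1
    · rw [if_pos hJ, Finsupp.zero_apply, smul_zero]
      split_ifs with hK
      · rw [Finsupp.single_eq_of_ne, mul_zero]
        rintro rfl
        simp [removeForm] at hJ
      · rfl
    · rw [if_neg hJ]
      by_cases hK : i ∈ (K j).2.1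
      · rw [if_pos hK]
        by_cases h : insertForm J j i = K
        · subst h
          rw [removeForm_insertForm hJ, Finsupp.single_eq_same, Finsupp.single_eq_same, smul_eq_mul,
            mul_comm]
        · rw [Finsupp.single_eq_of_ne (Ne.symm h), Finsupp.single_eq_of_ne, smul_zero, mul_zero]
          rintro rfl
          exact h (insertForm_removeForm hK)
      · rw [if_neg hK, Finsupp.single_eq_of_ne, smul_zero]
        rintro rfl
        simp [insertForm] at hK

/-- The action of the Euler vector field on coefficients. -/
theorem actN_eulerLie_realizeConst (C : (Fin (n + 1) → Jet d ι) →₀ ℂ) :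
    actN 1 (eulerLie d ι) (realizeConst d ι n C) = realizeConst d ι n
      (Finsupp.onFinset C.support (fun J => weight J * C J) fun _ h =>
        Finsupp.mem_support_iff.2 (right_ne_zero_of_mul h)) := by
  rw [realizeConst, Finsupp.linearCombination_onFinset, Finsupp.linearCombination_apply,
    Finsupp.sum, map_sum]
  refine Finset.sum_congr rfl fun J _ => ?_
  rw [map_smul, actN_eulerLie_mono, smul_smul, mul_comm]

/-- The relations satisfied by the coefficients of functionals that are annihilated by all
contractions and by the Euler vector field. -/
theorem weight_eq_zero_of_coeff_ne_zero {C : (Fin (n + 1) → Jet d ι) →₀ ℂ}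
    (hC : C ∈ Finsupp.supported ℂ ℂ (normalJets d ι n))
    (hN : actN 1 (eulerLie d ι) (realizeConst d ι n C) = 0) {J : Fin (n + 1) → Jet d ι}
    (hJ : C J ≠ 0) : weight J = 0 := by
  rw [actN_eulerLie_realizeConst] at hN
  have h := realizeConst_injective (fun K hK => hC (Finsupp.support_onFinset_subset hK)) hN
  have := DFunLike.congr_fun h J
  simpa [hJ] using this

theorem sum_contractSign_mul_coeff {deg : ι → ℤ} {C : (Fin (n + 1) → Jet d ι) →₀ ℂ}
    (hC : C ∈ Finsupp.supported ℂ ℂ (normalJets d ι n)) {i : Fin d}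
    (h : actN (parity deg) (contract i) (realizeConst d ι n C) = 0) (K : Fin (n + 1) → Jet d ι) :
    ∑ j, (if i ∈ (K j).2.1 then
      contractSign deg (removeForm K j i) j i * C (removeForm K j i) else 0) = 0 := by
  rw [← realizeConst_contractCoeff] at h
  rw [← contractCoeff_apply, realizeConst_injective (contractCoeff_mem_supported hC) h]
  rfl

theorem exists_mem_of_coeff_ne_zero {deg : ι → ℤ} {C : (Fin (n + 1) → Jet d ι) →₀ ℂ}
    (hC : C ∈ Finsupp.supported ℂ ℂ (normalJets d ι n)) {i : Fin d}
    (h : actN (parity deg) (contract i) (realizeConst d ι n C) = 0) {J : Fin (n + 1) → Jet d ι}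
    (hJ : C J ≠ 0) : ∃ j, i ∈ (J j).2.1 := by
  by_contra! hcon
  have := sum_contractSign_mul_coeff hC h (insertForm J 0 i)
  rw [Finset.sum_eq_single 0] at this
  · rw [if_pos (by simp [insertForm]), removeForm_insertForm (hcon 0)] at this
    exact mul_ne_zero (contractSign_ne_zero _ _ _ _) hJ this
  · intro j _ hj
    rw [if_neg]
    simpa [insertForm, hj] using hcon j
  · simp

theorem weight_eq (J : Fin (n + 1) → Jet d ι) :
    weight J = ∑ j, ∑ i, ((J j).1 (.inr i) : ℤ) +
      ∑ i, (((Finset.univ.filter fun j => i ∈ (J j).2.1).card : ℤ) - 1) := by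
  have h : ∑ j, ((J j).2.1.card : ℤ) =
      ∑ i, ((Finset.univ.filter fun j => i ∈ (J j).2.1).card : ℤ) := by
    have h1 : ∀ j, ((J j).2.1.card : ℤ) = ∑ i, if i ∈ (J j).2.1 then 1 else 0 := fun j => by simp
    have h2 : ∀ i, ((Finset.univ.filter fun j => i ∈ (J j).2.1).card : ℤ) =
        ∑ j, if i ∈ (J j).2.1 then 1 else 0 := fun i => by simp
    rw [Finset.sum_congr rfl fun j _ => h1 j, Finset.sum_comm]
    exact Finset.sum_congr rfl fun i _ => (h2 i).symm
  rw [weight, Finset.sum_add_distrib, Finset.sum_sub_distrib, h]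
  simp
  ring

/-- A jet monomial of weight zero in which all the `dz̄_i` occur. -/
theorem exists_eq_holJet {J : Fin (n + 1) → Jet d ι} (hw : weight J = 0)
    (hJ : ∀ i, ∃ j, i ∈ (J j).2.1) :
    ∃ a g, J = holJet (fun j i => (J j).1 (.inl i)) a g := by
  have hpos : ∀ i, 0 ≤ ((Finset.univ.filter fun j => i ∈ (J j).2.1).card : ℤ) - 1 := by
    intro i
    obtain ⟨j, hj⟩ := hJ i
    have : 0 < (Finset.univ.filter fun j => i ∈ (J j).2.1).card :=
      Finset.card_pos.2 ⟨j, by simp [hj]⟩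
    omega
  rw [weight_eq, add_eq_zero_iff_of_nonneg
    (Finset.sum_nonneg fun j _ => Finset.sum_nonneg fun i _ => by positivity)
    (Finset.sum_nonneg fun i _ => hpos i), Finset.sum_eq_zero_iff_of_nonneg
    (fun j _ => Finset.sum_nonneg fun i _ => by positivity),
    Finset.sum_eq_zero_iff_of_nonneg fun i _ => hpos i] at hw
  obtain ⟨hβ, hc⟩ := hw
  have hβ' : ∀ j i, (J j).1 (.inr i) = 0 := by
    intro j i
    have := (Finset.sum_eq_zero_iff_of_nonneg (fun i _ => by positivity)).1
      (hβ j (Finset.mem_univ j)) i (Finset.mem_univ i)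
    exact_mod_cast this
  have huniq : ∀ i, ∃ j, ∀ l, i ∈ (J l).2.1 ↔ j = l := by
    intro i
    have : (Finset.univ.filter fun j => i ∈ (J j).2.1).card = 1 := by
      have := hc i (Finset.mem_univ i)
      omega
    obtain ⟨j, hj⟩ := Finset.card_eq_one.1 this
    refine ⟨j, fun l => ?_⟩
    have := Finset.ext_iff.1 hj l
    simpa [eq_comm] using this
  choose g hg using huniq
  refine ⟨fun j => (J j).2.2, g, ?_⟩
  ext1 j
  refine Prod.ext (funext fun k => ?_) (Prod.ext ?_ rfl)
  · rcases k with k | k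
    · rfl
    · exact hβ' j k
  · ext i
    simp [holJet, hg]

theorem removeForm_insertForm_holJet (α : Fin (n + 1) → Fin d → ℕ) (a : Fin (n + 1) → ι)
    (g : Fin d → Fin (n + 1)) {i : Fin d} (h : g i ≠ 0) :
    removeForm (insertForm (holJet α a g) 0 i) (g i) i = holJet α a (Function.update g i 0) := by
  rw [← insertForm_holJet_update α a g h, removeForm_insertForm]
  simpa [holJet] using Ne.symm h

theorem coeff_holJet_eq_zero {deg : ι → ℤ} {C : (Fin (n + 1) → Jet d ι) →₀ ℂ}
    (hC : C ∈ Finsupp.supported ℂ ℂ (normalJets d ι n))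
    (h : ∀ i, actN (parity deg) (contract i) (realizeConst d ι n C) = 0)
    {α : Fin (n + 1) → Fin d → ℕ} {a : Fin (n + 1) → ι} (h0 : C (holJet α a 0) = 0)
    (g : Fin d → Fin (n + 1)) : C (holJet α a g) = 0 := by
  induction hm : (Finset.univ.filter fun i => g i ≠ 0).card using Nat.strong_induction_on
    generalizing g with
  | _ m ih =>
    by_cases hg : g = 0
    · rw [hg, h0]
    · obtain ⟨i, hi⟩ := Function.ne_iff.1 hg
      have hi' : g i ≠ 0 := hi
      have hlt : C (holJet α a (Function.update g i 0)) = 0 := by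
        refine ih _ ?_ _ rfl
        rw [← hm]
        refine Finset.card_lt_card (Finset.ssubset_iff_of_subset ?_ |>.2 ⟨i, by simp [hi'], by simp⟩)
        intro k hk
        by_cases hki : k = i
        · subst hki; simp [hi']
        · simpa [hki] using hk
      have key := sum_contractSign_mul_coeff hC (h i) (insertForm (holJet α a g) 0 i)
      rw [Finset.sum_eq_single 0] at key
      · rw [if_pos (by simp [insertForm]), removeForm_insertForm (by simpa [holJet] using hi')] at key
        exact (mul_eq_zero.1 key).resolve_left (contractSign_ne_zero _ _ _ _)
      · intro j _ hj
        split_ifs with hmem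
        · have : j = g i := by
            rw [insertForm, Function.update_of_ne hj] at hmem
            simpa [holJet, eq_comm] using hmem
          subst this
          rw [removeForm_insertForm_holJet α a g hi', hlt, mul_zero]
        · rfl
      · simp

theorem coeff_eq_zero_of_holJet {deg : ι → ℤ} {C : (Fin (n + 1) → Jet d ι) →₀ ℂ}
    (hC : C ∈ Finsupp.supported ℂ ℂ (normalJets d ι n))
    (hN : actN 1 (eulerLie d ι) (realizeConst d ι n C) = 0)
    (h : ∀ i, actN (parity deg) (contract i) (realizeConst d ι n C) = 0)
    (h0 : ∀ α a, C (holJet α a 0) = 0) : C = 0 := by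
  ext J
  by_contra hJ
  obtain ⟨a, g, hJ'⟩ := exists_eq_holJet (weight_eq_zero_of_coeff_ne_zero hC hN hJ)
    fun i => exists_mem_of_coeff_ne_zero hC (h i) hJ
  rw [hJ'] at hJ
  exact hJ (coeff_holJet_eq_zero hC h (h0 _ _) g)

theorem holJet_injective {α α' : Fin (n + 1) → Fin d → ℕ} {a a' : Fin (n + 1) → ι}
    {g g' : Fin d → Fin (n + 1)} (h : holJet α a g = holJet α' a' g') :
    α = α' ∧ a = a' ∧ g = g' := by
  refine ⟨funext fun j => funext fun i => ?_, funext fun j => ?_, funext fun i => ?_⟩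
  · exact congrFun (congrArg Prod.fst (congrFun h j)) (.inl i)
  · exact congrArg (fun J => J.2.2) (congrFun h j)
  · have : i ∈ (holJet α a g (g i)).2.1 := by simp [holJet]
    rw [h] at this
    simpa [holJet, eq_comm] using this

/-- The coefficients of a holomorphic functional. -/
def holCoeff [Fintype ι] (deg : ι → ℤ) (F₀ : (Fin (n + 1) → ι) → ℂ)
    (α : Fin (n + 1) → Fin d → ℕ) : (Fin (n + 1) → Jet d ι) →₀ ℂ :=
  ∑ a, ∑ g, Finsupp.single (holJet α a g) (wedgeSign deg a g * F₀ a)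

theorem realizeConst_holCoeff [Fintype ι] (deg : ι → ℤ) (F₀ : (Fin (n + 1) → ι) → ℂ)
    (α : Fin (n + 1) → Fin d → ℕ) :
    realizeConst d ι n (holCoeff deg F₀ α) = holMono deg F₀ α := by
  simp only [holCoeff, holMono, map_sum, realizeConst_single]

theorem holCoeff_apply [Fintype ι] (deg : ι → ℤ) (F₀ : (Fin (n + 1) → ι) → ℂ)
    (α α' : Fin (n + 1) → Fin d → ℕ) (a : Fin (n + 1) → ι) [Decidable (α = α')] :
    holCoeff deg F₀ α (holJet α' a 0) = if α = α' then F₀ a else 0 := by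
  classical
  rw [holCoeff, Finsupp.finsetSum_apply]
  simp only [Finsupp.finsetSum_apply]
  split_ifs with hα
  · subst hα
    rw [Finset.sum_eq_single a, Finset.sum_eq_single 0]
    · rw [Finsupp.single_eq_same]
      rw [wedgeSign_eq]
      simp [signOf, vectorSign]
    · intro g _ hg
      exact Finsupp.single_eq_of_ne fun h => hg (holJet_injective h).2.2.symm
    · simp
    · intro b _ hb
      exact Finset.sum_eq_zero fun g _ =>
        Finsupp.single_eq_of_ne fun h => hb (holJet_injective h).2.1.symm
    · simp
  · exact Finset.sum_eq_zero fun b _ => Finset.sum_eq_zero fun g _ =>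
      Finsupp.single_eq_of_ne fun h => hα (holJet_injective h).1.symm

/-- A functional with constant coefficients, of weight zero and annihilated by all contractions, is
built from holomorphic derivatives only. -/
theorem realizeConst_mem_hol [Fintype ι] {deg : ι → ℤ} {C : (Fin (n + 1) → Jet d ι) →₀ ℂ}
    (hC : C ∈ Finsupp.supported ℂ ℂ (normalJets d ι n))
    (hN : actN 1 (eulerLie d ι) (realizeConst d ι n C) = 0)
    (h : ∀ i, actN (parity deg) (contract i) (realizeConst d ι n C) = 0) :
    realizeConst d ι n C ∈ Submodule.span ℂ {I | IsHolMonomial deg I} := by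
  classical
  let A : Finset (Fin (n + 1) → Fin d → ℕ) := C.support.image fun J j i => (J j).1 (.inl i)
  let F : (Fin (n + 1) → Fin d → ℕ) → (Fin (n + 1) → ι) → ℂ := fun α a => C (holJet α a 0)
  have hA : ∀ α ∈ A, holCoeff deg (F α) α ∈ Finsupp.supported ℂ ℂ (normalJets d ι n) := by
    intro α hα
    obtain ⟨J, hJ, rfl⟩ := Finset.mem_image.1 hα
    have hJ0 : (J 0).1 = 0 := hC hJ
    refine Submodule.sum_mem _ fun a _ => Submodule.sum_mem _ fun g _ =>
      Finsupp.single_mem_supported ℂ _ ?_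
    refine funext fun k => ?_
    rcases k with k | k
    · exact congrFun hJ0 (.inl k)
    · rfl
  have hzero : C - ∑ α ∈ A, holCoeff deg (F α) α = 0 := by
    refine coeff_eq_zero_of_holJet (deg := deg)
      (sub_mem hC (Submodule.sum_mem _ fun α hα => hA α hα)) ?_ (fun i => ?_) fun α a => ?_
    · simp only [map_sub, map_sum, realizeConst_holCoeff, actN_eulerLie_holMono, hN,
        Finset.sum_const_zero, sub_zero]
    · simp only [map_sub, map_sum, realizeConst_holCoeff, actN_contract_holMono, h i,
        Finset.sum_const_zero, sub_zero]
    · rw [Finsupp.sub_apply, Finsupp.finsetSum_apply]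
      simp only [holCoeff_apply, Finset.sum_ite_eq', F]
      split_ifs with hα
      · exact sub_self _
      · rw [sub_zero]
        by_contra hne
        exact hα (Finset.mem_image.2 ⟨_, Finsupp.mem_support_iff.2 hne, rfl⟩)
  rw [sub_eq_zero.1 hzero, map_sum]
  refine Submodule.sum_mem _ fun α _ => Submodule.subset_span ?_
  exact (isHolMonomial_iff deg _).2 ⟨_, _, realizeConst_holCoeff deg _ _⟩

end WeightZero

/-! ### A criterion for quasi-isomorphisms -/

section QuasiIsomorphism

variable {A : Type u} [AddCommGroup A] [Module ℂ A] {Q : Module.End ℂ A} {hQ : Q * Q = 0}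

/-- A free cover on which linear maps may be prescribed elementwise. -/
theorem exists_refinement {B : ModuleCat.{u} ℂ} {C : ModuleCat.{u} ℂ} (f : B → C) :
    ∃ (B' : ModuleCat.{u} ℂ) (π : B' ⟶ B) (_ : Epi π) (g : B' ⟶ C), ∃ b : B → B',
      (∀ x, π (b x) = x) ∧ (∀ x, g (b x) = f x) ∧
      ∀ (D : ModuleCat.{u} ℂ) (h h' : B' ⟶ D), (∀ x, h (b x) = h' (b x)) → h = h' := by
  have h1 : ∀ x, (ModuleCat.ofHom (Finsupp.linearCombination ℂ (id : B → B)) :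
      ModuleCat.of ℂ (B →₀ ℂ) ⟶ B) (Finsupp.single x 1) = x := fun x => by
    simp
  refine ⟨ModuleCat.of ℂ (B →₀ ℂ), ModuleCat.ofHom (Finsupp.linearCombination ℂ (id : B → B)), ?_,
    ModuleCat.ofHom (Finsupp.linearCombination ℂ f), fun x => Finsupp.single x 1, h1, ?_, ?_⟩
  · exact (ModuleCat.epi_iff_surjective _).2 fun x => ⟨_, h1 x⟩
  · intro x
    simp
  · intro D h h' hh
    refine ModuleCat.hom_ext (Finsupp.lhom_ext' fun x => LinearMap.ext_ring ?_)
    exact hh x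

theorem quasiIso_subcomplexInclusion (S S' : ℤ → Submodule ℂ A)
    (hS : ∀ k, ∀ x ∈ S k, Q x ∈ S (k + 1)) (hS' : ∀ k, ∀ x ∈ S' k, Q x ∈ S' (k + 1))
    (hle : ∀ k, S k ≤ S' k)
    (hsurj : ∀ k, ∀ x ∈ S' (k + 1), Q x = 0 → ∃ y ∈ S (k + 1), Q y = 0 ∧
      ∃ z ∈ S' k, x = y + Q z)
    (hinj : ∀ k, ∀ x ∈ S (k + 1), ∀ z ∈ S' k, Q z = x → ∃ y ∈ S k, Q y = x) :
    QuasiIso (subcomplexInclusion Q hQ S S' hS hS' hle) := by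
  refine ⟨fun j => ?_⟩
  obtain ⟨k, rfl⟩ : ∃ k, j = k + 1 := ⟨j - 1, by ring⟩
  rw [quasiIsoAt_iff_isIso_homologyMap]
  have hmono : Mono (HomologicalComplex.homologyMap
      (subcomplexInclusion Q hQ S S' hS hS' hle) (k + 1)) := by
    rw [HomologicalComplex.mono_homologyMap_iff_up_to_refinements _ k (k + 1) (k + 1 + 1)
      (by simp) (by simp)]
    intro B x₂ _ y₁ hy
    rw [subcomplex_d] at hy
    have hb : ∀ b : B, ∃ y : S k, Q y.1 = (x₂ b : S (k + 1)).1 := by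
      intro b
      obtain ⟨y, hy, h⟩ := hinj k _ (x₂ b : S (k + 1)).2 _ (y₁ b : S' k).2
        (congrArg (fun f => (f b : S' (k + 1)).1) hy).symm
      exact ⟨⟨y, hy⟩, h⟩
    choose f hf using hb
    obtain ⟨B', π, hπ, g, b, h1, h2, h3⟩ := exists_refinement (C := ModuleCat.of ℂ (S k)) f
    refine ⟨B', π, hπ, g, ?_⟩
    rw [subcomplex_d]
    refine h3 _ _ _ fun x => ?_
    change x₂ (π (b x)) = (Q.restrict (hS k)) (g (b x))
    rw [h1, h2]
    exact Subtype.ext (hf x).symm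
  have hepi : Epi (HomologicalComplex.homologyMap
      (subcomplexInclusion Q hQ S S' hS hS' hle) (k + 1)) := by
    rw [HomologicalComplex.epi_homologyMap_iff_up_to_refinements _ k (k + 1) (k + 1 + 1)
      (by simp) (by simp)]
    intro B y₂ hy
    rw [subcomplex_d] at hy
    have hb : ∀ b : B, ∃ y : S (k + 1), ∃ z : S' k, Q y.1 = 0 ∧
        (y₂ b : S' (k + 1)).1 = y.1 + Q z.1 := by
      intro b
      obtain ⟨y, hy, h0, z, hz, h⟩ := hsurj k _ (y₂ b : S' (k + 1)).2
        (congrArg (fun f => (f b : S' (k + 1 + 1)).1) hy)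
      exact ⟨⟨y, hy⟩, ⟨z, hz⟩, h0, h⟩
    choose f f' hf0 hf using hb
    obtain ⟨B', π, hπ, g, b, h1, h2, h3⟩ :=
      exists_refinement (C := ModuleCat.of ℂ (S (k + 1) × S' k)) fun x => (f x, f' x)
    refine ⟨B', π, hπ, g ≫ ModuleCat.ofHom (LinearMap.fst ℂ (S (k + 1)) (S' k)), ?_,
      g ≫ ModuleCat.ofHom (LinearMap.snd ℂ (S (k + 1)) (S' k)), ?_⟩
    · rw [subcomplex_d]
      refine h3 _ _ _ fun x => ?_
      change (Q.restrict (hS (k + 1))) ((g (b x)).1) = 0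
      rw [h2]
      exact Subtype.ext (hf0 x)
    · rw [subcomplex_d]
      refine h3 _ _ _ fun x => ?_
      change y₂ (π (b x)) = Submodule.inclusion (hle (k + 1)) (g (b x)).1 +
        (Q.restrict (hS' k)) ((g (b x)).2)
      rw [h1, h2]
      exact Subtype.ext (hf x)
  exact isIso_of_mono_of_epi _

end QuasiIsomorphism

/-! ### The comparison of the two complexes -/

section Comparison

theorem aeval_apply_mem {V : Type*} [AddCommGroup V] [Module ℂ V] {N : Module.End ℂ V}
    {S : Submodule ℂ V} (hS : ∀ x ∈ S, N x ∈ S) (q : Polynomial ℂ) :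
    ∀ x ∈ S, Polynomial.aeval N q x ∈ S := by
  induction q using Polynomial.induction_on' with
  | add p q hp hq =>
    intro x hx
    rw [map_add, LinearMap.add_apply]
    exact add_mem (hp x hx) (hq x hx)
  | monomial m r =>
    intro x hx
    rw [Polynomial.aeval_monomial, ← Algebra.smul_def, LinearMap.smul_apply]
    refine S.smul_mem r ?_
    induction m with
    | zero => exact hx
    | succ m ih =>
      rw [pow_succ']
      exact hS _ ih

theorem commute_aeval {V : Type*} [AddCommGroup V] [Module ℂ V] {D N : Module.End ℂ V}
    (h : Commute D N) (q : Polynomial ℂ) : Commute D (Polynomial.aeval N q) := by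
  induction q using Polynomial.induction_on' with
  | add p q hp hq =>
    rw [map_add]
    exact hp.add_right hq
  | monomial m r =>
    rw [Polynomial.aeval_monomial]
    exact Commute.mul_right (show Commute D (algebraMap ℂ _ r) from (Algebra.commutes r D).symm)
      (h.pow_right m)

theorem sub_neg_one_smul {V : Type*} [AddCommGroup V] [Module ℂ V] (v w : V) :
    v - (-1 : ℂ) • w = v + w := by
  rw [neg_one_smul, sub_neg_eq_add]

theorem actN_anticommutator {F : Type*} [AddCommGroup F] [Module ℂ F] {N : ℕ}
    {s f g : Module.End ℂ F} (hs : s * s = 1) (hf : s * f = (-1 : ℂ) • (f * s))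
    (hg : s * g = (-1 : ℂ) • (g * s)) (I : MultilinearMap ℂ (fun _ : Fin N => F) ℂ) :
    actN s f (actN s g I) + actN s g (actN s f I) = actN 1 (g * f + f * g) I := by
  have := actN_commutator (c := -1) (by norm_num) rfl hg hf I
  rw [hs, sub_neg_one_smul, sub_neg_one_smul] at this
  exact this

variable {d : ℕ} {ι : Type u} {n : ℕ}

/-- Functionals with constant coefficients decompose into eigenvectors of the Euler field. -/
theorem exists_polynomial (C : (Fin (n + 1) → Jet d ι) →₀ ℂ) : ∃ q : Polynomial ℂ,
    q.eval 0 = 1 ∧ Polynomial.aeval (actN 1 (eulerLie d ι)) (Polynomial.X * q)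
      (realizeConst d ι n C) = 0 := by
  induction C using Finsupp.induction_linear with
  | zero => exact ⟨1, by simp, by simp⟩
  | add C C' h h' =>
    obtain ⟨q, hq, h⟩ := h
    obtain ⟨q', hq', h'⟩ := h'
    refine ⟨q * q', by simp [hq, hq'], ?_⟩
    have e1 : Polynomial.aeval (actN 1 (eulerLie d ι)) (Polynomial.X * (q * q'))
        (realizeConst d ι n C) = 0 := by
      rw [show Polynomial.X * (q * q') = q' * (Polynomial.X * q) by ring,
        map_mul (Polynomial.aeval _) q', Module.End.mul_apply, h, map_zero]
    have e2 : Polynomial.aeval (actN 1 (eulerLie d ι)) (Polynomial.X * (q * q'))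
        (realizeConst d ι n C') = 0 := by
      rw [show Polynomial.X * (q * q') = q * (Polynomial.X * q') by ring,
        map_mul (Polynomial.aeval _) q, Module.End.mul_apply, h', map_zero]
    rw [map_add, map_add, e1, e2, add_zero]
  | single J r =>
    have hw := actN_eulerLie_mono J
    rw [realizeConst_single]
    by_cases h0 : weight J = 0
    · refine ⟨1, by simp, ?_⟩
      rw [mul_one, Polynomial.aeval_X, map_smul, hw, h0]
      simp
    · refine ⟨1 - Polynomial.C (weight J : ℂ)⁻¹ * Polynomial.X, by simp, ?_⟩
      have h0' : (weight J : ℂ) ≠ 0 := by exact_mod_cast h0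
      rw [map_mul, map_sub, map_mul, Polynomial.aeval_X, Polynomial.aeval_C, map_one,
        ← Algebra.smul_def, Module.End.mul_apply, LinearMap.sub_apply, LinearMap.smul_apply,
        Module.End.one_apply, map_sub, map_smul, map_smul, map_smul, hw, map_smul, hw]
      simp only [smul_smul]
      rw [← sub_smul]
      convert zero_smul ℂ _ using 2
      field_simp
      ring

namespace FreeTheory

variable [Fintype ι] (T : FreeTheory d ι)

/-- The `n + 1`-linear part of the invariant local functionals. -/
def invariantN (n : ℕ) (k : ℤ) :
    Submodule ℂ (MultilinearMap ℂ (fun _ : Fin (n + 1) => FieldC d ι) ℂ) :=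
  degN T.deg (n + 1) k ⊓ symN T.deg n ⊓ Submodule.span ℂ {I | IsLocal I} ⊓
    (⨅ k, LinearMap.ker (actN 1 (onCoeff (pdC k)))) ⊓
    ⨅ i, LinearMap.ker (actN (parity T.deg) (contract i))

/-- The `n + 1`-linear part of the holomorphic functionals. -/
def holN (n : ℕ) (k : ℤ) :
    Submodule ℂ (MultilinearMap ℂ (fun _ : Fin (n + 1) => FieldC d ι) ℂ) :=
  degN T.deg (n + 1) k ⊓ symN T.deg n ⊓ Submodule.span ℂ {I | IsHolMonomial T.deg I}

theorem mem_invariantN {k : ℤ} {I : MultilinearMap ℂ (fun _ : Fin (n + 1) => FieldC d ι) ℂ} :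
    I ∈ T.invariantN n k ↔ I ∈ degN T.deg (n + 1) k ∧ I ∈ symN T.deg n ∧
      I ∈ Submodule.span ℂ {I | IsLocal I} ∧ (∀ k, actN 1 (onCoeff (pdC k)) I = 0) ∧
      ∀ i, actN (parity T.deg) (contract i) I = 0 := by
  simp only [invariantN, Submodule.mem_inf, Submodule.mem_iInf, LinearMap.mem_ker, and_assoc]

theorem mem_invariantLocal {k : ℤ} {I : Functional d ι} :
    I ∈ T.invariantLocal k ↔ ∀ n, I n ∈ T.invariantN n k := by
  have hdeg : I ∈ degreePart T.deg k ↔ ∀ n, I n ∈ degN T.deg (n + 1) k := Iff.rfl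
  have hsym : I ∈ symmetricPart T.deg ↔ ∀ n, I n ∈ symN T.deg n := Iff.rfl
  have hact : ∀ s f : Module.End ℂ (FieldC d ι), act s f I = 0 ↔ ∀ n, actN s f (I n) = 0 := by
    intro s f
    simp only [funext_iff, act_apply, Pi.zero_apply]
  constructor
  · rintro ⟨⟨⟨h1, h2⟩, h3⟩, h4⟩ n
    refine T.mem_invariantN.2 ⟨hdeg.1 h1 n, hsym.1 h2 n, h3 n (Set.mem_univ n), fun k => ?_,
      fun i => ?_⟩
    · rcases k with i | i
      · exact (hact _ _).1 ((Submodule.mem_iInf _).1 h4 i).1.1 n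
      · exact (hact _ _).1 ((Submodule.mem_iInf _).1 h4 i).1.2 n
    · exact (hact _ _).1 ((Submodule.mem_iInf _).1 h4 i).2 n
  · intro h
    have h' := fun n => T.mem_invariantN.1 (h n)
    exact ⟨⟨⟨hdeg.2 fun n => (h' n).1, hsym.2 fun n => (h' n).2.1⟩, fun n _ => (h' n).2.2.1⟩,
      (Submodule.mem_iInf _).2 fun i =>
        ⟨⟨(hact _ _).2 fun n => (h' n).2.2.2.1 (.inl i),
          (hact _ _).2 fun n => (h' n).2.2.2.1 (.inr i)⟩,
          (hact _ _).2 fun n => (h' n).2.2.2.2 i⟩⟩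

theorem mem_holLocal {k : ℤ} {I : Functional d ι} :
    I ∈ T.holLocal k ↔ ∀ n, I n ∈ T.holN n k := by
  have hdeg : I ∈ degreePart T.deg k ↔ ∀ n, I n ∈ degN T.deg (n + 1) k := Iff.rfl
  have hsym : I ∈ symmetricPart T.deg ↔ ∀ n, I n ∈ symN T.deg n := Iff.rfl
  simp only [holLocal, holN, Submodule.mem_inf, Submodule.mem_pi, hdeg, hsym, Set.mem_univ,
    forall_const, forall_and]

/-- The differential on `N`-linear functionals. -/
def diffN (N : ℕ) : Module.End ℂ (MultilinearMap ℂ (fun _ : Fin N => FieldC d ι) ℂ) :=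
  actN (parity T.deg) T.fieldDiff

/-- The contracting homotopy on `N`-linear functionals. -/
def homotopyN (N : ℕ) : Module.End ℂ (MultilinearMap ℂ (fun _ : Fin N => FieldC d ι) ℂ) :=
  actN (parity T.deg) (eulerContract d ι)

theorem differential_apply (I : Functional d ι) (n : ℕ) :
    T.differential I n = T.diffN (n + 1) (I n) := act_apply _ _ _ _

/-- The anticommutator of two odd derivations. -/
theorem actN_parity_anticommutator {e e' : ℤ} (he : Odd e) (he' : Odd e')
    {f g : Module.End ℂ (FieldC d ι)} (hf : HasDegree T.deg e f) (hg : HasDegree T.deg e' g) {N : ℕ}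
    (I : MultilinearMap ℂ (fun _ : Fin N => FieldC d ι) ℂ) :
    actN (parity T.deg) f (actN (parity T.deg) g I) +
      actN (parity T.deg) g (actN (parity T.deg) f I) = actN 1 (g * f + f * g) I := by
  have h1 := parity_anticommute he hf
  have h2 := parity_anticommute he' hg
  have h3 : parity T.deg * parity T.deg = (1 : Module.End ℂ (FieldC d ι)) := parity_mul_self T.deg
  have h4 := actN_anticommutator h3 h1 h2 I
  exact h4

/-- The commutator of a derivation of even degree with an odd one. -/
theorem actN_parity_commutator (f g : Module.End ℂ (FieldC d ι)) (hf : HasDegree T.deg 0 f)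
    {N : ℕ} (I : MultilinearMap ℂ (fun _ : Fin N => FieldC d ι) ℂ) :
    actN 1 f (actN (parity T.deg) g I) - actN (parity T.deg) g (actN 1 f I) =
      actN (parity T.deg) (g * f - f * g) I := by
  have hp : parity T.deg * f = (1 : ℂ) • (f * parity T.deg) := by
    rw [one_smul]
    classical
    refine LinearMap.pi_ext fun s x => ?_
    have hx : IsHomog T.deg ((s.1.card : ℤ) + T.deg s.2) (Pi.single s x : FieldC d ι) := by
      intro t ht
      rw [Pi.single_apply, if_neg]
      rintro rfl
      exact ht rfl
    change parity T.deg (f (Pi.single s x)) = f (parity T.deg (Pi.single s x))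
    rw [isKoszulSign_parity T.deg odd_one _ _ hx, isKoszulSign_parity T.deg odd_one _ _ (hf _ _ hx),
      map_smul, add_zero]
  have := actN_commutator (s := 1) (t := parity T.deg) (c := 1) (f := f) (g := g) (by norm_num)
    (by rw [one_mul, mul_one]) (by rw [one_mul, mul_one, one_smul]) hp I
  simpa only [one_smul, one_mul] using this

theorem diffN_diffN {N : ℕ} (I : MultilinearMap ℂ (fun _ : Fin N => FieldC d ι) ℂ) :
    T.diffN N (T.diffN N I) = 0 := by
  have := T.actN_parity_anticommutator odd_one odd_one T.hasDegree_fieldDiff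
    T.hasDegree_fieldDiff I
  rw [T.fieldDiff_mul_self, add_zero, actN_zero, ← two_smul ℂ] at this
  exact (smul_eq_zero.1 this).resolve_left two_ne_zero

theorem diffN_homotopyN_add {N : ℕ} (I : MultilinearMap ℂ (fun _ : Fin N => FieldC d ι) ℂ) :
    T.diffN N (T.homotopyN N I) + T.homotopyN N (T.diffN N I) = actN 1 (eulerLie d ι) I := by
  rw [← T.fieldDiff_mul_eulerContract_add, add_comm (T.fieldDiff * _)]
  exact T.actN_parity_anticommutator odd_one odd_neg_one T.hasDegree_fieldDiff
    hasDegree_eulerContract I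

theorem commute_diffN_eulerLie (N : ℕ) : Commute (T.diffN N) (actN 1 (eulerLie d ι)) := by
  refine LinearMap.ext fun I => ?_
  have := T.actN_parity_commutator (eulerLie d ι) T.fieldDiff hasDegree_eulerLie I
  rw [← (T.commute_eulerLie_fieldDiff).eq, sub_self, actN_zero, sub_eq_zero] at this
  exact this.symm

theorem exists_realizeConst_of_mem {k : ℤ}
    {I : MultilinearMap ℂ (fun _ : Fin (n + 1) => FieldC d ι) ℂ} (hI : I ∈ T.invariantN n k) :
    ∃ C ∈ Finsupp.supported ℂ ℂ (normalJets d ι n), realizeConst d ι n C = I := by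
  obtain ⟨-, -, hloc, hinv, -⟩ := T.mem_invariantN.1 hI
  exact exists_realizeConst_eq hloc hinv

theorem actN_parity_mem_local {k : ℤ} {f : Module.End ℂ (FieldC d ι)} (hf : IsDiffOp f)
    {I : MultilinearMap ℂ (fun _ : Fin (n + 1) => FieldC d ι) ℂ} (hI : I ∈ T.invariantN n k) :
    actN (parity T.deg) f I ∈ Submodule.span ℂ {I | IsLocal I} := by
  obtain ⟨C, -, rfl⟩ := T.exists_realizeConst_of_mem hI
  exact lagrangian_le_local
    (actN_mem_lagrangian (isDiffOp_parity _) hf (realizeConst_mem_lagrangian C))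

theorem diffN_mem {k : ℤ} {I : MultilinearMap ℂ (fun _ : Fin (n + 1) => FieldC d ι) ℂ}
    (hI : I ∈ T.invariantN n k) : T.diffN (n + 1) I ∈ T.invariantN n (k + 1) := by
  have hloc := T.actN_parity_mem_local T.isDiffOp_fieldDiff hI
  obtain ⟨hdeg, hsym, -, hinv, hη⟩ := T.mem_invariantN.1 hI
  have hs := isKoszulSign_parity (d := d) T.deg odd_one
  refine T.mem_invariantN.2 ⟨actN_mem_degN hs T.hasDegree_fieldDiff hdeg,
    actN_mem_symN hs T.hasDegree_fieldDiff hsym, hloc, fun k => ?_, fun i => ?_⟩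
  · have := T.actN_parity_commutator (onCoeff (pdC k)) T.fieldDiff (hasDegree_onCoeff _) I
    rwa [hinv k, map_zero, sub_zero, (T.commute_onCoeff_pdC_fieldDiff k).eq, sub_self,
      actN_zero] at this
  · have := T.actN_parity_anticommutator odd_neg_one odd_one (hasDegree_contract i)
      T.hasDegree_fieldDiff I
    rwa [hη i, map_zero, add_zero, add_comm (T.fieldDiff * _), T.contract_mul_fieldDiff_add,
      hinv] at this

theorem homotopyN_mem {k : ℤ} {I : MultilinearMap ℂ (fun _ : Fin (n + 1) => FieldC d ι) ℂ}
    (hI : I ∈ T.invariantN n (k + 1)) : T.homotopyN (n + 1) I ∈ T.invariantN n k := by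
  have hloc := T.actN_parity_mem_local isDiffOp_eulerContract hI
  obtain ⟨hdeg, hsym, -, hinv, hη⟩ := T.mem_invariantN.1 hI
  have hs := isKoszulSign_parity (d := d) T.deg odd_neg_one
  refine T.mem_invariantN.2 ⟨?_, actN_mem_symN hs hasDegree_eulerContract hsym, hloc,
    fun k => ?_, fun i => ?_⟩
  · have := actN_mem_degN hs hasDegree_eulerContract hdeg
    rwa [add_neg_cancel_right] at this
  · have := T.actN_parity_commutator (onCoeff (pdC k)) (eulerContract d ι) (hasDegree_onCoeff _) I
    rw [hinv k, map_zero, sub_zero, ← neg_sub, onCoeff_pdC_mul_eulerContract,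
      ← neg_one_smul ℂ, actN_smul] at this
    rw [homotopyN, this]
    rcases k with i | i
    · rw [Sum.elim_inl, actN_zero, smul_zero]
    · rw [Sum.elim_inr, hη, smul_zero]
  · have := T.actN_parity_anticommutator odd_neg_one odd_neg_one (hasDegree_contract i)
      hasDegree_eulerContract I
    rwa [hη i, map_zero, add_zero, add_comm (eulerContract d ι * contract i),
      contract_mul_eulerContract_add, actN_zero] at this

theorem actN_eulerLie_mem {k : ℤ} {I : MultilinearMap ℂ (fun _ : Fin (n + 1) => FieldC d ι) ℂ}
    (hI : I ∈ T.invariantN n k) : actN 1 (eulerLie d ι) I ∈ T.invariantN n k := by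
  rw [← T.diffN_homotopyN_add]
  refine add_mem ?_ (T.homotopyN_mem (T.diffN_mem hI))
  obtain ⟨l, rfl⟩ : ∃ l, k = l + 1 := ⟨k - 1, by ring⟩
  exact T.diffN_mem (T.homotopyN_mem hI)

/-- The holomorphic functionals are the invariant local functionals of weight zero. -/
theorem mem_holN_iff {k : ℤ} {I : MultilinearMap ℂ (fun _ : Fin (n + 1) => FieldC d ι) ℂ} :
    I ∈ T.holN n k ↔ I ∈ T.invariantN n k ∧ actN 1 (eulerLie d ι) I = 0 := by
  constructor
  · rintro ⟨⟨hdeg, hsym⟩, hhol⟩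
    have h1 : I ∈ lagrangian d ι n :=
      holMono_induction (fun F₀ α => holMono_mem_lagrangian T.deg F₀ α) hhol
    have h2 : ∀ k, I ∈ LinearMap.ker
        (actN (N := n + 1) 1 (onCoeff (pdC k) : Module.End ℂ (FieldC d ι))) := fun k =>
      holMono_induction (fun F₀ α => actN_onCoeff_pdC_holMono T.deg F₀ α k) hhol
    have h3 : ∀ i, I ∈ LinearMap.ker
        (actN (N := n + 1) (parity T.deg) (contract i : Module.End ℂ (FieldC d ι))) := fun i =>
      holMono_induction (fun F₀ α => actN_contract_holMono T.deg F₀ α i) hhol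
    have h4 : I ∈ LinearMap.ker (actN 1 (eulerLie d ι)) :=
      holMono_induction (fun F₀ α => actN_eulerLie_holMono T.deg F₀ α) hhol
    exact ⟨T.mem_invariantN.2 ⟨hdeg, hsym, lagrangian_le_local h1, h2, h3⟩, h4⟩
  · rintro ⟨hI, hN⟩
    obtain ⟨C, hC, hCI⟩ := T.exists_realizeConst_of_mem hI
    obtain ⟨hdeg, hsym, -, -, hη⟩ := T.mem_invariantN.1 hI
    refine ⟨⟨hdeg, hsym⟩, ?_⟩
    subst hCI
    exact realizeConst_mem_hol hC hN hη

theorem exists_polynomial_of_mem {k : ℤ}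
    {I : MultilinearMap ℂ (fun _ : Fin (n + 1) => FieldC d ι) ℂ} (hI : I ∈ T.invariantN n k) :
    ∃ q : Polynomial ℂ, q.eval 0 = 1 ∧
      Polynomial.aeval (actN 1 (eulerLie d ι)) q I ∈ T.holN n k := by
  obtain ⟨C, -, hC⟩ := T.exists_realizeConst_of_mem hI
  obtain ⟨q, hq, h⟩ := exists_polynomial C
  refine ⟨q, hq, T.mem_holN_iff.2 ⟨aeval_apply_mem (fun _ h => T.actN_eulerLie_mem h) q I hI, ?_⟩⟩
  rwa [hC, map_mul, Polynomial.aeval_X] at h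

theorem exists_mul_X_eq {q : Polynomial ℂ} (hq : q.eval 0 = 1) :
    ∃ r : Polynomial ℂ, 1 = q + Polynomial.X * r := by
  have : Polynomial.X ∣ 1 - q := by
    rw [Polynomial.X_dvd_iff, Polynomial.coeff_zero_eq_eval_zero]
    simp [hq]
  obtain ⟨r, hr⟩ := this
  exact ⟨r, by rw [← hr]; ring⟩

theorem diffN_mem_holN {k : ℤ} {I : MultilinearMap ℂ (fun _ : Fin (n + 1) => FieldC d ι) ℂ}
    (hI : I ∈ T.holN n k) : T.diffN (n + 1) I ∈ T.holN n (k + 1) := by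
  obtain ⟨h, hN⟩ := T.mem_holN_iff.1 hI
  refine T.mem_holN_iff.2 ⟨T.diffN_mem h, ?_⟩
  have := LinearMap.congr_fun (T.commute_diffN_eulerLie (n + 1)).eq I
  rw [Module.End.mul_apply, Module.End.mul_apply, hN, map_zero] at this
  exact this.symm

theorem exists_decomposition {k : ℤ}
    {I : MultilinearMap ℂ (fun _ : Fin (n + 1) => FieldC d ι) ℂ}
    (hI : I ∈ T.invariantN n (k + 1)) (hD : T.diffN (n + 1) I = 0) :
    ∃ I' ∈ T.holN n (k + 1), ∃ J ∈ T.invariantN n k, I = I' + T.diffN (n + 1) J := by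
  obtain ⟨q, hq, hhol⟩ := T.exists_polynomial_of_mem hI
  obtain ⟨r, hr⟩ := exists_mul_X_eq hq
  set N := actN (N := n + 1) 1 (eulerLie d ι) with hN
  have hmem := aeval_apply_mem (fun _ h => T.actN_eulerLie_mem h) r I hI
  refine ⟨_, hhol, _, T.homotopyN_mem hmem, ?_⟩
  have h1 : I = Polynomial.aeval N q I + N (Polynomial.aeval N r I) := by
    have := congrArg (fun p => Polynomial.aeval N p I) hr
    simpa only [map_one, map_add, map_mul, Polynomial.aeval_X, LinearMap.add_apply,
      Module.End.mul_apply, Module.End.one_apply] using this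
  have h2 : T.diffN (n + 1) (Polynomial.aeval N r I) = 0 := by
    have := LinearMap.congr_fun (commute_aeval (T.commute_diffN_eulerLie (n + 1)) r).eq I
    rw [Module.End.mul_apply, Module.End.mul_apply, hD, map_zero] at this
    exact this
  have h3 := T.diffN_homotopyN_add (Polynomial.aeval N r I)
  rw [h2, map_zero, add_zero] at h3
  rw [h3]
  exact h1

theorem exists_primitive {k : ℤ} {I J : MultilinearMap ℂ (fun _ : Fin (n + 1) => FieldC d ι) ℂ}
    (hI : I ∈ T.holN n (k + 1)) (hJ : J ∈ T.invariantN n k) (hD : T.diffN (n + 1) J = I) :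
    ∃ J' ∈ T.holN n k, T.diffN (n + 1) J' = I := by
  obtain ⟨q, hq, hhol⟩ := T.exists_polynomial_of_mem hJ
  obtain ⟨r, hr⟩ := exists_mul_X_eq hq
  refine ⟨_, hhol, ?_⟩
  set N := actN (N := n + 1) 1 (eulerLie d ι) with hN
  have h1 := LinearMap.congr_fun (commute_aeval (T.commute_diffN_eulerLie (n + 1)) q).eq J
  rw [Module.End.mul_apply, Module.End.mul_apply, hD] at h1
  rw [h1]
  have h2 := congrArg (fun p => Polynomial.aeval N p I) hr
  simp only [map_one, map_add, mul_comm Polynomial.X, map_mul, Polynomial.aeval_X,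
    LinearMap.add_apply, Module.End.mul_apply, (T.mem_holN_iff.1 hI).2, map_zero, add_zero,
    Module.End.one_apply, hN] at h2
  exact h2.symm

theorem differential_mul_self : T.differential * T.differential = 0 := by
  refine LinearMap.ext fun I => funext fun n => ?_
  change T.differential (T.differential I) n = 0
  rw [differential_apply, differential_apply, diffN_diffN]

theorem holLocal_le_invariantLocal (k : ℤ) : T.holLocal k ≤ T.invariantLocal k := fun _ hI =>
  T.mem_invariantLocal.2 fun n => (T.mem_holN_iff.1 (T.mem_holLocal.1 hI n)).1

theorem differential_mem_invariantLocal (k : ℤ) :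
    ∀ I ∈ T.invariantLocal k, T.differential I ∈ T.invariantLocal (k + 1) := fun I hI =>
  T.mem_invariantLocal.2 fun n => by
    rw [differential_apply]
    exact T.diffN_mem (T.mem_invariantLocal.1 hI n)

theorem differential_mem_holLocal (k : ℤ) :
    ∀ I ∈ T.holLocal k, T.differential I ∈ T.holLocal (k + 1) := fun I hI =>
  T.mem_holLocal.2 fun n => by
    rw [differential_apply]
    exact T.diffN_mem_holN (T.mem_holLocal.1 hI n)

end FreeTheory

end Comparison

end HolTrans

end

theorem mainTheorem5 {d : ℕ} {ι : Type*} [Fintype ι] (T : HolTrans.FreeTheory d ι) :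
    ∃ (hQ : T.differential * T.differential = 0)
      (hhol : ∀ k, ∀ I ∈ T.holLocal k, T.differential I ∈ T.holLocal (k + 1))
      (hinv : ∀ k, ∀ I ∈ T.invariantLocal k, T.differential I ∈ T.invariantLocal (k + 1))
      (hle : ∀ k, T.holLocal k ≤ T.invariantLocal k),
      QuasiIso (HolTrans.subcomplexInclusion T.differential hQ T.holLocal T.invariantLocal
        hhol hinv hle) := by
  refine ⟨T.differential_mul_self, T.differential_mem_holLocal, T.differential_mem_invariantLocal,
    T.holLocal_le_invariantLocal, HolTrans.quasiIso_subcomplexInclusion _ _ _ _ _ ?_ ?_⟩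
  · intro k I hI hD
    have hD' : ∀ n, T.diffN (n + 1) (I n) = 0 := fun n => by
      rw [← T.differential_apply, hD]
      rfl
    choose I' hI' J hJ h using fun n =>
      T.exists_decomposition (T.mem_invariantLocal.1 hI n) (hD' n)
    refine ⟨I', T.mem_holLocal.2 hI', ?_, J, T.mem_invariantLocal.2 hJ, ?_⟩
    · funext n
      have := congrArg (T.diffN (n + 1)) (h n)
      rw [map_add, T.diffN_diffN, add_zero, hD'] at this
      rw [T.differential_apply, ← this]
      rfl
    · funext n
      rw [Pi.add_apply, T.differential_apply, ← h]
  · intro k I hI J hJ hD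
    choose J' hJ' h using fun n => T.exists_primitive (T.mem_holLocal.1 hI n)
      (T.mem_invariantLocal.1 hJ n) (by rw [← T.differential_apply, hD])
    refine ⟨J', T.mem_holLocal.2 hJ', ?_⟩
    funext n
    rw [T.differential_apply, h]
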